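/- Let $\alpha\in(0,2)$, $C_\alpha=\left(\frac{(2-\alpha)(4-\alpha)}{\pi}\right)^{1/(4-\alpha)}$ and, for $\mu>0$, $\zeta\in\mathbb R^2$, $$U_{\mu,\zeta}(x)=\frac{4-\alpha}{2}\log\left(\frac{C_\alpha\mu}{1+\mu^2|x-\zeta|^2}\right),\qquad U=U_{1,0}.$$ Let $\varphi\in\dot H^1(\mathbb R^2)=\{u\in L^1_{loc}(\mathbb R^2):\nabla u\in L^2(\mathbb R^2)\}$ be a real-valued weak solution of $$-\Delta\varphi(x)=\mathfrak N(\varphi)(x):=\left(\int_{\mathbb R^2}\frac{e^{U(y)}\varphi(y)}{|x-y|^\alpha}dy\right)e^{U(x)}+\left(\int_{\mathbb R^2}\frac{e^{U(y)}}{|x-y|^\alpha}dy\right)e^{U(x)}\varphi(x)\quad\text{in }\mathbb R^2,$$ that is, $\int_{\mathbb R^2}\nabla\varphi\cdot\nabla\psi\,dx=\int_{\mathbb R^2}\mathfrak N(\varphi)\psi\,dx$ for all $\psi\in C_c^\infty(\mathbb R^2)$. Then, after modification of $\varphi$ on a null set, the following hold. 1. $\varphi\in L^\infty(\mathbb R^2)\cap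 C^\infty(\mathbb R^2)$; the functions $\Delta\varphi$ and $e^{\frac4{4-\alpha}U}\varphi$ are integrable, and $$-\int_{\mathbb R^2}\Delta\varphi\,dx=\frac{4(4-\alpha)}{C_\alpha^2}\int_{\mathbb R^2}e^{\frac{4}{4-\alpha}U(x)}\varphi(x)\,dx=0.$$ 2. There are constants $a_1,a_2,b\in\mathbb R$ such that $\varphi=a_1\varphi_1+a_2\varphi_2+b\varphi_3$, where $$\varphi_j(x)=\partial_{\zeta_j}U_{\mu,\zeta}(x)\big|_{\mu=1,\zeta=0}=\frac{(4-\alpha)x_j}{1+|x|^2}\ (j=1,2),\qquad \varphi_3(x)=\partial_\mu U_{\mu,\zeta}(x)\big|_{\mu=1,\zeta=0}=\frac{4-\alpha}{2}\,\frac{1-|x|^2}{1+|x|^2}.$$ 3. $\varphi\in H^1_w(\mathbb R^2)$ and $\|\varphi\|_{H^1_w}\le\sqrt{4(4-\alpha)+1}\;\|\varphi\|_{L^2_w}$, where $\|u\|_{L^2_w}=\left\|\frac{u}{1+|x|^2}\right\|_{L^2(\mathbb R^2)}$, $\|u\|_{H^1_w}=\left(\|\nabla u\|_{L^2(\mathbb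 R^2)}^2+\|u\|_{L^2_w}^2\right)^{1/2}$, and $H^1_w(\mathbb R^2)$ is the space of functions with $\|\nabla u\|_{L^2}+\|u\|_{L^2_w}<\infty$. -/

import Mathlib

open MeasureTheory
open scoped ContDiff

noncomputable section

namespace Choquard

/-- The Euclidean plane `ℝ²`. -/
abbrev Plane : Type := EuclideanSpace ℝ (Fin 2)

/-! ### Weak gradients and function spaces -/

/-- Test functions: `ψ ∈ C_c^∞(ℝ²)`. -/
def IsTestFunction (ψ : Plane → ℝ) : Prop :=
  ContDiff ℝ ∞ ψ ∧ HasCompactSupport ψ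

/-- `G` is a weak (distributional) gradient of `u`; both are locally integrable. -/
def HasWeakGradient (u : Plane → ℝ) (G : Plane → Plane) : Prop :=
  LocallyIntegrable u volume ∧ LocallyIntegrable G volume ∧
    ∀ ψ : Plane → ℝ, IsTestFunction ψ → ∀ i : Fin 2,
      ∫ x, u x * fderiv ℝ ψ x (EuclideanSpace.single i 1) = -∫ x, G x i * ψ x

open Classical in
/-- The weak gradient `∇u` (unique up to null sets), with the value `0` if there is none. -/
def weakGradient (u : Plane → ℝ) : Plane → Plane :=
  if h : ∃ G, HasWeakGradient u G then h.choose else 0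

/-- `u ∈ Ḣ¹(ℝ²)`: `u ∈ L¹_loc` has a weak gradient, which lies in `L²`. -/
def MemHomogeneousH1 (u : Plane → ℝ) : Prop :=
  ∃ G, HasWeakGradient u G ∧ MemLp G 2 volume

/-- The function `x ↦ u(x) / (1 + |x|²)`. -/
def weighted (u : Plane → ℝ) (x : Plane) : ℝ := u x / (1 + ‖x‖ ^ 2)

/-- `u ∈ L²_w(ℝ²)`. -/
def MemL2w (u : Plane → ℝ) : Prop := MemLp (weighted u) 2 volume

/-- `u ∈ H¹_w(ℝ²)`. -/
def MemH1w (u : Plane → ℝ) : Prop := MemHomogeneousH1 u ∧ MemL2w u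

/-- The norm of `L²_w(ℝ²)`. -/
def normL2w (u : Plane → ℝ) : ℝ := (eLpNorm (weighted u) 2 volume).toReal

/-- The norm of `H¹_w(ℝ²)`. -/
def normH1w (u : Plane → ℝ) : ℝ :=
  Real.sqrt ((eLpNorm (weakGradient u) 2 volume).toReal ^ 2 + normL2w u ^ 2)

/-! ### The bubbles and the linearized equation -/

/-- The constant `C_α = ((2 - α)(4 - α) / π)^(1 / (4 - α))`. -/
def bubbleConst (α : ℝ) : ℝ := ((2 - α) * (4 - α) / Real.pi) ^ (1 / (4 - α))

/-- The bubble `U_{μ,ζ}`. -/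
def bubble (α μ : ℝ) (ζ x : Plane) : ℝ :=
  (4 - α) / 2 * Real.log (bubbleConst α * μ / (1 + μ ^ 2 * ‖x - ζ‖ ^ 2))

/-- The standard bubble `U = U_{1,0}`. -/
def stdBubble (α : ℝ) (x : Plane) : ℝ := bubble α 1 0 x

/-- The right-hand side of the equation linearized at `U`. -/
def linearizedRHS (α : ℝ) (φ : Plane → ℝ) (x : Plane) : ℝ :=
  (∫ y, Real.exp (stdBubble α y) * φ y / ‖x - y‖ ^ α) * Real.exp (stdBubble α x) +
    (∫ y, Real.exp (stdBubble α y) / ‖x - y‖ ^ α) * Real.exp (stdBubble α x) * φ x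

/-- `φ` is a weak solution of the linearized equation `-Δφ = linearizedRHS α φ` in `ℝ²`. -/
def IsWeakSolution (α : ℝ) (φ : Plane → ℝ) : Prop :=
  ∃ G, HasWeakGradient φ G ∧ ∀ ψ : Plane → ℝ, IsTestFunction ψ →
    ∫ x, inner ℝ (G x) (gradient ψ x) = ∫ x, linearizedRHS α φ x * ψ x

/-- The functions `φ₁`, `φ₂`: `φ_j(x) = (4 - α) x_j / (1 + |x|²)`. -/
def kernelTranslation (α : ℝ) (j : Fin 2) (x : Plane) : ℝ :=
  (4 - α) * x j / (1 + ‖x‖ ^ 2)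

/-- The function `φ₃(x) = ((4 - α) / 2) (1 - |x|²) / (1 + |x|²)`. -/
def kernelDilation (α : ℝ) (x : Plane) : ℝ :=
  (4 - α) / 2 * ((1 - ‖x‖ ^ 2) / (1 + ‖x‖ ^ 2))

end Choquard

end

/-! Write w = 1 + |x|² for `weight`. Inverse stereographic projection carries dx / w²
(`sphereMeasure`) to a quarter of the surface measure of the unit sphere, and exp U is a constant
times w ^ (-(4 - α) / 2). By conformal covariance of the Riesz kernel the right-hand side becomes
w⁻² (c K + d) φ. Here K is the zonal operator with kernel s ^ (-α / 2) in s = `chord`, c = C_α ^ (4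
- α) and d = 2 (4 - α) (`linearizedRHS_eq`).

A function with square integrable gradient in the plane grows slowly enough in the mean to be
integrable on the sphere (`integrable_weight_mul`). Testing the equation with differences of
regularized logarithms then shows that F = (c K + d) φ has mean zero and that φ = const + G F, where
G is the zonal operator with the Green kernel -(4π)⁻¹ log s (`exists_ae_eq_zonal_greenKernel`). The
differential equation has become an integral equation on the sphere that involves only zonal
operators with strictly decreasing kernels.

Linear functions l on the sphere are eigenfunctions of every zonal operator, and they solve the
equation because λ(G) (c λ(K) + d) = (1/8) (2α + 8 - 2α) = 1. That there are no other solutions is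
proved without expansion in spherical harmonics, by a Schur test. Let R be the reflection in the
plane with normal n, and let l = ⟨n, ·⟩. On R-odd functions a zonal operator acts through the
antisymmetrized kernel, which is positive for two points on the same side of the mirror and negative
for points on opposite sides. Hence ∫ |l| |T h| ≤ λ(T) ∫ |l| |h| for odd h, with equality only if l
h has constant sign (`IsReflection.integral_abs_zonal_le`, `IsReflection.constSign_of_le`). The
relation between the eigenvalues forces equality for odd solutions, so that an odd solution
orthogonal to l vanishes (`IsLinearization.odd_eq`).

Consequently φ - φ ∘ R is a multiple of l for every reflection R. Subtracting a suitable linear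
function gives a solution g that is invariant under the three coordinate reflections, hence even
under the antipodal map. Then g - g ∘ R is even and also a multiple of an odd function, so it is
zero for all R. Thus g is constant, and the mean value condition makes it zero
(`IsLinearization.rigidity`). The solution is therefore linear on the sphere, and the three kernel
functions are multiples of the three coordinates. All remaining claims are computations for linear
functions: their Dirichlet energy is 8 times the squared weighted norm, and 8 ≤ 4 (4 - α). -/

noncomputable section

namespace Choquard

open Set Filter Topology

/-! ### Stereographic coordinates -/

/-- The conformal weight `1 + |x|²`. -/
def weight (x : Plane) : ℝ := 1 + ‖x‖ ^ 2

theorem weight_pos (x : Plane) : 0 < weight x := by unfold weight; positivity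

theorem weight_ne_zero (x : Plane) : weight x ≠ 0 := (weight_pos x).ne'

theorem one_le_weight (x : Plane) : 1 ≤ weight x := by unfold weight; nlinarith [sq_nonneg ‖x‖]

theorem norm_sq_eq_coord (x : Plane) : ‖x‖ ^ 2 = x 0 ^ 2 + x 1 ^ 2 := by
  rw [EuclideanSpace.real_norm_sq_eq, Fin.sum_univ_two]

theorem weight_eq_coord (x : Plane) : weight x = 1 + x 0 ^ 2 + x 1 ^ 2 := by
  rw [weight, norm_sq_eq_coord, add_assoc]

@[fun_prop]
theorem continuous_weight : Continuous weight := by unfold weight; fun_prop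

@[fun_prop]
theorem contDiff_weight {n : WithTop ℕ∞} : ContDiff ℝ n weight := by
  unfold weight
  exact contDiff_const.add (contDiff_norm_sq ℝ)

/-- Inverse stereographic projection, in coordinates of `ℝ³`. -/
def stereo (x : Plane) : Fin 3 → ℝ :=
  ![2 * x 0 / weight x, 2 * x 1 / weight x, (‖x‖ ^ 2 - 1) / weight x]

@[simp] theorem stereo_zero_apply (x : Plane) : stereo x 0 = 2 * x 0 / weight x := rfl
@[simp] theorem stereo_one_apply (x : Plane) : stereo x 1 = 2 * x 1 / weight x := rfl
@[simp] theorem stereo_two_apply (x : Plane) : stereo x 2 = (‖x‖ ^ 2 - 1) / weight x := rfl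

/-- The restriction of the linear form `⟨v, ·⟩` to the sphere, in stereographic coordinates. -/
def lin (v : Fin 3 → ℝ) (x : Plane) : ℝ := ∑ i, v i * stereo x i

/-- The square of (half) the chordal distance of two points. -/
def chord (x y : Plane) : ℝ := ‖x - y‖ ^ 2 / (weight x * weight y)

@[fun_prop]
theorem continuous_stereo (i : Fin 3) : Continuous fun x => stereo x i := by
  have := weight_ne_zero
  fin_cases i
  · exact Continuous.div (by fun_prop) (by fun_prop) this
  · exact Continuous.div (by fun_prop) (by fun_prop) this
  · exact Continuous.div (by fun_prop) (by fun_prop) this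

@[fun_prop]
theorem continuous_lin (v : Fin 3 → ℝ) : Continuous (lin v) := by
  unfold lin
  fun_prop

@[fun_prop]
theorem continuous_chord : Continuous fun p : Plane × Plane => chord p.1 p.2 := by
  unfold chord
  exact Continuous.div (by fun_prop) (by fun_prop)
    fun p => mul_ne_zero (weight_ne_zero _) (weight_ne_zero _)

theorem sum_stereo_sq (x : Plane) : ∑ i, stereo x i ^ 2 = 1 := by
  have hw := weight_ne_zero x
  rw [Fin.sum_univ_three]
  simp only [stereo_zero_apply, stereo_one_apply, stereo_two_apply, norm_sq_eq_coord]
  rw [weight_eq_coord] at *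
  field_simp
  ring

/-- For unit vectors |s - t|² / 4 = (1 - s · t) / 2. With this formula the effect of a reflection on
`chord` is linear algebra in ℝ³. -/
theorem chord_eq (x y : Plane) : chord x y = (1 - ∑ i, stereo x i * stereo y i) / 2 := by
  have hx := weight_ne_zero x
  have hy := weight_ne_zero y
  rw [Fin.sum_univ_three]
  simp only [stereo_zero_apply, stereo_one_apply, stereo_two_apply, chord, norm_sq_eq_coord,
    PiLp.sub_apply]
  rw [weight_eq_coord] at *
  rw [weight_eq_coord] at *
  field_simp
  ring

theorem chord_comm (x y : Plane) : chord x y = chord y x := by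
  rw [chord, chord, norm_sub_rev, mul_comm]

theorem chord_pos {x y : Plane} (h : x ≠ y) : 0 < chord x y :=
  div_pos (pow_pos (norm_pos_iff.2 (sub_ne_zero.2 h)) 2) (mul_pos (weight_pos x) (weight_pos y))

theorem eq_of_stereo_eq {x y : Plane} (h : ∀ i, stereo x i = stereo y i) : x = y := by
  by_contra hne
  have h1 := chord_pos hne
  have h2 := sum_stereo_sq x
  rw [chord_eq] at h1
  simp only [← h, ← sq, h2] at h1
  norm_num at h1

/-- 1 - `chord` is a quarter of the squared norm of the sum of the two unit vectors. -/
theorem chord_le_one (x y : Plane) : chord x y ≤ 1 := by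
  have h : 0 ≤ ∑ i, (stereo x i + stereo y i) ^ 2 := Finset.sum_nonneg fun i _ => sq_nonneg _
  have h1 := sum_stereo_sq x
  have h2 := sum_stereo_sq y
  rw [chord_eq]
  simp only [Fin.sum_univ_three] at *
  nlinarith

theorem abs_stereo_le (x : Plane) (i : Fin 3) : |stereo x i| ≤ 1 := by
  have h1 := sum_stereo_sq x
  have h2 : stereo x i ^ 2 ≤ ∑ i, stereo x i ^ 2 :=
    Finset.single_le_sum (f := fun i => stereo x i ^ 2) (fun i _ => sq_nonneg _)
      (Finset.mem_univ i)
  exact (sq_le_one_iff_abs_le_one _).1 (h2.trans h1.le)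

theorem abs_lin_le (v : Fin 3 → ℝ) (x : Plane) : |lin v x| ≤ ∑ i, |v i| := by
  refine (Finset.abs_sum_le_sum_abs _ _).trans (Finset.sum_le_sum fun i _ => ?_)
  rw [abs_mul]
  exact mul_le_of_le_one_right (abs_nonneg _) (abs_stereo_le x i)

theorem chord_zero_left (y : Plane) : chord 0 y = ‖y‖ ^ 2 / (1 + ‖y‖ ^ 2) := by
  simp [chord, weight]

theorem stereo_two_eq_chord (y : Plane) : stereo y 2 = 2 * chord 0 y - 1 := by
  have := weight_ne_zero y
  rw [chord_zero_left]
  simp only [stereo_two_apply, weight] at *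
  field_simp
  ring

/-! ### The inversions that correspond to reflections of the sphere -/

/-- The inversion with centre `a` that corresponds to a reflection of the sphere. -/
def circleInv (a : Plane) : Plane → Plane := EuclideanGeometry.inversion a √(weight a)

/-- The unit normal of the reflection that corresponds to `circleInv a`. -/
def circleNormal (a : Plane) : Fin 3 → ℝ :=
  ![-a 0 / √(weight a), -a 1 / √(weight a), 1 / √(weight a)]

theorem sqrt_weight_pos (x : Plane) : 0 < √(weight x) := Real.sqrt_pos.2 (weight_pos x)

theorem circleInv_apply (a x : Plane) (i : Fin 2) :
    circleInv a x i = weight a / ‖x - a‖ ^ 2 * (x i - a i) + a i := by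
  simp [circleInv, EuclideanGeometry.inversion, div_pow, Real.sq_sqrt (weight_pos a).le,
    dist_eq_norm]

/-- The inversion has conformal factor `weight a / ‖x - a‖ ^ 2`, and this is exactly the factor by
which the weight changes. Invariance of the measure follows. -/
theorem weight_circleInv {a x : Plane} (h : x ≠ a) :
    weight (circleInv a x) = weight a * weight x / ‖x - a‖ ^ 2 := by
  have hq : ‖x - a‖ ^ 2 ≠ 0 := pow_ne_zero _ (norm_ne_zero_iff.2 (sub_ne_zero.2 h))
  rw [weight_eq_coord, circleInv_apply, circleInv_apply]
  simp only [weight_eq_coord, norm_sq_eq_coord, PiLp.sub_apply] at *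
  field_simp
  ring

theorem sum_circleNormal_sq (a : Plane) : ∑ i, circleNormal a i ^ 2 = 1 := by
  have h := (sqrt_weight_pos a).ne'
  have h2 := Real.sq_sqrt (weight_pos a).le
  rw [Fin.sum_univ_three]
  simp only [circleNormal, Matrix.cons_val]
  field_simp
  rw [h2, weight_eq_coord]
  ring

/-- The product of the two factors no longer contains `√(weight a)`, so the reflection formula below
becomes an identity of rational functions. -/
theorem lin_circleNormal_mul (a x : Plane) (i : Fin 3) :
    lin (circleNormal a) x * circleNormal a i =
      (‖x‖ ^ 2 - 1 - 2 * (a 0 * x 0 + a 1 * x 1)) / (weight x * weight a) *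
        (![-a 0, -a 1, 1] : Fin 3 → ℝ) i := by
  have h := (sqrt_weight_pos a).ne'
  have hw := weight_ne_zero x
  have h2 := Real.sq_sqrt (weight_pos a).le
  have h3 : lin (circleNormal a) x =
      (‖x‖ ^ 2 - 1 - 2 * (a 0 * x 0 + a 1 * x 1)) / (weight x * √(weight a)) := by
    simp only [lin, Fin.sum_univ_three, circleNormal, Matrix.cons_val, stereo]
    field_simp
    ring
  have h4 : circleNormal a i = (![-a 0, -a 1, 1] : Fin 3 → ℝ) i / √(weight a) := by
    fin_cases i <;> simp [circleNormal]
  rw [h3, h4]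
  rw [div_mul_div_comm, mul_assoc, ← sq, h2]
  ring

theorem stereo_circleInv {a x : Plane} (h : x ≠ a) (i : Fin 3) :
    stereo (circleInv a x) i =
      stereo x i - 2 * lin (circleNormal a) x * circleNormal a i := by
  have hq : ‖x - a‖ ^ 2 ≠ 0 := pow_ne_zero _ (norm_ne_zero_iff.2 (sub_ne_zero.2 h))
  have ha := weight_ne_zero a
  have hx := weight_ne_zero x
  rw [mul_assoc, lin_circleNormal_mul]
  have hW := weight_circleInv h
  have hn : ‖circleInv a x‖ ^ 2 = weight (circleInv a x) - 1 := by rw [weight]; ring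
  fin_cases i
  · simp only [Fin.zero_eta, stereo_zero_apply, hW, circleInv_apply, Matrix.cons_val]
    simp only [weight_eq_coord, norm_sq_eq_coord, PiLp.sub_apply] at *
    field_simp
    ring
  · simp only [Fin.mk_one, stereo_one_apply, hW, circleInv_apply, Matrix.cons_val]
    simp only [weight_eq_coord, norm_sq_eq_coord, PiLp.sub_apply] at *
    field_simp
    ring
  · simp only [Fin.reduceFinMk, stereo_two_apply, hn, hW, Matrix.cons_val]
    simp only [weight_eq_coord, norm_sq_eq_coord, PiLp.sub_apply] at *
    field_simp
    ring

/-- The centre a = -x / |x|² lies on the line through 0 and x, with 0 between a and x, and |a| |x -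
a| = 1 + |x|⁻² = 1 + |a|², the squared radius. -/
theorem circleInv_zero_of_swap {x : Plane} (hx : x ≠ 0) :
    circleInv (-(‖x‖ ^ 2)⁻¹ • x) 0 = x := by
  have hq : ‖x‖ ^ 2 ≠ 0 := pow_ne_zero _ (norm_ne_zero_iff.2 hx)
  have h1 : ‖(0 : Plane) - -(‖x‖ ^ 2)⁻¹ • x‖ ^ 2 = (‖x‖ ^ 2)⁻¹ := by
    rw [zero_sub, norm_neg, norm_smul, mul_pow, norm_neg, norm_inv, norm_pow, norm_norm]
    field_simp
  have h2 : weight (-(‖x‖ ^ 2)⁻¹ • x) = 1 + (‖x‖ ^ 2)⁻¹ := by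
    rw [zero_sub, norm_neg] at h1
    rw [weight, h1]
  ext i
  rw [circleInv_apply, h1, h2]
  simp only [PiLp.smul_apply, PiLp.zero_apply, smul_eq_mul]
  field_simp
  ring

theorem swapCenter_ne_zero {x : Plane} (hx : x ≠ 0) : -(‖x‖ ^ 2)⁻¹ • x ≠ 0 :=
  smul_ne_zero (neg_ne_zero.2 (inv_ne_zero (pow_ne_zero _ (norm_ne_zero_iff.2 hx)))) hx

/-- Reflection of the plane in a coordinate axis. -/
def axisRefl (j : Fin 2) (x : Plane) : Plane :=
  WithLp.toLp 2 fun i => if i = j then -x i else x i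

theorem norm_axisRefl (j : Fin 2) (x : Plane) : ‖axisRefl j x‖ = ‖x‖ := by
  refine (sq_eq_sq₀ (norm_nonneg _) (norm_nonneg _)).1 ?_
  rw [norm_sq_eq_coord, norm_sq_eq_coord]
  fin_cases j <;> simp [axisRefl]

/-! ### The measure of the sphere in stereographic coordinates -/

/-- A quarter of the surface measure of the unit sphere, in stereographic coordinates. -/
def sphereMeasure : Measure Plane :=
  volume.withDensity fun x => ENNReal.ofReal ((weight x ^ 2)⁻¹)

theorem measurable_density : Measurable fun x : Plane => ENNReal.ofReal ((weight x ^ 2)⁻¹) := by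
  fun_prop

theorem integrable_sphereMeasure_iff {h : Plane → ℝ} :
    Integrable h sphereMeasure ↔ Integrable fun x => (weight x ^ 2)⁻¹ * h x := by
  have h1 : ∀ x : Plane, 0 ≤ (weight x ^ 2)⁻¹ := fun x => by positivity
  rw [sphereMeasure, integrable_withDensity_iff_integrable_smul' measurable_density (by simp)]
  simp [ENNReal.toReal_ofReal (h1 _)]

theorem integral_sphereMeasure (h : Plane → ℝ) :
    ∫ x, h x ∂sphereMeasure = ∫ x, (weight x ^ 2)⁻¹ * h x := by
  have h1 : ∀ x : Plane, 0 ≤ (weight x ^ 2)⁻¹ := fun x => by positivity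
  rw [sphereMeasure, integral_withDensity_eq_integral_toReal_smul measurable_density (by simp)]
  simp [ENNReal.toReal_ofReal (h1 _)]

theorem sphereMeasure_ac : sphereMeasure ≪ volume := withDensity_absolutelyContinuous _ _

theorem ac_sphereMeasure : volume ≪ sphereMeasure := by
  refine withDensity_absolutelyContinuous' measurable_density.aemeasurable (ae_of_all _ fun x => ?_)
  have := weight_pos x
  simpa using this.ne'

theorem ae_sphereMeasure {p : Plane → Prop} : (∀ᵐ x ∂sphereMeasure, p x) ↔ ∀ᵐ x, p x :=
  ⟨fun h => ac_sphereMeasure h, fun h => sphereMeasure_ac h⟩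

theorem ae_eq_sphereMeasure {f g : Plane → ℝ} : f =ᵐ[sphereMeasure] g ↔ f =ᵐ[volume] g :=
  ae_sphereMeasure

instance : NullSingletonClass sphereMeasure := ⟨fun x => sphereMeasure_ac (measure_singleton x)⟩

theorem ae_ne (a : Plane) : ∀ᵐ x ∂sphereMeasure, x ≠ a := by
  simp [ae_iff]

theorem integrable_weight_rpow {r : ℝ} (hr : 1 < r) :
    Integrable fun x : Plane => weight x ^ (-r) := by
  have h := integrable_rpow_neg_one_add_norm_sq (E := Plane) (μ := volume) (r := 2 * r)
    (by simp; linarith)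
  refine h.congr (ae_of_all _ fun x => ?_)
  simp only [weight]
  congr 1
  ring

theorem integrable_inv_weight_sq : Integrable fun x : Plane => (weight x ^ 2)⁻¹ := by
  refine (integrable_weight_rpow (r := 2) (by norm_num)).congr (ae_of_all _ fun x => ?_)
  simp only
  rw [Real.rpow_neg (weight_pos x).le, Real.rpow_two]

instance : IsFiniteMeasure sphereMeasure :=
  isFiniteMeasure_withDensity_ofReal integrable_inv_weight_sq.2

theorem integrable_of_continuous_bounded {h : Plane → ℝ} (hc : Continuous h) {C : ℝ}
    (hb : ∀ x, |h x| ≤ C) : Integrable h sphereMeasure :=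
  Integrable.of_bound hc.aestronglyMeasurable C (ae_of_all _ hb)

theorem integrable_stereo (i : Fin 3) : Integrable (fun x => stereo x i) sphereMeasure :=
  integrable_of_continuous_bounded (continuous_stereo i) fun x => abs_stereo_le x i

theorem integrable_lin (v : Fin 3 → ℝ) : Integrable (lin v) sphereMeasure :=
  integrable_of_continuous_bounded (continuous_lin v) (abs_lin_le v)

/-! ### Reflections preserve the measure -/

/-- `R` corresponds to the reflection of the sphere in the plane with unit normal `n`. -/
structure IsReflection (n : Fin 3 → ℝ) (R : Plane → Plane) : Prop where
  unit : ∑ i, n i ^ 2 = 1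
  involutive : Function.Involutive R
  preserving : MeasurePreserving R sphereMeasure sphereMeasure
  stereo_apply : ∀ᵐ x ∂sphereMeasure, ∀ i, stereo (R x) i = stereo x i - 2 * lin n x * n i
  lin_ne_zero : ∀ᵐ x ∂sphereMeasure, lin n x ≠ 0

theorem measurable_circleInv (a : Plane) : Measurable (circleInv a) := by
  unfold circleInv EuclideanGeometry.inversion
  simp only [vsub_eq_sub, vadd_eq_add]
  fun_prop

theorem circleInv_involutive (a : Plane) : Function.Involutive (circleInv a) :=
  EuclideanGeometry.inversion_involutive a (sqrt_weight_pos a).ne'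

/-- Change of variables: the Jacobian of the inversion cancels the change of the density computed in
`weight_circleInv`. -/
theorem measurePreserving_circleInv (a : Plane) :
    MeasurePreserving (circleInv a) sphereMeasure sphereMeasure := by
  refine ⟨measurable_circleInv a, ?_⟩
  ext s hs
  rw [Measure.map_apply (measurable_circleInv a) hs]
  have hms : MeasurableSet (circleInv a ⁻¹' s) := measurable_circleInv a hs
  have hS : MeasurableSet (circleInv a ⁻¹' s ∩ {a}ᶜ) :=
    hms.inter (measurableSet_singleton a).compl
  have himg : circleInv a '' (circleInv a ⁻¹' s ∩ {a}ᶜ) = s ∩ {a}ᶜ := by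
    ext y
    constructor
    · rintro ⟨x, ⟨hx, hxa⟩, rfl⟩
      exact ⟨hx, fun h => hxa ((EuclideanGeometry.inversion_eq_center (sqrt_weight_pos a).ne').1 h)⟩
    · rintro ⟨hy, hya⟩
      refine ⟨circleInv a y, ⟨?_, fun h => hya
        ((EuclideanGeometry.inversion_eq_center (sqrt_weight_pos a).ne').1 h)⟩,
        circleInv_involutive a y⟩
      simpa [circleInv_involutive a y] using hy
  -- The centre, which the inversion fixes by convention and where it is not differentiable, is a
  -- null set and is removed from both sides.
  have hinter : ∀ t : Set Plane, sphereMeasure t = sphereMeasure (t ∩ {a}ᶜ) := fun t =>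
    (measure_inter_conull (by rw [compl_compl]; exact measure_singleton a)).symm
  have hd : ∀ x ∈ circleInv a ⁻¹' s ∩ {a}ᶜ, HasFDerivWithinAt (circleInv a)
      ((√(weight a) / dist x a) ^ 2 •
        ((Submodule.span ℝ {x - a})ᗮ.reflection : Plane →L[ℝ] Plane))
      (circleInv a ⁻¹' s ∩ {a}ᶜ) x := fun x hx =>
    (EuclideanGeometry.hasFDerivAt_inversion (c := a) (R := √(weight a)) hx.2).hasFDerivWithinAt
  rw [hinter, hinter s, sphereMeasure, withDensity_apply _ hS, ← himg,
    withDensity_apply _ (himg ▸ hs.inter (measurableSet_singleton a).compl),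
    lintegral_image_eq_lintegral_abs_det_fderiv_mul volume hS hd
      (circleInv_involutive a).injective.injOn]
  refine setLIntegral_congr_fun hS fun x hx => ?_
  have hxa : x ≠ a := hx.2
  have hq : ‖x - a‖ ≠ 0 := norm_ne_zero_iff.2 (sub_ne_zero.2 hxa)
  -- The derivative is a scalar times a reflection. In dimension two the scalar enters the
  -- determinant squared, and the reflection contributes only a sign.
  have hdet : |(((√(weight a) / dist x a) ^ 2 •
      ((Submodule.span ℝ {x - a})ᗮ.reflection : Plane →L[ℝ] Plane))).det| =
      (weight a / ‖x - a‖ ^ 2) ^ 2 := by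
    have h1 : ((√(weight a) / dist x a) ^ 2 •
      ((Submodule.span ℝ {x - a})ᗮ.reflection : Plane →L[ℝ] Plane)).det =
      ((√(weight a) / dist x a) ^ 2) ^ 2 *
        LinearMap.det ((Submodule.span ℝ {x - a})ᗮ.reflection.toLinearEquiv :
          Plane →ₗ[ℝ] Plane) := by
      have h2 := LinearMap.det_smul ((√(weight a) / dist x a) ^ 2)
        ((Submodule.span ℝ {x - a})ᗮ.reflection.toLinearEquiv : Plane →ₗ[ℝ] Plane)
      rw [finrank_euclideanSpace_fin] at h2
      exact h2
    rw [h1, Submodule.det_reflection, abs_mul, abs_neg_one_pow, mul_one,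
      abs_of_nonneg (by positivity), div_pow, Real.sq_sqrt (weight_pos a).le,
      dist_eq_norm]
  simp only [hdet, weight_circleInv hxa]
  rw [← ENNReal.ofReal_mul (by positivity)]
  congr 1
  have := weight_ne_zero a
  have := weight_ne_zero x
  field_simp

theorem isReflection_circleInv (a : Plane) : IsReflection (circleNormal a) (circleInv a) where
  unit := sum_circleNormal_sq a
  involutive := circleInv_involutive a
  preserving := measurePreserving_circleInv a
  stereo_apply := by
    filter_upwards [ae_ne a] with x hx
    exact stereo_circleInv hx
  lin_ne_zero := by
    rw [ae_sphereMeasure]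
    -- The mirror of the reflection meets the sphere in a great circle, whose image in the plane
    -- lies on the circle of inversion.
    have h0 : volume (Metric.sphere a √(weight a)) = 0 :=
      Measure.addHaar_sphere_of_ne_zero _ _ (sqrt_weight_pos a).ne'
    refine measure_mono_null (fun x hx => ?_) h0
    have hx : lin (circleNormal a) x = 0 := by simpa using hx
    have h1 := lin_circleNormal_mul a x 2
    have hw := weight_pos x
    have hw' := weight_pos a
    rw [hx, zero_mul, eq_comm] at h1
    simp only [Matrix.cons_val, mul_one] at h1
    rw [div_eq_zero_iff, or_iff_left (mul_pos hw hw').ne'] at h1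
    rw [mem_sphere_iff_norm, ← sq_eq_sq₀ (norm_nonneg _) (Real.sqrt_nonneg _),
      Real.sq_sqrt hw'.le, norm_sq_eq_coord, weight_eq_coord]
    simp only [PiLp.sub_apply, norm_sq_eq_coord] at *
    linarith

/-- `axisRefl` as a linear isometry. -/
def axisReflEquiv (j : Fin 2) : Plane ≃ₗᵢ[ℝ] Plane :=
  LinearIsometryEquiv.piLpCongrRight 2
    fun i => if i = j then LinearIsometryEquiv.neg ℝ else LinearIsometryEquiv.refl ℝ ℝ

theorem axisReflEquiv_apply (j : Fin 2) (x : Plane) : axisReflEquiv j x = axisRefl j x := by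
  ext i
  by_cases h : i = j <;> simp [axisReflEquiv, axisRefl, h]

theorem measurePreserving_axisRefl (j : Fin 2) :
    MeasurePreserving (axisRefl j) sphereMeasure sphereMeasure := by
  have h0 : ⇑(axisReflEquiv j) = axisRefl j := funext (axisReflEquiv_apply j)
  have h1 := (axisReflEquiv j).measurePreserving
  have hm : Measurable (axisRefl j) := h0 ▸ h1.measurable
  rw [h0] at h1
  refine ⟨hm, ?_⟩
  ext s hs
  rw [Measure.map_apply hm hs, sphereMeasure, withDensity_apply _ (hm hs), withDensity_apply _ hs,
    ← h1.setLIntegral_comp_preimage hs measurable_density]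
  simp [weight, norm_axisRefl]

theorem isReflection_axisRefl (j : Fin 2) :
    IsReflection (Pi.single j.castSucc 1) (axisRefl j) where
  unit := by fin_cases j <;> simp [Pi.single_apply]
  involutive x := by
    ext i
    by_cases h : i = j <;> simp [axisRefl, h]
  preserving := measurePreserving_axisRefl j
  stereo_apply := by
    refine ae_of_all _ fun x i => ?_
    have hw : ∀ j, weight (axisRefl j x) = weight x := fun j => by simp [weight, norm_axisRefl]
    have h0 : ∀ j i, axisRefl j x i = if i = j then -x i else x i := fun j i => rfl
    fin_cases j <;> fin_cases i <;>
      simp [lin, Fin.sum_univ_three, stereo, hw, norm_axisRefl, h0] <;> ring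
  lin_ne_zero := by
    rw [ae_sphereMeasure]
    have hsub : LinearMap.ker (EuclideanSpace.proj j : Plane →L[ℝ] ℝ).toLinearMap ≠ ⊤ := by
      intro h
      have h1 : EuclideanSpace.single j (1 : ℝ) ∈
          LinearMap.ker (EuclideanSpace.proj j : Plane →L[ℝ] ℝ).toLinearMap := h ▸ Submodule.mem_top
      simp at h1
    refine measure_mono_null (fun x hx => ?_) (Measure.addHaar_submodule volume _ hsub)
    have hw := weight_ne_zero x
    have hx : lin (Pi.single j.castSucc 1) x = 0 := by simpa using hx
    have hx' : stereo x j.castSucc = 0 := by simpa [lin, Pi.single_apply] using hx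
    fin_cases j <;> simpa [hw] using hx'

namespace IsReflection

variable {n : Fin 3 → ℝ} {R : Plane → Plane}

theorem measurableEmbedding (hR : IsReflection n R) : MeasurableEmbedding R :=
  (MeasurableEquiv.mk hR.involutive.toPerm hR.preserving.measurable
    hR.preserving.measurable).measurableEmbedding

theorem integral_comp (hR : IsReflection n R) (h : Plane → ℝ) :
    ∫ x, h (R x) ∂sphereMeasure = ∫ x, h x ∂sphereMeasure :=
  hR.preserving.integral_comp hR.measurableEmbedding h

theorem integrable_comp (hR : IsReflection n R) {h : Plane → ℝ} (hh : Integrable h sphereMeasure) :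
    Integrable (fun x => h (R x)) sphereMeasure :=
  hR.preserving.integrable_comp_of_integrable hh

theorem ae_comp (hR : IsReflection n R) {p : Plane → Prop} (hp : ∀ᵐ x ∂sphereMeasure, p x) :
    ∀ᵐ x ∂sphereMeasure, p (R x) :=
  hR.preserving.quasiMeasurePreserving.ae hp

/-- Replacing y by its mirror image changes the chord by the product of the two signed distances to
the mirror. So y is nearer to x than `R y` exactly when x and y lie on the same side. -/
theorem chord_apply (hR : IsReflection n R) :
    ∀ᵐ y ∂sphereMeasure, ∀ x, chord x (R y) = chord x y + lin n x * lin n y := by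
  filter_upwards [hR.stereo_apply] with y hy x
  rw [chord_eq, chord_eq]
  simp only [hy, lin, Fin.sum_univ_three]
  ring

theorem lin_apply (hR : IsReflection n R) (v : Fin 3 → ℝ) :
    ∀ᵐ x ∂sphereMeasure, lin v (R x) = lin v x - 2 * (∑ i, v i * n i) * lin n x := by
  filter_upwards [hR.stereo_apply] with x hx
  simp only [lin, hx, Fin.sum_univ_three]
  ring

theorem lin_normal_apply (hR : IsReflection n R) :
    ∀ᵐ x ∂sphereMeasure, lin n (R x) = -lin n x := by
  have h := hR.unit
  simp only [sq] at h
  filter_upwards [hR.lin_apply n] with x hx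
  rw [hx, h]
  ring

/-- Two applications of `chord_apply`, one in each variable; the two correction terms cancel because
`lin n` is odd. -/
theorem chord_apply_apply (hR : IsReflection n R) :
    ∀ᵐ x ∂sphereMeasure, ∀ᵐ y ∂sphereMeasure, chord (R x) (R y) = chord x y := by
  filter_upwards [hR.chord_apply, hR.lin_normal_apply] with x hx hlx
  filter_upwards [hR.chord_apply] with y hy
  rw [hy, chord_comm, hx, hlx, chord_comm]
  ring

end IsReflection

/-! ### Zonal integral operators -/

/-- The variable s = r² / (1 + r²) is the chord from the origin to a point at distance r. It
straightens the measure, since r dr / (1 + r²)² = ds / 2. -/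
theorem image_chordRadius :
    (fun r : ℝ => r ^ 2 / (1 + r ^ 2)) '' Ioi 0 = Ioo 0 1 := by
  ext s
  constructor
  · rintro ⟨r, hr, rfl⟩
    have hr : 0 < r := hr
    exact ⟨by positivity, by rw [div_lt_one (by positivity)]; linarith⟩
  · rintro ⟨h0, h1⟩
    refine ⟨√(s / (1 - s)), Real.sqrt_pos.2 (div_pos h0 (by linarith)), ?_⟩
    have h2 : 1 - s ≠ 0 := by linarith
    simp only
    rw [Real.sq_sqrt (div_pos h0 (by linarith)).le]
    field_simp
    ring

theorem injOn_chordRadius : InjOn (fun r : ℝ => r ^ 2 / (1 + r ^ 2)) (Ioi 0) := by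
  intro r hr s hs h
  have hr : 0 < r := hr
  have hs : 0 < s := hs
  simp only at h
  rw [div_eq_div_iff (by positivity) (by positivity)] at h
  exact (sq_eq_sq₀ hr.le hs.le).1 (by linarith)

theorem hasDerivAt_chordRadius (r : ℝ) :
    HasDerivAt (fun r : ℝ => r ^ 2 / (1 + r ^ 2)) (2 * r / (1 + r ^ 2) ^ 2) r := by
  have h : 1 + r ^ 2 ≠ 0 := by positivity
  have h1 := ((hasDerivAt_pow 2 r).div ((hasDerivAt_pow 2 r).const_add 1) h)
  refine h1.congr_deriv ?_
  push_cast
  congr 1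
  ring

theorem radial_integrand_eq (k : ℝ → ℝ) {r : ℝ} (hr : r ∈ Ioi (0 : ℝ)) :
    r ^ (Module.finrank ℝ Plane - 1) • (((1 + r ^ 2) ^ 2)⁻¹ * k (r ^ 2 / (1 + r ^ 2))) =
      2⁻¹ * |2 * r / (1 + r ^ 2) ^ 2| • k (r ^ 2 / (1 + r ^ 2)) := by
  have hr : 0 < r := hr
  rw [abs_of_pos (by positivity), finrank_euclideanSpace_fin]
  simp only [Nat.add_one_sub_one, pow_one, smul_eq_mul]
  field_simp

theorem integrable_comp_chord_zero {k : ℝ → ℝ} (hk : IntegrableOn k (Ioo 0 1)) :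
    Integrable (fun y => k (chord 0 y)) sphereMeasure := by
  rw [← image_chordRadius, integrableOn_image_iff_integrableOn_abs_deriv_smul measurableSet_Ioi
    (fun r _ => (hasDerivAt_chordRadius r).hasDerivWithinAt) injOn_chordRadius] at hk
  rw [integrable_sphereMeasure_iff]
  simp only [chord_zero_left, weight]
  refine (integrable_fun_norm_addHaar (E := Plane) volume
    (f := fun r => ((1 + r ^ 2) ^ 2)⁻¹ * k (r ^ 2 / (1 + r ^ 2)))).2 ?_
  exact IntegrableOn.congr_fun (Integrable.const_mul hk 2⁻¹)
    (fun r hr => (radial_integrand_eq k hr).symm) measurableSet_Ioi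

theorem volume_real_unitBall : volume.real (Metric.ball (0 : Plane) 1) = Real.pi := by
  rw [Measure.real, EuclideanSpace.volume_ball_fin_two]
  simp [Real.pi_pos.le]

/-- Archimedes: the height is uniformly distributed on the sphere. Polar coordinates contribute 2π,
and the substitution contributes 1/2. -/
theorem integral_comp_chord_zero (k : ℝ → ℝ) :
    ∫ y, k (chord 0 y) ∂sphereMeasure = Real.pi * ∫ s in Ioo (0 : ℝ) 1, k s := by
  rw [← image_chordRadius, integral_image_eq_integral_abs_deriv_smul measurableSet_Ioi
    (fun r _ => (hasDerivAt_chordRadius r).hasDerivWithinAt) injOn_chordRadius,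
    integral_sphereMeasure]
  simp only [chord_zero_left, weight]
  have h := integral_fun_norm_addHaar (E := Plane) volume
    (fun r => ((1 + r ^ 2) ^ 2)⁻¹ * k (r ^ 2 / (1 + r ^ 2)))
  rw [setIntegral_congr_fun measurableSet_Ioi fun r hr => radial_integrand_eq k hr] at h
  rw [h, volume_real_unitBall, integral_const_mul, finrank_euclideanSpace_fin]
  simp only [smul_eq_mul, nsmul_eq_mul]
  push_cast
  ring

/-- Both points are moved by the same orthogonal reflection of ℝ³, so their inner product is
unchanged; the only relation needed is that the normal has length one. -/
theorem chord_circleInv {a x y : Plane} (hx : x ≠ a) (hy : y ≠ a) :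
    chord (circleInv a x) (circleInv a y) = chord x y := by
  have h := sum_circleNormal_sq a
  have hs := stereo_circleInv hx
  have ht := stereo_circleInv hy
  rw [chord_eq, chord_eq]
  simp only [hs, ht, lin, Fin.sum_univ_three] at *
  linear_combination (-2) * (circleNormal a 0 * stereo x 0 + circleNormal a 1 * stereo x 1 +
    circleNormal a 2 * stereo x 2) * (circleNormal a 0 * stereo y 0 +
    circleNormal a 1 * stereo y 1 + circleNormal a 2 * stereo y 2) * h

/-- Two points of the plane are exchanged with the origin by an inversion. -/
theorem exists_swap (x : Plane) (hx : x ≠ 0) :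
    ∃ a : Plane, a ≠ 0 ∧ circleInv a 0 = x ∧
      ∀ᵐ y ∂sphereMeasure, chord x (circleInv a y) = chord 0 y := by
  obtain ⟨a, ha0, hax⟩ : ∃ a : Plane, a ≠ 0 ∧ circleInv a 0 = x :=
    ⟨_, swapCenter_ne_zero hx, circleInv_zero_of_swap hx⟩
  refine ⟨a, ha0, hax, ?_⟩
  filter_upwards [ae_ne a] with y hy
  rw [← hax, chord_circleInv ha0.symm hy]

/-- The integral operator with kernel `k (chord x y)`. -/
def zonal (k : ℝ → ℝ) (h : Plane → ℝ) (x : Plane) : ℝ :=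
  ∫ y, k (chord x y) * h y ∂sphereMeasure

/-- Kernels for which zonal operators are bounded on `L¹`. -/
structure IsKernel (k : ℝ → ℝ) : Prop where
  measurable : Measurable k
  integrable : IntegrableOn k (Ioo 0 1)

theorem zonal_congr (k : ℝ → ℝ) {g h : Plane → ℝ} (hgh : g =ᵐ[sphereMeasure] h) :
    zonal k g = zonal k h := by
  funext x
  refine integral_congr_ae ?_
  filter_upwards [hgh] with y hy
  rw [hy]

namespace IsKernel

variable {k : ℝ → ℝ}

theorem integrable_comp_chord (hk : IsKernel k) (x : Plane) :
    Integrable (fun y => k (chord x y)) sphereMeasure := by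
  by_cases hx : x = 0
  · rw [hx]
    exact integrable_comp_chord_zero hk.integrable
  obtain ⟨a, -, -, ha⟩ := exists_swap x hx
  have hR := isReflection_circleInv a
  refine (hR.preserving.integrable_comp_emb hR.measurableEmbedding).1 ?_
  refine (integrable_comp_chord_zero hk.integrable).congr ?_
  filter_upwards [ha] with y hy
  simp [hy]

/-- An inversion that exchanges x with the origin preserves the measure, so the value does not
depend on x. This uniformity gives the bound on L¹ and the action on constants. -/
theorem integral_comp_chord (x : Plane) :
    ∫ y, k (chord x y) ∂sphereMeasure = Real.pi * ∫ s in Ioo (0 : ℝ) 1, k s := by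
  by_cases hx : x = 0
  · rw [hx]
    exact integral_comp_chord_zero k
  obtain ⟨a, -, -, ha⟩ := exists_swap x hx
  rw [← integral_comp_chord_zero, ← (isReflection_circleInv a).integral_comp]
  refine integral_congr_ae ?_
  filter_upwards [ha] with y hy
  rw [hy]

theorem integrable_mul_bounded (hk : IsKernel k) (x : Plane) {h : Plane → ℝ} (hc : Continuous h)
    {C : ℝ} (hb : ∀ y, |h y| ≤ C) :
    Integrable (fun y => k (chord x y) * h y) sphereMeasure :=
  (hk.integrable_comp_chord x).mul_bdd hc.aestronglyMeasurable (ae_of_all _ hb)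

/-- At the south pole the first two coordinates integrate to zero by oddness. The third is 2s - 1 in
the chord variable s, and it equals -1 at the pole. -/
theorem zonal_stereo_zero (k : ℝ → ℝ) (i : Fin 3) :
    zonal k (fun y => stereo y i) 0 =
      (Real.pi * ∫ s in Ioo (0 : ℝ) 1, k s * (1 - 2 * s)) * stereo 0 i := by
  have hodd : ∀ j : Fin 2, zonal k (fun y => stereo y j.castSucc) 0 = 0 := by
    intro j
    have hR := isReflection_axisRefl j
    have h1 := hR.integral_comp fun y => k (chord 0 y) * stereo y j.castSucc
    have h2 : ∫ y, k (chord 0 (axisRefl j y)) * stereo (axisRefl j y) j.castSucc ∂sphereMeasure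
        = -∫ y, k (chord 0 y) * stereo y j.castSucc ∂sphereMeasure := by
      rw [← integral_neg]
      refine integral_congr_ae ?_
      filter_upwards [hR.stereo_apply] with y hy
      rw [hy, chord_zero_left, chord_zero_left, norm_axisRefl]
      have : lin (Pi.single j.castSucc 1) y = stereo y j.castSucc := by
        simp [lin, Pi.single_apply]
      rw [this, Pi.single_eq_same]
      ring
    unfold zonal
    linarith
  fin_cases i
  · simpa using hodd 0
  · simpa using hodd 1
  · have h := integral_comp_chord_zero fun s => k s * (1 - 2 * s)
    have h0 : stereo 0 2 = -1 := by simp [weight]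
    simp only [Fin.reduceFinMk, h0, zonal, stereo_two_eq_chord]
    rw [← h, mul_neg_one, ← integral_neg]
    congr 1
    ext y
    ring

/-- The coordinate functions are eigenfunctions of zonal operators. -/
theorem zonal_stereo (hk : IsKernel k) (i : Fin 3) (x : Plane) :
    zonal k (fun y => stereo y i) x =
      (Real.pi * ∫ s in Ioo (0 : ℝ) 1, k s * (1 - 2 * s)) * stereo x i := by
  by_cases hx : x = 0
  · rw [hx]
    exact zonal_stereo_zero k i
  obtain ⟨a, ha0, hax, ha⟩ := exists_swap x hx
  have hR := isReflection_circleInv a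
  have hint : ∀ j, Integrable (fun y => k (chord 0 y) * stereo y j) sphereMeasure := fun j =>
    hk.integrable_mul_bounded 0 (continuous_stereo j) fun y => abs_stereo_le y j
  -- The vector of the three values at x is the mirror image of the vector of values at the origin,
  -- because the inversion moves the base point and reflects the coordinates.
  have h1 : zonal k (fun y => stereo y i) x = zonal k (fun y => stereo y i) 0 -
      2 * circleNormal a i * ∑ j, circleNormal a j * zonal k (fun y => stereo y j) 0 := by
    unfold zonal
    rw [← hR.integral_comp]
    have h2 : ∀ j, circleNormal a j * ∫ y, k (chord 0 y) * stereo y j ∂sphereMeasure =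
        ∫ y, circleNormal a j * (k (chord 0 y) * stereo y j) ∂sphereMeasure := fun j =>
      (integral_const_mul _ _).symm
    simp only [h2]
    rw [← integral_finsetSum _ fun j _ => (hint j).const_mul _, ← integral_const_mul,
      ← integral_sub (hint i) ((integrable_finsetSum _ fun j _ => (hint j).const_mul _).const_mul _)]
    refine integral_congr_ae ?_
    filter_upwards [ha, hR.stereo_apply] with y hy hy'
    rw [hy, hy', lin]
    simp only [Fin.sum_univ_three]
    ring
  rw [h1, ← hax, stereo_circleInv ha0.symm, lin]
  simp only [zonal_stereo_zero, Fin.sum_univ_three]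
  ring

theorem zonal_lin (hk : IsKernel k) (v : Fin 3 → ℝ) (x : Plane) :
    zonal k (lin v) x =
      (Real.pi * ∫ s in Ioo (0 : ℝ) 1, k s * (1 - 2 * s)) * lin v x := by
  have h : zonal k (lin v) x = ∑ i, v i * zonal k (fun y => stereo y i) x := by
    simp only [zonal, lin, ← integral_const_mul]
    rw [← integral_finsetSum]
    · congr 1
      ext y
      rw [Finset.mul_sum]
      exact Finset.sum_congr rfl fun i _ => by ring
    · exact fun i _ => (hk.integrable_mul_bounded x (continuous_stereo i)
        fun y => abs_stereo_le y i).const_mul _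
  rw [h, lin, Finset.mul_sum]
  exact Finset.sum_congr rfl fun i _ => by rw [hk.zonal_stereo]; ring

/-- Tonelli, integrating in x first: by `integral_comp_chord` the inner integral of the absolute
kernel is a constant independent of y. -/
theorem integrable_prod (hk : IsKernel k) {h : Plane → ℝ} (hh : Integrable h sphereMeasure) :
    Integrable (fun p : Plane × Plane => k (chord p.1 p.2) * h p.2)
      (sphereMeasure.prod sphereMeasure) := by
  have hm : AEStronglyMeasurable (fun p : Plane × Plane => k (chord p.1 p.2) * h p.2)
      (sphereMeasure.prod sphereMeasure) :=
    (hk.measurable.comp continuous_chord.measurable).aestronglyMeasurable.mul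
      hh.aestronglyMeasurable.comp_snd
  rw [integrable_prod_iff' hm]
  constructor
  · refine ae_of_all _ fun y => ?_
    rw [show (fun x => k (chord x y) * h y) = fun x => k (chord y x) * h y from
      funext fun x => by rw [chord_comm]]
    exact (hk.integrable_comp_chord y).mul_const _
  · simp only [norm_mul, integral_mul_const]
    have : ∀ y, ∫ x, ‖k (chord x y)‖ ∂sphereMeasure = Real.pi * ∫ s in Ioo (0 : ℝ) 1, |k s| := by
      intro y
      rw [show (fun x => ‖k (chord x y)‖) = fun x => |k (chord y x)| from
        funext fun x => by rw [chord_comm, Real.norm_eq_abs]]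
      exact integral_comp_chord (k := fun s => |k s|) y
    simp only [this]
    exact hh.norm.const_mul _

theorem integrable_zonal (hk : IsKernel k) {h : Plane → ℝ} (hh : Integrable h sphereMeasure) :
    Integrable (zonal k h) sphereMeasure :=
  (hk.integrable_prod hh).integral_prod_left

theorem ae_integrable (hk : IsKernel k) {h : Plane → ℝ} (hh : Integrable h sphereMeasure) :
    ∀ᵐ x ∂sphereMeasure, Integrable (fun y => k (chord x y) * h y) sphereMeasure :=
  (hk.integrable_prod hh).prod_right_ae

/-- Zonal operators are symmetric. -/
theorem integral_mul_zonal (hk : IsKernel k) {g h : Plane → ℝ} (hh : Integrable h sphereMeasure)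
    (hc : Continuous g) {C : ℝ} (hb : ∀ y, |g y| ≤ C) :
    ∫ x, g x * zonal k h x ∂sphereMeasure = ∫ y, zonal k g y * h y ∂sphereMeasure := by
  have hint : Integrable (fun p : Plane × Plane => g p.1 * (k (chord p.1 p.2) * h p.2))
      (sphereMeasure.prod sphereMeasure) :=
    (hk.integrable_prod hh).bdd_mul (hc.comp continuous_fst).aestronglyMeasurable
      (ae_of_all _ fun p => hb p.1)
  have h1 := integral_integral_swap (f := fun x y => g x * (k (chord x y) * h y)) hint
  simp only [integral_const_mul] at h1
  rw [show ∫ x, g x * zonal k h x ∂sphereMeasure = _ from h1]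
  congr 1
  ext y
  rw [zonal, ← integral_mul_const]
  congr 1
  ext x
  rw [chord_comm]
  ring

end IsKernel

/-- Zonal operators commute with reflections. -/
theorem IsReflection.zonal_comp {n : Fin 3 → ℝ} {R : Plane → Plane} (hR : IsReflection n R)
    (k : ℝ → ℝ) (h : Plane → ℝ) :
    ∀ᵐ x ∂sphereMeasure, zonal k (fun y => h (R y)) x = zonal k h (R x) := by
  filter_upwards [hR.chord_apply_apply] with x hx
  unfold zonal
  rw [← hR.integral_comp fun y => k (chord (R x) y) * h y]
  refine integral_congr_ae ?_
  filter_upwards [hx] with y hy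
  rw [hy]

/-- A zonal operator maps a function invariant under all reflections to a constant. -/
theorem zonal_eq_of_invariant (k : ℝ → ℝ) {h : Plane → ℝ}
    (hinv : ∀ a, (fun y => h (circleInv a y)) =ᵐ[sphereMeasure] h) (x : Plane) :
    zonal k h x = zonal k h 0 := by
  by_cases hx : x = 0
  · rw [hx]
  obtain ⟨a, -, -, ha⟩ := exists_swap x hx
  unfold zonal
  rw [← (isReflection_circleInv a).integral_comp]
  refine integral_congr_ae ?_
  filter_upwards [ha, hinv a] with y hy hy'
  rw [hy, hy']

/-! ### Odd functions and the Schur test -/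

theorem zonal_add_ae {k : ℝ → ℝ} (hk : IsKernel k) {g h : Plane → ℝ}
    (hg : Integrable g sphereMeasure) (hh : Integrable h sphereMeasure) :
    zonal k (fun y => g y + h y) =ᵐ[sphereMeasure] fun x => zonal k g x + zonal k h x := by
  filter_upwards [hk.ae_integrable hg, hk.ae_integrable hh] with x h1 h2
  simp only [zonal, mul_add]
  exact integral_add h1 h2

theorem zonal_const_mul (k : ℝ → ℝ) (c : ℝ) (h : Plane → ℝ) (x : Plane) :
    zonal k (fun y => c * h y) x = c * zonal k h x := by
  simp only [zonal, ← integral_const_mul]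
  congr 1
  ext y
  ring

/-- The eigenvalue of a zonal operator on linear functions. -/
def eigenOne (k : ℝ → ℝ) : ℝ := Real.pi * ∫ s in Ioo (0 : ℝ) 1, k s * (1 - 2 * s)

/-- The function `sign ⟨n, ·⟩ |h|`. -/
def signedAbs (n : Fin 3 → ℝ) (h : Plane → ℝ) (x : Plane) : ℝ := SignType.sign (lin n x) * |h x|

theorem abs_sign_le_one (r : ℝ) : |((SignType.sign r : SignType) : ℝ)| ≤ 1 := by
  rcases lt_trichotomy r 0 with h | h | h <;> simp [h]

theorem measurable_sign_lin (n : Fin 3 → ℝ) :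
    Measurable fun x => ((SignType.sign (lin n x) : SignType) : ℝ) := by
  have h : (fun r : ℝ => ((SignType.sign r : SignType) : ℝ)) =
      fun r => if 0 < r then 1 else if r < 0 then -1 else 0 := by
    funext r
    rw [sign_apply]
    split_ifs <;> simp
  have : Measurable fun r : ℝ => ((SignType.sign r : SignType) : ℝ) := by
    rw [h]
    exact Measurable.ite measurableSet_Ioi measurable_const
      (Measurable.ite measurableSet_Iio measurable_const measurable_const)
  exact this.comp (continuous_lin n).measurable

theorem integrable_signedAbs (n : Fin 3 → ℝ) {h : Plane → ℝ} (hh : Integrable h sphereMeasure) :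
    Integrable (signedAbs n h) sphereMeasure :=
  hh.abs.bdd_mul (measurable_sign_lin n).aestronglyMeasurable
    (ae_of_all _ fun _ => abs_sign_le_one _)

section Schur

variable {n : Fin 3 → ℝ} {R : Plane → Plane} {k : ℝ → ℝ}

/-- `h` is odd with respect to the reflection `R`. -/
def IsOdd (R : Plane → Plane) (h : Plane → ℝ) : Prop :=
  ∀ᵐ x ∂sphereMeasure, h (R x) = -h x

theorem IsReflection.isOdd_signedAbs (hR : IsReflection n R) {h : Plane → ℝ} (hh : IsOdd R h) :
    IsOdd R (signedAbs n h) := by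
  filter_upwards [hR.lin_normal_apply, hh] with x h1 h2
  simp only [signedAbs, h1, h2, abs_neg, Left.sign_neg, SignType.coe_neg]
  ring

theorem IsReflection.isOdd_zonal (hR : IsReflection n R) (k : ℝ → ℝ) {h : Plane → ℝ}
    (hh : IsOdd R h) : IsOdd R (zonal k h) := by
  have h1 : (fun y => h (R y)) =ᵐ[sphereMeasure] fun y => (-1) * h y := by
    filter_upwards [hh] with y hy
    rw [hy]
    ring
  filter_upwards [hR.zonal_comp k h] with x hx
  rw [← hx, zonal_congr k h1, zonal_const_mul]
  ring

/-- The antisymmetrized kernel. -/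
def oddKernel (k : ℝ → ℝ) (R : Plane → Plane) (x y : Plane) : ℝ :=
  k (chord x y) - k (chord x (R y))

theorem IsReflection.integrable_oddKernel_mul (hR : IsReflection n R) {h : Plane → ℝ}
    (hh : IsOdd R h) {x : Plane}
    (hx : Integrable (fun y => k (chord x y) * h y) sphereMeasure) :
    Integrable (fun y => oddKernel k R x y * h y) sphereMeasure := by
  refine (hx.add (hR.integrable_comp hx)).congr ?_
  filter_upwards [hh] with y hy
  simp only [Pi.add_apply, hy, oddKernel]
  ring

/-- The substitution y ↦ `R y` in the reflected half of the kernel produces a second copy of the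
first half, because h changes sign. -/
theorem IsReflection.integral_oddKernel_mul (hR : IsReflection n R) {h : Plane → ℝ}
    (hh : IsOdd R h) {x : Plane}
    (hx : Integrable (fun y => k (chord x y) * h y) sphereMeasure) :
    ∫ y, oddKernel k R x y * h y ∂sphereMeasure = 2 * zonal k h x := by
  have h1 : ∫ y, oddKernel k R x y * h y ∂sphereMeasure =
      ∫ y, (k (chord x y) * h y + k (chord x (R y)) * h (R y)) ∂sphereMeasure := by
    refine integral_congr_ae ?_
    filter_upwards [hh] with y hy
    simp only [hy, oddKernel]
    ring
  rw [h1, integral_add hx (hR.integrable_comp hx),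
    hR.integral_comp fun y => k (chord x y) * h y, zonal]
  ring

/-- By `chord_apply` the nearer of y and `R y` is determined by the sides of the mirror, and k is
strictly decreasing. The strict part, nonvanishing off the mirror, is what makes the equality case
rigid. -/
theorem IsReflection.oddKernel_sign (hR : IsReflection n R) (hanti : StrictAntiOn k (Ioc 0 1))
    (x : Plane) : ∀ᵐ y ∂sphereMeasure,
      (SignType.sign (lin n x) : ℝ) * SignType.sign (lin n y) * oddKernel k R x y =
        |oddKernel k R x y| ∧ (lin n x ≠ 0 → oddKernel k R x y ≠ 0) := by
  filter_upwards [hR.chord_apply, ae_ne x, hR.ae_comp (ae_ne x), hR.lin_ne_zero] with y hy hyx hRyx hy0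
  have hm : chord x y ∈ Ioc (0 : ℝ) 1 := ⟨chord_pos hyx.symm, chord_le_one _ _⟩
  have hm' : chord x (R y) ∈ Ioc (0 : ℝ) 1 := ⟨chord_pos hRyx.symm, chord_le_one _ _⟩
  have hy := hy x
  have hpos : 0 < lin n x * lin n y → 0 < oddKernel k R x y := fun h =>
    sub_pos.2 (hanti hm hm' (by linarith))
  have hneg : lin n x * lin n y < 0 → oddKernel k R x y < 0 := fun h =>
    sub_neg.2 (hanti hm' hm (by linarith))
  rcases lt_trichotomy (lin n x) 0 with h1 | h1 | h1
  · rcases lt_or_gt_of_ne hy0 with h2 | h2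
    · have := hpos (mul_pos_of_neg_of_neg h1 h2)
      simp [h1, h2, abs_of_pos this, this.ne']
    · have := hneg (mul_neg_of_neg_of_pos h1 h2)
      simp [h1, h2, abs_of_neg this, this.ne]
  · have : oddKernel k R x y = 0 := by
      rw [oddKernel, hy, h1]
      simp
    simp [h1, this]
  · rcases lt_or_gt_of_ne hy0 with h2 | h2
    · have := hneg (mul_neg_of_pos_of_neg h1 h2)
      simp [h1, h2, abs_of_neg this, this.ne]
    · have := hpos (mul_pos h1 h2)
      simp [h1, h2, abs_of_pos this, this.ne']

theorem integrable_kernel_signedAbs (hk : IsKernel k) {h : Plane → ℝ}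
    (hh : Integrable h sphereMeasure) {x : Plane}
    (hx : Integrable (fun y => k (chord x y) * h y) sphereMeasure) :
    Integrable (fun y => k (chord x y) * signedAbs n h y) sphereMeasure := by
  refine hx.mono ?_ (ae_of_all _ fun y => ?_)
  · have hc : Continuous (chord x) := by
      unfold chord
      exact Continuous.div (by fun_prop) (by fun_prop)
        fun y => mul_ne_zero (weight_ne_zero _) (weight_ne_zero _)
    exact (hk.measurable.comp hc.measurable).aestronglyMeasurable.mul
      (integrable_signedAbs n hh).aestronglyMeasurable
  · rw [norm_mul, norm_mul]
    gcongr
    simp only [signedAbs, Real.norm_eq_abs, abs_mul, abs_abs]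
    exact mul_le_of_le_one_left (abs_nonneg _) (abs_sign_le_one _)

/-- The pointwise bound behind the Schur test. -/
theorem IsReflection.defect_eq (hR : IsReflection n R) (hk : IsKernel k)
    (hanti : StrictAntiOn k (Ioc 0 1)) {h : Plane → ℝ} (hh : Integrable h sphereMeasure)
    (hodd : IsOdd R h) {x : Plane}
    (hx : Integrable (fun y => k (chord x y) * h y) sphereMeasure) (s : ℝ) :
    Integrable (fun y => |oddKernel k R x y| * |h y| - s * (oddKernel k R x y * h y))
      sphereMeasure ∧
    ∫ y, (|oddKernel k R x y| * |h y| - s * (oddKernel k R x y * h y)) ∂sphereMeasure =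
      2 * (SignType.sign (lin n x) * zonal k (signedAbs n h) x - s * zonal k h x) := by
  have hx' := integrable_kernel_signedAbs (n := n) hk hh hx
  have hodd' := hR.isOdd_signedAbs hodd
  -- The absolute value of the kernel is the kernel times both signs; the sign at y is absorbed into
  -- `signedAbs`.
  have hae : (fun y => |oddKernel k R x y| * |h y| - s * (oddKernel k R x y * h y))
      =ᵐ[sphereMeasure] fun y => SignType.sign (lin n x) * (oddKernel k R x y * signedAbs n h y) -
        s * (oddKernel k R x y * h y) := by
    filter_upwards [hR.oddKernel_sign hanti x] with y hy
    rw [← hy.1, signedAbs]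
    ring
  have hi1 := (hR.integrable_oddKernel_mul hodd' hx').const_mul
    (SignType.sign (lin n x) : ℝ)
  have hi2 := (hR.integrable_oddKernel_mul hodd hx).const_mul s
  refine ⟨(hi1.sub hi2).congr hae.symm, ?_⟩
  rw [integral_congr_ae hae, integral_sub hi1 hi2, integral_const_mul, integral_const_mul,
    hR.integral_oddKernel_mul hodd hx, hR.integral_oddKernel_mul hodd' hx']
  ring

/-- The integrand of `defect_eq` is nonnegative for s = 1 and for s = -1. -/
theorem IsReflection.abs_zonal_le (hR : IsReflection n R) (hk : IsKernel k)
    (hanti : StrictAntiOn k (Ioc 0 1)) {h : Plane → ℝ} (hh : Integrable h sphereMeasure)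
    (hodd : IsOdd R h) : ∀ᵐ x ∂sphereMeasure,
      |zonal k h x| ≤ SignType.sign (lin n x) * zonal k (signedAbs n h) x := by
  filter_upwards [hk.ae_integrable hh] with x hx
  have key : ∀ s : ℝ, |s| = 1 →
      s * zonal k h x ≤ SignType.sign (lin n x) * zonal k (signedAbs n h) x := by
    intro s hs
    have h1 := (hR.defect_eq hk hanti hh hodd hx s).2
    have h2 : 0 ≤ ∫ y, (|oddKernel k R x y| * |h y| - s * (oddKernel k R x y * h y))
        ∂sphereMeasure := by
      refine integral_nonneg fun y => sub_nonneg.2 ((le_abs_self _).trans ?_)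
      rw [abs_mul, abs_mul, hs, one_mul]
    linarith
  rw [abs_le']
  exact ⟨by simpa using key 1 (by simp), by simpa using key (-1) (by simp)⟩

/-- Since |l| sign l = l, symmetry moves the operator onto the eigenfunction l, and l sign l = |l|
restores the weight. -/
theorem integral_abs_lin_mul_sign_zonal (hk : IsKernel k) (n : Fin 3 → ℝ) {h : Plane → ℝ}
    (hh : Integrable h sphereMeasure) :
    ∫ x, |lin n x| * (SignType.sign (lin n x) * zonal k (signedAbs n h) x) ∂sphereMeasure =
      eigenOne k * ∫ x, |lin n x| * |h x| ∂sphereMeasure := by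
  have h1 := hk.integral_mul_zonal (integrable_signedAbs n hh) (continuous_lin n) (abs_lin_le n)
  have h2 : ∀ r : ℝ, |r| * SignType.sign r = r := fun r => by
    rw [mul_comm, sign_mul_abs]
  have h3 : ∀ r : ℝ, r * SignType.sign r = |r| := fun r => by
    exact self_mul_sign r
  simp only [← mul_assoc, h2]
  rw [h1, ← integral_const_mul]
  congr 1
  ext x
  rw [hk.zonal_lin, eigenOne, signedAbs, ← h3 (lin n x)]
  ring

theorem integrable_abs_lin_mul (n : Fin 3 → ℝ) {h : Plane → ℝ} (hh : Integrable h sphereMeasure) :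
    Integrable (fun x => |lin n x| * h x) sphereMeasure :=
  hh.bdd_mul (continuous_lin n).abs.aestronglyMeasurable
    (ae_of_all _ fun x => by rw [Real.norm_eq_abs, abs_abs]; exact abs_lin_le n x)

theorem integrable_sign_mul (n : Fin 3 → ℝ) {h : Plane → ℝ} (hh : Integrable h sphereMeasure) :
    Integrable (fun x => (SignType.sign (lin n x) : ℝ) * h x) sphereMeasure :=
  hh.bdd_mul (measurable_sign_lin n).aestronglyMeasurable
    (ae_of_all _ fun _ => abs_sign_le_one _)

/-- The Schur test for odd functions. -/
theorem IsReflection.integral_abs_zonal_le (hR : IsReflection n R) (hk : IsKernel k)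
    (hanti : StrictAntiOn k (Ioc 0 1)) {h : Plane → ℝ} (hh : Integrable h sphereMeasure)
    (hodd : IsOdd R h) :
    ∫ x, |lin n x| * |zonal k h x| ∂sphereMeasure ≤
      eigenOne k * ∫ x, |lin n x| * |h x| ∂sphereMeasure := by
  rw [← integral_abs_lin_mul_sign_zonal hk n hh]
  refine integral_mono_ae (integrable_abs_lin_mul n (hk.integrable_zonal hh).abs)
    (integrable_abs_lin_mul n
      (integrable_sign_mul n (hk.integrable_zonal (integrable_signedAbs n hh)))) ?_
  filter_upwards [hR.abs_zonal_le hk hanti hh hodd] with x hx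
  gcongr

/-- Allows an actual point to be chosen from a property that holds almost everywhere. -/
instance : NeZero sphereMeasure :=
  ⟨fun h => (NeZero.ne (volume : Measure Plane))
    (Measure.measure_univ_eq_zero.1 (ac_sphereMeasure (by simp [h])))⟩

/-- In the Schur test equality holds only for functions of constant sign. -/
theorem IsReflection.constSign_of_le (hR : IsReflection n R) (hk : IsKernel k)
    (hanti : StrictAntiOn k (Ioc 0 1)) {h : Plane → ℝ} (hh : Integrable h sphereMeasure)
    (hodd : IsOdd R h)
    (hle : eigenOne k * ∫ x, |lin n x| * |h x| ∂sphereMeasure ≤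
      ∫ x, |lin n x| * |zonal k h x| ∂sphereMeasure) :
    ∃ c : ℝ, c ≠ 0 ∧ ∀ᵐ x ∂sphereMeasure, 0 ≤ c * (lin n x * h x) := by
  rw [← integral_abs_lin_mul_sign_zonal hk n hh] at hle
  have hi1 := integrable_abs_lin_mul n (hk.integrable_zonal hh).abs
  have hi2 := integrable_abs_lin_mul n
      (integrable_sign_mul n (hk.integrable_zonal (integrable_signedAbs n hh)))
  have hnn : 0 ≤ᵐ[sphereMeasure] fun x =>
      |lin n x| * (SignType.sign (lin n x) * zonal k (signedAbs n h) x) -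
        |lin n x| * |zonal k h x| := by
    filter_upwards [hR.abs_zonal_le hk hanti hh hodd] with x hx
    exact sub_nonneg.2 (by gcongr)
  have hz := (integral_eq_zero_iff_of_nonneg_ae hnn (hi2.sub hi1)).1 (le_antisymm
    (by rw [integral_sub hi2 hi1]; linarith) (integral_nonneg_of_ae hnn))
  -- Equality of the integrals gives pointwise equality almost everywhere. A single such point x off
  -- the mirror suffices: there a nonnegative function of y has integral zero, which fixes the sign
  -- of h at almost every y.
  obtain ⟨x, hx0, hxz, hxi⟩ := (hR.lin_ne_zero.and (hz.and (hk.ae_integrable hh))).exists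
  have hxeq : (SignType.sign (lin n x) : ℝ) * zonal k (signedAbs n h) x = |zonal k h x| := by
    have h1 : |lin n x| * ((SignType.sign (lin n x) : ℝ) * zonal k (signedAbs n h) x -
        |zonal k h x|) = 0 := by rw [mul_sub]; exact hxz
    have h2 := (mul_eq_zero.1 h1).resolve_left (abs_ne_zero.2 hx0)
    linarith
  obtain ⟨s, hs, hsz⟩ : ∃ s : ℝ, |s| = 1 ∧ s * zonal k h x = |zonal k h x| := by
    rcases le_total 0 (zonal k h x) with h0 | h0
    · exact ⟨1, by simp, by rw [abs_of_nonneg h0, one_mul]⟩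
    · exact ⟨-1, by simp, by rw [abs_of_nonpos h0]; ring⟩
  obtain ⟨hdi, hde⟩ := hR.defect_eq hk hanti hh hodd hxi s
  rw [hxeq, hsz, sub_self, mul_zero] at hde
  have hdn : 0 ≤ᵐ[sphereMeasure] fun y =>
      |oddKernel k R x y| * |h y| - s * (oddKernel k R x y * h y) := by
    refine ae_of_all _ fun y => sub_nonneg.2 ((le_abs_self _).trans ?_)
    rw [abs_mul, abs_mul, hs, one_mul]
  have hd0 := (integral_eq_zero_iff_of_nonneg_ae hdn hdi).1 hde
  have hs0 : s ≠ 0 := fun h => by simp [h] at hs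
  -- Here s is the sign of `zonal k h x`. Vanishing of the defect says that s times the
  -- antisymmetrized kernel times h is nonnegative, and that kernel has the sign of `lin n x * lin n
  -- y`.
  refine ⟨s * lin n x, mul_ne_zero hs0 hx0, ?_⟩
  filter_upwards [hd0, hR.oddKernel_sign hanti x] with y h1 h2
  have h1 : |oddKernel k R x y| * |h y| = s * (oddKernel k R x y * h y) := sub_eq_zero.1 h1
  have hq := abs_pos.2 (h2.2 hx0)
  have h3 : |oddKernel k R x y| * (s * lin n x * (lin n y * h y)) =
      |lin n x| * |lin n y| * (|oddKernel k R x y| * |h y|) := by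
    rw [h1]
    have h4 := h2.1
    have h5 : ∀ r : ℝ, |r| * SignType.sign r = r := fun r => by rw [mul_comm, sign_mul_abs]
    have h6 : |oddKernel k R x y| * (lin n x * lin n y) =
        |lin n x| * |lin n y| * oddKernel k R x y := by
      have h7 : oddKernel k R x y * (SignType.sign (lin n x) * SignType.sign (lin n y)) =
        |oddKernel k R x y| := by rw [← h4]; ring
      rw [← h7]
      rcases lt_trichotomy (lin n x) 0 with a | a | a <;>
        rcases lt_trichotomy (lin n y) 0 with b | b | b <;>
        simp [a, b, abs_of_neg, abs_of_pos] <;> ring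
    linear_combination s * h y * h6
  by_contra hneg
  have h8 := mul_neg_of_pos_of_neg hq (not_le.1 hneg)
  rw [h3] at h8
  exact absurd h8 (not_lt.2 (by positivity))

end Schur

/-! ### Rigidity of the integral equation -/

/-- The operator `c K + d` for the zonal operator `K` with kernel `k`. -/
def affineZonal (k : ℝ → ℝ) (c d : ℝ) (h : Plane → ℝ) (x : Plane) : ℝ :=
  c * zonal k h x + d * h x

/-- Kernels and constants for which linear functions solve `h = G (c K + d) h`. -/
structure IsLinearization (kG kT : ℝ → ℝ) (c d : ℝ) : Prop where
  kernelG : IsKernel kG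
  kernelT : IsKernel kT
  antiG : StrictAntiOn kG (Ioc 0 1)
  antiT : StrictAntiOn kT (Ioc 0 1)
  nonneg_integral : 0 ≤ ∫ s in Ioo (0 : ℝ) 1, kT s
  c_pos : 0 < c
  d_pos : 0 < d
  eigenG_pos : 0 < eigenOne kG
  eigen : eigenOne kG * (c * eigenOne kT + d) = 1

/-- Integrable solutions of `h = const + G (c K + d) h`. -/
def IsSolution (kG kT : ℝ → ℝ) (c d : ℝ) (h : Plane → ℝ) : Prop :=
  Integrable h sphereMeasure ∧
    ∃ e : ℝ, h =ᵐ[sphereMeasure] fun x => e + zonal kG (affineZonal kT c d h) x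

theorem isReflection_circleInv_zero : IsReflection (Pi.single 2 1) (circleInv 0) := by
  have h2 : circleNormal 0 = Pi.single 2 1 := by
    ext i
    fin_cases i <;> simp [circleNormal, weight]
  exact h2 ▸ isReflection_circleInv 0

theorem lin_single (i : Fin 3) (x : Plane) : lin (Pi.single i 1) x = stereo x i := by
  simp [lin, Pi.single_apply]

variable {kG kT : ℝ → ℝ} {c d : ℝ}

theorem affineZonal_congr {g h : Plane → ℝ} (hgh : g =ᵐ[sphereMeasure] h) :
    affineZonal kT c d g =ᵐ[sphereMeasure] affineZonal kT c d h := by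
  filter_upwards [hgh] with x hx
  rw [affineZonal, affineZonal, zonal_congr kT hgh, hx]

namespace IsLinearization

theorem integrable_affine (H : IsLinearization kG kT c d) {h : Plane → ℝ}
    (hh : Integrable h sphereMeasure) : Integrable (affineZonal kT c d h) sphereMeasure :=
  ((H.kernelT.integrable_zonal hh).const_mul c).add (hh.const_mul d)

theorem affine_comb (H : IsLinearization kG kT c d) {g h : Plane → ℝ} (t : ℝ)
    (hg : Integrable g sphereMeasure) (hh : Integrable h sphereMeasure) :
    affineZonal kT c d (fun y => g y + t * h y) =ᵐ[sphereMeasure]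
      fun x => affineZonal kT c d g x + t * affineZonal kT c d h x := by
  filter_upwards [zonal_add_ae H.kernelT hg (hh.const_mul t)] with x hx
  simp only [affineZonal, hx, zonal_const_mul]
  ring

theorem comp_comb (H : IsLinearization kG kT c d) {g h : Plane → ℝ} (t : ℝ)
    (hg : Integrable g sphereMeasure) (hh : Integrable h sphereMeasure) :
    zonal kG (affineZonal kT c d fun y => g y + t * h y) =ᵐ[sphereMeasure]
      fun x => zonal kG (affineZonal kT c d g) x + t * zonal kG (affineZonal kT c d h) x := by
  rw [zonal_congr kG (H.affine_comb t hg hh)]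
  filter_upwards [zonal_add_ae H.kernelG (H.integrable_affine hg)
    ((H.integrable_affine hh).const_mul t)] with x hx
  rw [hx, zonal_const_mul]

theorem affine_lin (H : IsLinearization kG kT c d) (v : Fin 3 → ℝ) :
    affineZonal kT c d (lin v) = fun x => (c * eigenOne kT + d) * lin v x := by
  funext x
  rw [affineZonal, H.kernelT.zonal_lin, eigenOne]
  ring

/-- This is the meaning of the field `eigen`: the product of the two eigenvalues on linear functions
is one. -/
theorem comp_lin (H : IsLinearization kG kT c d) (v : Fin 3 → ℝ) (x : Plane) :
    zonal kG (affineZonal kT c d (lin v)) x = lin v x := by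
  rw [H.affine_lin, zonal_const_mul, H.kernelG.zonal_lin, ← eigenOne]
  linear_combination lin v x * H.eigen

theorem isSolution_add_lin (H : IsLinearization kG kT c d) {h : Plane → ℝ}
    (hh : IsSolution kG kT c d h) (v : Fin 3 → ℝ) (t : ℝ) :
    IsSolution kG kT c d fun x => h x + t * lin v x := by
  obtain ⟨hi, e, he⟩ := hh
  refine ⟨hi.add ((integrable_lin v).const_mul t), e, ?_⟩
  filter_upwards [he, H.comp_comb t hi (integrable_lin v)] with x h1 h2
  rw [h2, H.comp_lin]
  simp only [h1, add_assoc]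

variable {n : Fin 3 → ℝ} {R : Plane → Plane}

/-- Odd solutions are multiples of a linear function. -/
theorem odd_eq (H : IsLinearization kG kT c d) (hR : IsReflection n R) {u : Plane → ℝ}
    (hi : Integrable u sphereMeasure) (hodd : IsOdd R u)
    (hu : u =ᵐ[sphereMeasure] zonal kG (affineZonal kT c d u)) :
    ∃ t : ℝ, u =ᵐ[sphereMeasure] fun x => t * lin n x := by
  have hl := integrable_lin n
  have hll : Integrable (fun x => lin n x * lin n x) sphereMeasure :=
    hl.bdd_mul (continuous_lin n).aestronglyMeasurable (ae_of_all _ (abs_lin_le n))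
  have hlu : Integrable (fun x => lin n x * u x) sphereMeasure :=
    hi.bdd_mul (continuous_lin n).aestronglyMeasurable (ae_of_all _ (abs_lin_le n))
  have hpos : ∫ x, lin n x * lin n x ∂sphereMeasure ≠ 0 := by
    intro h0
    have h1 := (integral_eq_zero_iff_of_nonneg (fun x => mul_self_nonneg _) hll).1 h0
    obtain ⟨x, hx, hx'⟩ := (h1.and hR.lin_ne_zero).exists
    exact hx' (mul_self_eq_zero.1 hx)
  -- Orthogonal projection: t is chosen so that w = u + t l is orthogonal to l. As l itself solves
  -- the equation, so does w.
  obtain ⟨t, ht⟩ : ∃ t : ℝ, ∫ x, lin n x * (u x + t * lin n x) ∂sphereMeasure = 0 := by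
    refine ⟨-(∫ x, lin n x * u x ∂sphereMeasure) / ∫ x, lin n x * lin n x ∂sphereMeasure, ?_⟩
    simp only [mul_add, mul_left_comm _ (_ / _) _]
    rw [integral_add hlu (hll.const_mul _), integral_const_mul, div_mul_cancel₀ _ hpos,
      add_neg_cancel]
  set w : Plane → ℝ := fun x => u x + t * lin n x with hw
  have hwi : Integrable w sphereMeasure := hi.add (hl.const_mul t)
  have hwodd : IsOdd R w := by
    filter_upwards [hodd, hR.lin_normal_apply] with x h1 h2
    simp only [hw, h1, h2]
    ring
  have hweq : w =ᵐ[sphereMeasure] zonal kG (affineZonal kT c d w) := by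
    filter_upwards [hu, H.comp_comb t hi hl] with x h1 h2
    rw [h2, H.comp_lin, ← h1]
  have hNi := H.integrable_affine hwi
  have hNodd : IsOdd R (affineZonal kT c d w) := by
    filter_upwards [hR.isOdd_zonal kT hwodd, hwodd] with x h1 h2
    rw [affineZonal, affineZonal, h1, h2]
    ring
  have hTi := H.kernelT.integrable_zonal hwi
  have h1 := hR.integral_abs_zonal_le H.kernelG H.antiG hNi hNodd
  have h2 : ∫ x, |lin n x| * |zonal kG (affineZonal kT c d w) x| ∂sphereMeasure =
      ∫ x, |lin n x| * |w x| ∂sphereMeasure := by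
    refine integral_congr_ae ?_
    filter_upwards [hweq] with x hx
    rw [← hx]
  have h3 : ∫ x, |lin n x| * |affineZonal kT c d w x| ∂sphereMeasure ≤
      c * ∫ x, |lin n x| * |zonal kT w x| ∂sphereMeasure +
        d * ∫ x, |lin n x| * |w x| ∂sphereMeasure := by
    have hT := (integrable_abs_lin_mul n hTi.abs).const_mul c
    have hW := (integrable_abs_lin_mul n hwi.abs).const_mul d
    rw [← integral_const_mul, ← integral_const_mul, ← integral_add hT hW]
    refine integral_mono (integrable_abs_lin_mul n hNi.abs) (hT.add hW) fun x => ?_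
    have h4 : |affineZonal kT c d w x| ≤ c * |zonal kT w x| + d * |w x| := by
      refine (abs_add_le _ _).trans_eq ?_
      rw [abs_mul, abs_mul, abs_of_pos H.c_pos, abs_of_pos H.d_pos]
    have := mul_le_mul_of_nonneg_left h4 (abs_nonneg (lin n x))
    linarith
  -- The Schur bound for `kG` and the triangle inequality give ∫ |l||w| ≤ λ_G (c ∫ |l||K w| + d ∫
  -- |l||w|). Since λ_G (c λ_K + d) = 1, this is the reverse of the Schur inequality for `kT`.
  have h5 : eigenOne kT * ∫ x, |lin n x| * |w x| ∂sphereMeasure ≤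
      ∫ x, |lin n x| * |zonal kT w x| ∂sphereMeasure := by
    have h6 := h1.trans (mul_le_mul_of_nonneg_left h3 H.eigenG_pos.le)
    rw [h2] at h6
    have h7 := H.eigen
    have h8 := mul_pos H.eigenG_pos H.c_pos
    refine le_of_mul_le_mul_left ?_ h8
    linear_combination h6 + (∫ x, |lin n x| * |w x| ∂sphereMeasure) * h7
  obtain ⟨s, hs, hsw⟩ := hR.constSign_of_le H.kernelT H.antiT hwi hwodd h5
  have hlw : Integrable (fun x => lin n x * w x) sphereMeasure :=
    hwi.bdd_mul (continuous_lin n).aestronglyMeasurable (ae_of_all _ (abs_lin_le n))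
  -- A function l w of constant sign whose integral is zero vanishes.
  have h9 := (integral_eq_zero_iff_of_nonneg_ae hsw (hlw.const_mul s)).1
    (by rw [integral_const_mul, ht, mul_zero])
  refine ⟨-t, ?_⟩
  filter_upwards [h9, hR.lin_ne_zero] with x hx hx0
  have h10 : w x = 0 :=
    (mul_eq_zero.1 ((mul_eq_zero.1 hx).resolve_left hs)).resolve_left hx0
  simp only [hw] at h10
  linarith

theorem affine_comp (hR : IsReflection n R) (h : Plane → ℝ) :
    affineZonal kT c d (fun y => h (R y)) =ᵐ[sphereMeasure]
      fun x => affineZonal kT c d h (R x) := by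
  filter_upwards [hR.zonal_comp kT h] with x hx
  rw [affineZonal, affineZonal, hx]

/-- The constant e cancels in h - h ∘ R, which is an odd solution, so `odd_eq` applies. -/
theorem sub_comp_eq (H : IsLinearization kG kT c d) (hR : IsReflection n R) {h : Plane → ℝ}
    (hh : IsSolution kG kT c d h) :
    ∃ t : ℝ, ∀ᵐ x ∂sphereMeasure, h x - h (R x) = t * lin n x := by
  obtain ⟨hi, e, he⟩ := hh
  have hiR := hR.integrable_comp hi
  have hu := H.odd_eq (u := fun x => h x + (-1) * h (R x)) hR (hi.add (hiR.const_mul (-1)))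
    (ae_of_all _ fun x => by simp only [hR.involutive x]; ring) (by
      filter_upwards [he, hR.ae_comp he, H.comp_comb (-1) hi hiR,
        hR.zonal_comp kG (affineZonal kT c d h)] with x h1 h2 h3 h4
      rw [h3, zonal_congr kG (affine_comp hR h), h4]
      linarith)
  obtain ⟨t, ht⟩ := hu
  refine ⟨t, ?_⟩
  filter_upwards [ht] with x hx
  linarith

/-- Each coordinate is odd under a reflection that preserves the measure. -/
theorem integral_lin (v : Fin 3 → ℝ) : ∫ x, lin v x ∂sphereMeasure = 0 := by
  have key : ∀ {n : Fin 3 → ℝ} {R : Plane → Plane}, IsReflection n R →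
      ∫ x, lin n x ∂sphereMeasure = 0 := by
    intro n R hR
    have h1 := hR.integral_comp (lin n)
    rw [integral_congr_ae hR.lin_normal_apply, integral_neg] at h1
    linarith
  have h : ∀ i, ∫ x, stereo x i ∂sphereMeasure = 0 := by
    intro i
    simp only [← lin_single]
    fin_cases i
    · exact key (isReflection_axisRefl 0)
    · exact key (isReflection_axisRefl 1)
    · exact key isReflection_circleInv_zero
  unfold lin
  rw [integral_finsetSum _ fun i _ => (integrable_stereo i).const_mul _]
  simp [integral_const_mul, h]

end IsLinearization

/-- The composition of three orthogonal reflections. -/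
def antipode (x : Plane) : Plane := axisRefl 0 (axisRefl 1 (circleInv 0 x))

theorem measurePreserving_antipode : MeasurePreserving antipode sphereMeasure sphereMeasure :=
  (measurePreserving_axisRefl 0).comp
    ((measurePreserving_axisRefl 1).comp (measurePreserving_circleInv 0))

theorem stereo_antipode : ∀ᵐ x ∂sphereMeasure, ∀ i, stereo (antipode x) i = -stereo x i := by
  have h0 := isReflection_axisRefl 0
  have h1 := isReflection_axisRefl 1
  have h2 := isReflection_circleInv_zero
  filter_upwards [h2.stereo_apply, h2.ae_comp h1.stereo_apply,
    h2.ae_comp (h1.ae_comp h0.stereo_apply)] with x a2 a1 a0 i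
  rw [antipode, a0]
  simp only [lin_single, a1, a2]
  fin_cases i <;> simp <;> ring

/-- Solutions of the integral equation are linear functions on the sphere. -/
theorem IsLinearization.rigidity (H : IsLinearization kG kT c d) {h : Plane → ℝ}
    (hh : IsSolution kG kT c d h)
    (hmean : ∫ x, affineZonal kT c d h x ∂sphereMeasure = 0) :
    ∃ v : Fin 3 → ℝ, h =ᵐ[sphereMeasure] lin v := by
  obtain ⟨t0, ht0⟩ := H.sub_comp_eq (isReflection_axisRefl 0) hh
  obtain ⟨t1, ht1⟩ := H.sub_comp_eq (isReflection_axisRefl 1) hh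
  obtain ⟨t2, ht2⟩ := H.sub_comp_eq isReflection_circleInv_zero hh
  -- A coordinate reflection changes `lin v` by twice the corresponding coordinate term, so half of
  -- each coefficient must be subtracted.
  set v : Fin 3 → ℝ := ![t0 / 2, t1 / 2, t2 / 2] with hv
  set g : Plane → ℝ := fun x => h x + (-1) * lin v x with hg
  have hgs : IsSolution kG kT c d g := H.isSolution_add_lin hh v (-1)
  have hinv : ∀ {j : Fin 3} {R : Plane → Plane} {t : ℝ}, IsReflection (Pi.single j 1) R →
      (∀ᵐ x ∂sphereMeasure, h x - h (R x) = t * lin (Pi.single j 1) x) → v j = t / 2 →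
      ∀ᵐ x ∂sphereMeasure, g (R x) = g x := by
    intro j R t hR ht hvj
    filter_upwards [ht, hR.lin_apply v] with x h1 h2
    have h3 : ∑ i, v i * (Pi.single j 1 : Fin 3 → ℝ) i = t / 2 := by
      rw [← hvj]
      simp [Pi.single_apply]
    rw [h3] at h2
    simp only [hg, h2]
    linarith
  have hg0 := hinv (isReflection_axisRefl 0) ht0 rfl
  have hg1 := hinv (isReflection_axisRefl 1) ht1 rfl
  have hg2 := hinv isReflection_circleInv_zero ht2 rfl
  have hanti : ∀ᵐ x ∂sphereMeasure, g (antipode x) = g x := by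
    filter_upwards [hg2, isReflection_circleInv_zero.ae_comp hg1,
      isReflection_circleInv_zero.ae_comp ((isReflection_axisRefl 1).ae_comp hg0)] with x a b c
    rw [antipode, c, b, a]
  -- The antipodal map commutes with every reflection and leaves g unchanged. Comparing g - g ∘ R =
  -- t l at x and at its antipode, where l changes sign, gives t l = 0.
  have hinvAll : ∀ a, (fun y => g (circleInv a y)) =ᵐ[sphereMeasure] g := by
    intro a
    have hR := isReflection_circleInv a
    obtain ⟨t, ht⟩ := H.sub_comp_eq hR hgs
    have hq := measurePreserving_antipode.quasiMeasurePreserving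
    filter_upwards [ht, hq.ae ht, hanti, hR.ae_comp hanti, stereo_antipode,
      hR.ae_comp stereo_antipode, hR.stereo_apply, hq.ae hR.stereo_apply]
      with x e1 e2 e3 e4 s1 s2 s3 s4
    have hneg : lin (circleNormal a) (antipode x) = -lin (circleNormal a) x := by
      simp only [lin, s1, mul_neg, Finset.sum_neg_distrib]
    have hcomm : circleInv a (antipode x) = antipode (circleInv a x) := by
      refine eq_of_stereo_eq fun i => ?_
      rw [s4, s2, s3, s1, hneg]
      ring
    rw [hcomm, e3, e4, hneg] at e2
    linarith
  have hNinv : ∀ a, (fun y => affineZonal kT c d g (circleInv a y)) =ᵐ[sphereMeasure]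
      affineZonal kT c d g := fun a =>
    (IsLinearization.affine_comp (isReflection_circleInv a) g).symm.trans
      (affineZonal_congr (hinvAll a))
  obtain ⟨hgi, e, he⟩ := hgs
  have hconst : g =ᵐ[sphereMeasure] fun _ => e + zonal kG (affineZonal kT c d g) 0 := by
    filter_upwards [he] with x hx
    rw [hx, zonal_eq_of_invariant kG hNinv]
  set C := e + zonal kG (affineZonal kT c d g) 0
  have hmean' : ∫ x, affineZonal kT c d g x ∂sphereMeasure = 0 := by
    rw [integral_congr_ae (H.affine_comb (-1) hh.1 (integrable_lin v)),
      integral_add (H.integrable_affine hh.1)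
        ((H.integrable_affine (integrable_lin v)).const_mul _), hmean, integral_const_mul,
      H.affine_lin, integral_const_mul, IsLinearization.integral_lin]
    ring
  -- On constants the operator c K + d is multiplication by a positive number, so mean zero leaves
  -- only the constant 0.
  have hC : C = 0 := by
    rw [integral_congr_ae (affineZonal_congr hconst)] at hmean'
    simp only [affineZonal, zonal, integral_mul_const, IsKernel.integral_comp_chord,
      integral_const, smul_eq_mul] at hmean'
    have h1 : 0 < sphereMeasure.real univ := measureReal_univ_pos
    have h2 : 0 < c * (Real.pi * ∫ s in Ioo (0 : ℝ) 1, kT s) + d :=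
      add_pos_of_nonneg_of_pos (mul_nonneg H.c_pos.le (mul_nonneg Real.pi_pos.le H.nonneg_integral))
        H.d_pos
    have h3 : sphereMeasure.real univ * ((c * (Real.pi * ∫ s in Ioo (0 : ℝ) 1, kT s) + d) * C) = 0 := by
      linear_combination hmean'
    exact (mul_eq_zero.1 ((mul_eq_zero.1 h3).resolve_left h1.ne')).resolve_left h2.ne'
  refine ⟨v, ?_⟩
  filter_upwards [hconst] with x hx
  simp only [hg, hC] at hx
  linarith

/-! ### The kernels of the linearized equation -/

/-- The Green kernel of the sphere. -/
def greenKernel (s : ℝ) : ℝ := -(4 * Real.pi)⁻¹ * Real.log s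

/-- The Riesz kernel of the sphere. -/
def rieszKernel (α s : ℝ) : ℝ := s ^ (-(α / 2))

theorem setIntegral_Ioo_eq (f : ℝ → ℝ) :
    ∫ s in Ioo (0 : ℝ) 1, f s = ∫ s in (0 : ℝ)..1, f s := by
  rw [intervalIntegral.integral_of_le zero_le_one, integral_Ioc_eq_integral_Ioo]

theorem integrableOn_Ioo_iff (f : ℝ → ℝ) :
    IntegrableOn f (Ioo 0 1) ↔ IntervalIntegrable f volume 0 1 := by
  rw [intervalIntegrable_iff_integrableOn_Ioo_of_le zero_le_one]

theorem isKernel_greenKernel : IsKernel greenKernel where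
  measurable := Real.measurable_log.const_mul _
  integrable := by
    rw [integrableOn_Ioo_iff]
    exact intervalIntegral.intervalIntegrable_log'.const_mul _

theorem isKernel_rieszKernel {α : ℝ} (hα : α < 2) : IsKernel (rieszKernel α) where
  measurable := measurable_id.pow_const _
  integrable := by
    rw [integrableOn_Ioo_iff]
    exact intervalIntegral.intervalIntegrable_rpow' (by linarith)

theorem integral_log_mul : ∫ s in (0 : ℝ)..1, Real.log s * (1 - 2 * s) = -(1 / 2) := by
  have hi : IntervalIntegrable (fun s : ℝ => Real.log s * (1 - 2 * s)) volume 0 1 :=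
    intervalIntegral.intervalIntegrable_log'.mul_continuousOn (by fun_prop)
  -- This is the antiderivative, written with s log s so that it is continuous at 0.
  have hc : Continuous fun s : ℝ => (1 - s) * (s * Real.log s) - s + s ^ 2 / 2 := by
    have := Real.continuous_mul_log
    fun_prop
  rw [intervalIntegral.integral_eq_sub_of_hasDerivAt_of_le zero_le_one hc.continuousOn
    (fun s hs => ?_) hi]
  · norm_num
  · have h := ((((hasDerivAt_id s).const_sub 1).mul
      ((hasDerivAt_id s).mul (Real.hasDerivAt_log hs.1.ne'))).sub (hasDerivAt_id s)).add
      ((hasDerivAt_pow 2 s).div_const 2)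
    refine h.congr_deriv ?_
    have := hs.1.ne'
    simp only [Pi.mul_apply, id]
    field_simp
    ring

/-- The value is the reciprocal of the 8 in -Δ l = 8 w⁻² l, see `lap_lin`. -/
theorem eigenOne_greenKernel : eigenOne greenKernel = 1 / 8 := by
  have h : ∀ s : ℝ, greenKernel s * (1 - 2 * s) =
      -(4 * Real.pi)⁻¹ * (Real.log s * (1 - 2 * s)) := fun s => by rw [greenKernel]; ring
  have hpi := Real.pi_ne_zero
  rw [eigenOne, setIntegral_Ioo_eq]
  simp only [h, intervalIntegral.integral_const_mul, integral_log_mul]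
  field_simp
  norm_num

theorem integral_rieszKernel {α : ℝ} (hα : α < 2) :
    ∫ s in Ioo (0 : ℝ) 1, rieszKernel α s = 2 / (2 - α) := by
  rw [setIntegral_Ioo_eq]
  simp only [rieszKernel]
  have h1 : -(α / 2) + 1 ≠ 0 := by linarith
  have h2 : 2 - α ≠ 0 := by linarith
  rw [integral_rpow (Or.inl (by linarith)), Real.zero_rpow h1, Real.one_rpow,
    show -(α / 2) + 1 = (2 - α) / 2 by ring, sub_zero, one_div_div]

theorem eigenOne_rieszKernel {α : ℝ} (hα : α < 2) :
    eigenOne (rieszKernel α) = Real.pi * (2 * α / ((2 - α) * (4 - α))) := by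
  have h : ∀ s ∈ Ioo (0 : ℝ) 1, rieszKernel α s * (1 - 2 * s) =
      rieszKernel α s - 2 * s ^ (-(α / 2) + 1) := fun s hs => by
    rw [Real.rpow_add_one hs.1.ne', rieszKernel]
    ring
  have hi : IntegrableOn (fun s : ℝ => 2 * s ^ (-(α / 2) + 1)) (Ioo 0 1) := by
    rw [integrableOn_Ioo_iff]
    exact (intervalIntegral.intervalIntegrable_rpow' (by linarith)).const_mul 2
  have h1 : -(α / 2) + 1 + 1 ≠ 0 := by linarith
  have h2 : 2 - α ≠ 0 := by linarith
  have h3 : 4 - α ≠ 0 := by linarith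
  rw [eigenOne, setIntegral_congr_fun measurableSet_Ioo h,
    integral_sub (isKernel_rieszKernel hα).integrable hi, integral_rieszKernel hα,
    setIntegral_Ioo_eq, intervalIntegral.integral_const_mul,
    integral_rpow (Or.inl (by linarith)), Real.zero_rpow h1, Real.one_rpow]
  congr 1
  have h4 : -(α / 2) + 1 + 1 = (4 - α) / 2 := by ring
  rw [h4]
  field_simp
  ring

/-- The constant `C_α ^ (4 - α)`. -/
def rieszConst (α : ℝ) : ℝ := (2 - α) * (4 - α) / Real.pi

theorem isLinearization {α : ℝ} (hα : α ∈ Ioo (0 : ℝ) 2) :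
    IsLinearization greenKernel (rieszKernel α) (rieszConst α) (2 * (4 - α)) where
  kernelG := isKernel_greenKernel
  kernelT := isKernel_rieszKernel hα.2
  antiG := fun s hs t ht hst =>
    mul_lt_mul_of_neg_left (Real.strictMonoOn_log hs.1 ht.1 hst)
      (neg_neg_of_pos (by positivity))
  antiT := fun s hs t ht hst =>
    Real.rpow_lt_rpow_of_neg hs.1 hst (by linarith [hα.1])
  nonneg_integral := by
    rw [integral_rieszKernel hα.2]
    exact div_nonneg zero_le_two (by linarith [hα.2])
  c_pos := div_pos (mul_pos (by linarith [hα.2]) (by linarith [hα.2])) Real.pi_pos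
  d_pos := by linarith [hα.2]
  eigenG_pos := by rw [eigenOne_greenKernel]; norm_num
  -- The constants combine to (1/8) (2α + 2 (4 - α)) = 1.
  eigen := by
    have h2 : 2 - α ≠ 0 := by linarith [hα.2]
    have h3 : 4 - α ≠ 0 := by linarith [hα.2]
    have hpi := Real.pi_ne_zero
    rw [eigenOne_greenKernel, eigenOne_rieszKernel hα.2, rieszConst]
    field_simp
    ring

/-! ### The linearized equation on the sphere -/

theorem bubbleConst_pos {α : ℝ} (hα : α < 2) : 0 < bubbleConst α :=
  Real.rpow_pos_of_pos (div_pos (mul_pos (by linarith) (by linarith)) Real.pi_pos) _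

theorem bubbleConst_rpow {α : ℝ} (hα : α < 2) : bubbleConst α ^ (4 - α) = rieszConst α := by
  have h3 : 4 - α ≠ 0 := by linarith
  rw [bubbleConst, ← Real.rpow_mul (div_pos (mul_pos (by linarith) (by linarith)) Real.pi_pos).le,
    one_div, inv_mul_cancel₀ h3, Real.rpow_one, rieszConst]

theorem exp_mul_stdBubble {α : ℝ} (hα : α < 2) (t : ℝ) (x : Plane) :
    Real.exp (t * stdBubble α x) =
      (bubbleConst α) ^ (t * ((4 - α) / 2)) * weight x ^ (-(t * ((4 - α) / 2))) := by
  have hC := bubbleConst_pos hα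
  have hw := weight_pos x
  have h : stdBubble α x = (4 - α) / 2 * Real.log (bubbleConst α / weight x) := by
    simp [stdBubble, bubble, weight]
  rw [h, ← mul_assoc, mul_comm, ← Real.rpow_def_of_pos (div_pos hC hw), Real.div_rpow hC.le hw.le,
    Real.rpow_neg hw.le, div_eq_mul_inv]

theorem exp_stdBubble {α : ℝ} (hα : α < 2) (x : Plane) :
    Real.exp (stdBubble α x) =
      (bubbleConst α) ^ ((4 - α) / 2) * weight x ^ (-((4 - α) / 2)) := by
  simpa using exp_mul_stdBubble hα 1 x

/-- Conformal covariance: w ^ (-(4 - α) / 2) = w⁻² w ^ (α / 2). The factors w⁻² are the densities of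
the measure, and the factors w ^ (α / 2) turn |x - y| ^ (-α) into chord ^ (-α / 2). -/
theorem exp_mul_exp_div {α : ℝ} (hα : α ∈ Ioo (0 : ℝ) 2) (x y : Plane) (r : ℝ) :
    Real.exp (stdBubble α x) * (Real.exp (stdBubble α y) * r / ‖x - y‖ ^ α) =
      (weight x ^ 2)⁻¹ * rieszConst α * ((weight y ^ 2)⁻¹ * (rieszKernel α (chord x y) * r)) := by
  have hC := bubbleConst_pos hα.2
  have hx := weight_pos x
  have hy := weight_pos y
  have hn := norm_nonneg (x - y)
  have h1 : rieszKernel α (chord x y) =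
      weight x ^ (α / 2) * weight y ^ (α / 2) / ‖x - y‖ ^ α := by
    rw [rieszKernel, chord, Real.rpow_neg (by positivity), Real.div_rpow (by positivity)
      (by positivity), Real.mul_rpow hx.le hy.le, ← Real.rpow_natCast, ← Real.rpow_mul hn, inv_div]
    congr 2
    push_cast
    ring
  have h2 : ∀ z : ℝ, 0 < z → z ^ (-((4 - α) / 2)) = (z ^ 2)⁻¹ * z ^ (α / 2) := fun z hz => by
    rw [← Real.rpow_natCast, ← Real.rpow_neg hz.le, ← Real.rpow_add hz]
    congr 1
    push_cast
    ring
  have h3 : bubbleConst α ^ ((4 - α) / 2) * bubbleConst α ^ ((4 - α) / 2) = rieszConst α := by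
    rw [← bubbleConst_rpow hα.2, ← Real.rpow_add hC]
    congr 1
    ring
  rw [exp_stdBubble hα.2, exp_stdBubble hα.2, h1, h2 _ hx, h2 _ hy, ← h3]
  ring

/-- The linearized equation in terms of zonal operators. -/
theorem linearizedRHS_eq {α : ℝ} (hα : α ∈ Ioo (0 : ℝ) 2) (φ : Plane → ℝ) (x : Plane) :
    linearizedRHS α φ x =
      (weight x ^ 2)⁻¹ * affineZonal (rieszKernel α) (rieszConst α) (2 * (4 - α)) φ x := by
  have key : ∀ h : Plane → ℝ, (∫ y, Real.exp (stdBubble α y) * h y / ‖x - y‖ ^ α) *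
      Real.exp (stdBubble α x) =
      (weight x ^ 2)⁻¹ * rieszConst α * zonal (rieszKernel α) h x := by
    intro h
    rw [mul_comm, ← integral_const_mul, zonal, integral_sphereMeasure, ← integral_const_mul]
    simp only [exp_mul_exp_div hα]
  have h1 := key φ
  have h2 := key fun _ => 1
  -- The potential of exp U becomes a constant on the sphere; multiplied by `rieszConst α` it equals
  -- 2 (4 - α), the coefficient of the multiplication operator.
  have h3 : zonal (rieszKernel α) (fun _ => 1) x = Real.pi * (2 / (2 - α)) := by
    simp only [zonal, mul_one, IsKernel.integral_comp_chord, integral_rieszKernel hα.2]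
  simp only [mul_one] at h2
  rw [linearizedRHS, h1, h2, h3, affineZonal, rieszConst]
  have h4 : 2 - α ≠ 0 := by linarith [hα.2]
  have hpi := Real.pi_ne_zero
  field_simp

end Choquard

end

noncomputable section

namespace Choquard

open Set Filter Topology Metric
open scoped ENNReal Convolution

/-! ### Growth of functions with square integrable gradient -/

theorem setLIntegral_ball_comp_smul {g : Plane → ℝ≥0∞} (hg : Measurable g) {s r : ℝ} (hs : 0 < s) :
    ∫⁻ x in ball 0 r, g (s • x) = ENNReal.ofReal ((s ^ 2)⁻¹) * ∫⁻ x in ball 0 (s * r), g x := by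
  have hm : Measurable fun x : Plane => s • x := measurable_const_smul s
  have h1 := Measure.map_addHaar_smul (volume : Measure Plane) hs.ne'
  rw [finrank_euclideanSpace_fin, abs_of_pos (by positivity)] at h1
  have h2 : (fun x : Plane => s • x) ⁻¹' ball 0 (s * r) = ball 0 r := by
    ext x
    simp [norm_smul, abs_of_pos hs, hs]
  have h3 := setLIntegral_map (μ := volume) (measurableSet_ball (x := (0 : Plane)) (ε := s * r)) hg hm
  rw [h2] at h3
  rw [← h3, show Measure.map (fun x : Plane => s • x) volume = _ from h1, Measure.restrict_smul,
    lintegral_smul_measure, smul_eq_mul]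

/-- Fundamental theorem of calculus along the ray from x to 2x. -/
theorem enorm_sub_le_lintegral_fderiv {u : Plane → ℝ} (hu : ContDiff ℝ 1 u) (x : Plane) :
    ‖u ((2 : ℝ) • x)‖ₑ ≤ ‖u x‖ₑ + ∫⁻ s in Ioc (1 : ℝ) 2, ‖fderiv ℝ u (s • x)‖ₑ * ‖x‖ₑ := by
  have hd : ∀ s : ℝ, HasDerivAt (fun s : ℝ => u (s • x)) (fderiv ℝ u (s • x) x) s := by
    intro s
    have h1 : HasDerivAt (fun s : ℝ => s • x) x s := by
      simpa using (hasDerivAt_id s).smul_const x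
    exact ((hu.differentiable one_ne_zero) (s • x)).hasFDerivAt.comp_hasDerivAt s h1
  have hc : Continuous fun s : ℝ => fderiv ℝ u (s • x) x :=
    ((hu.continuous_fderiv one_ne_zero).comp (by fun_prop)).clm_apply continuous_const
  have h2 := intervalIntegral.integral_eq_sub_of_hasDerivAt (fun s _ => hd s)
    (hc.intervalIntegrable 1 2)
  rw [one_smul, intervalIntegral.integral_of_le one_le_two] at h2
  have h3 : u ((2 : ℝ) • x) = u x + ∫ s in Ioc (1 : ℝ) 2, fderiv ℝ u (s • x) x := by
    rw [h2]
    ring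
  rw [h3]
  refine (enorm_add_le _ _).trans (add_le_add le_rfl ?_)
  refine (enorm_integral_le_lintegral_enorm _).trans (lintegral_mono fun s => ?_)
  exact ContinuousLinearMap.le_opENorm _ _

/-- Doubling the radius of a ball multiplies the mass at most by four, up to the gradient. -/
theorem lintegral_ball_two_mul_le {u : Plane → ℝ} (hu : ContDiff ℝ 1 u) {M : ℝ≥0∞}
    (hM : ∀ r : ℝ, 1 ≤ r → ∫⁻ x in ball 0 r, ‖fderiv ℝ u x‖ₑ ≤ M * ENNReal.ofReal r)
    {r : ℝ} (hr : 1 ≤ r) :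
    ∫⁻ x in ball 0 (2 * r), ‖u x‖ₑ ≤
      4 * ((∫⁻ x in ball 0 r, ‖u x‖ₑ) + M * ENNReal.ofReal (r ^ 2)) := by
  have hmu : Measurable fun x => ‖u x‖ₑ := hu.continuous.enorm.measurable
  have hcd : Continuous fun x => ‖fderiv ℝ u x‖ₑ := (hu.continuous_fderiv one_ne_zero).enorm
  have h1 := setLIntegral_ball_comp_smul hmu (s := 2) (r := r) two_pos
  have h2 : ∫⁻ x in ball 0 (2 * r), ‖u x‖ₑ = 4 * ∫⁻ x in ball 0 r, ‖u ((2 : ℝ) • x)‖ₑ := by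
    rw [h1, ← mul_assoc]
    have h3 : (4 : ℝ≥0∞) * ENNReal.ofReal ((2 ^ 2)⁻¹) = 1 := by
      rw [show (4 : ℝ≥0∞) = ENNReal.ofReal 4 by simp, ← ENNReal.ofReal_mul (by norm_num)]
      norm_num
    rw [h3, one_mul]
  rw [h2]
  gcongr
  have hmeas : Measurable fun p : Plane × ℝ => ‖fderiv ℝ u (p.2 • p.1)‖ₑ * ‖p.1‖ₑ :=
    (hcd.comp (by fun_prop)).measurable.mul (by fun_prop)
  calc ∫⁻ x in ball 0 r, ‖u ((2 : ℝ) • x)‖ₑ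
      ≤ ∫⁻ x in ball 0 r, (‖u x‖ₑ + ∫⁻ s in Ioc (1 : ℝ) 2, ‖fderiv ℝ u (s • x)‖ₑ * ‖x‖ₑ) :=
        lintegral_mono fun x => enorm_sub_le_lintegral_fderiv hu x
    _ = (∫⁻ x in ball 0 r, ‖u x‖ₑ) +
        ∫⁻ x in ball 0 r, ∫⁻ s in Ioc (1 : ℝ) 2, ‖fderiv ℝ u (s • x)‖ₑ * ‖x‖ₑ :=
        lintegral_add_left hmu _
    _ = (∫⁻ x in ball 0 r, ‖u x‖ₑ) +
        ∫⁻ s in Ioc (1 : ℝ) 2, ∫⁻ x in ball 0 r, ‖fderiv ℝ u (s • x)‖ₑ * ‖x‖ₑ := by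
        rw [lintegral_lintegral_swap hmeas.aemeasurable]
    _ ≤ (∫⁻ x in ball 0 r, ‖u x‖ₑ) + ∫⁻ s in Ioc (1 : ℝ) 2, M * ENNReal.ofReal (r ^ 2) := by
        gcongr 1
        refine setLIntegral_mono measurable_const fun s hs => ?_
        have hs0 : 0 < s := by linarith [hs.1]
        have hr0 : 0 < r := by linarith
        have hcs : Measurable fun x : Plane => ‖fderiv ℝ u (s • x)‖ₑ :=
          (hcd.comp (continuous_const_smul s)).measurable
        calc ∫⁻ x in ball 0 r, ‖fderiv ℝ u (s • x)‖ₑ * ‖x‖ₑ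
            ≤ ∫⁻ x in ball 0 r, ‖fderiv ℝ u (s • x)‖ₑ * ENNReal.ofReal r := by
              refine setLIntegral_mono (hcs.mul_const _) fun x hx => ?_
              gcongr
              rw [← ofReal_norm]
              exact ENNReal.ofReal_le_ofReal (mem_ball_zero_iff.1 hx).le
          _ = ENNReal.ofReal ((s ^ 2)⁻¹) * (∫⁻ x in ball 0 (s * r), ‖fderiv ℝ u x‖ₑ) *
                ENNReal.ofReal r := by
              rw [lintegral_mul_const _ hcs,
                setLIntegral_ball_comp_smul hcd.measurable hs0]
          _ ≤ ENNReal.ofReal ((s ^ 2)⁻¹) * (M * ENNReal.ofReal (s * r)) * ENNReal.ofReal r := by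
              gcongr
              exact hM _ (by nlinarith [hs.1])
          _ = M * ENNReal.ofReal ((s ^ 2)⁻¹ * (s * r) * r) := by
              rw [ENNReal.ofReal_mul (p := (s ^ 2)⁻¹ * (s * r)) (by positivity),
                ENNReal.ofReal_mul (p := (s ^ 2)⁻¹) (by positivity)]
              ring
          _ ≤ M * ENNReal.ofReal (r ^ 2) := by
              gcongr
              have : (s ^ 2)⁻¹ * (s * r) * r = s⁻¹ * r ^ 2 := by field_simp
              rw [this]
              exact mul_le_of_le_one_left (sq_nonneg r) (inv_le_one_of_one_le₀ hs.1.le)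
    _ = (∫⁻ x in ball 0 r, ‖u x‖ₑ) + M * ENNReal.ofReal (r ^ 2) := by
        rw [setLIntegral_const, Real.volume_Ioc]
        norm_num

/-- Iteration of the doubling estimate. The base 6 exceeds the true rate 4 so that the induction
closes with the constant A + 2M (4·2 + 4 = 6·2), and it stays below the 8 needed for summation
against w ^ (-3/2). -/
theorem lintegral_ball_two_pow_le {u : Plane → ℝ} (hu : ContDiff ℝ 1 u) {A M : ℝ≥0∞}
    (hA : ∫⁻ x in ball 0 1, ‖u x‖ₑ ≤ A)
    (hM : ∀ r : ℝ, 1 ≤ r → ∫⁻ x in ball 0 r, ‖fderiv ℝ u x‖ₑ ≤ M * ENNReal.ofReal r) (k : ℕ) :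
    ∫⁻ x in ball 0 (2 ^ k), ‖u x‖ₑ ≤ 6 ^ k * (A + 2 * M) := by
  induction k with
  | zero => simpa using hA.trans le_self_add
  | succ k ih =>
    rw [pow_succ']
    refine (lintegral_ball_two_mul_le hu hM (one_le_pow₀ one_le_two)).trans ?_
    have h1 : ENNReal.ofReal ((2 ^ k) ^ 2) ≤ 6 ^ k := by
      rw [← pow_mul, mul_comm, pow_mul, ENNReal.ofReal_pow (by norm_num)]
      gcongr
      norm_num
    calc 4 * ((∫⁻ x in ball 0 (2 ^ k), ‖u x‖ₑ) + M * ENNReal.ofReal ((2 ^ k) ^ 2))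
        ≤ 4 * (6 ^ k * (A + 2 * M) + M * 6 ^ k) := by gcongr
      _ = 6 ^ k * (4 * A + 12 * M) := by ring
      _ ≤ 6 ^ k * (6 * A + 12 * M) := by gcongr; norm_num
      _ = 6 ^ (k + 1) * (A + 2 * M) := by ring

/-- A mollifier of mass at most one, supported in the unit ball, sees only values in the ball with
radius enlarged by one. -/
theorem lintegral_ball_convolution_le {ρ g : Plane → ℝ} (hρc : Continuous ρ)
    (hρ0 : ∀ t, 1 ≤ ‖t‖ → ρ t = 0) (hρ1 : ∫⁻ t, ‖ρ t‖ₑ ≤ 1)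
    (hg : AEStronglyMeasurable g volume) (r : ℝ) :
    ∫⁻ x in ball 0 r, ‖∫ t, ρ t * g (x - t)‖ₑ ≤ ∫⁻ x in ball 0 (r + 1), ‖g x‖ₑ := by
  have hm : AEStronglyMeasurable (fun p : Plane × Plane => ρ p.2 * g (p.1 - p.2))
      (volume.prod volume) :=
    AEStronglyMeasurable.convolution_integrand (ContinuousLinearMap.mul ℝ ℝ)
      hρc.aestronglyMeasurable hg
  have hm' : AEMeasurable (fun p : Plane × Plane => ‖ρ p.2 * g (p.1 - p.2)‖ₑ)
      ((volume.restrict (ball 0 r)).prod volume) :=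
    (hm.mono_ac (Measure.AbsolutelyContinuous.prod
      Measure.restrict_le_self.absolutelyContinuous Measure.AbsolutelyContinuous.rfl)).enorm
  calc ∫⁻ x in ball 0 r, ‖∫ t, ρ t * g (x - t)‖ₑ
      ≤ ∫⁻ x in ball 0 r, ∫⁻ t, ‖ρ t * g (x - t)‖ₑ :=
        lintegral_mono fun x => enorm_integral_le_lintegral_enorm _
    _ = ∫⁻ t, ∫⁻ x in ball 0 r, ‖ρ t * g (x - t)‖ₑ := lintegral_lintegral_swap hm'
    _ ≤ ∫⁻ t, ‖ρ t‖ₑ * ∫⁻ x in ball 0 (r + 1), ‖g x‖ₑ := by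
        refine lintegral_mono fun t => ?_
        simp only [enorm_mul]
        rw [lintegral_const_mul' _ _ enorm_ne_top]
        by_cases ht : 1 ≤ ‖t‖
        · simp [hρ0 t ht]
        refine mul_le_mul_right ?_ _
        rw [← lintegral_indicator measurableSet_ball, ← lintegral_indicator measurableSet_ball]
        rw [← lintegral_sub_right_eq_self (fun x => (ball 0 (r + 1)).indicator (fun x => ‖g x‖ₑ) x) t]
        refine lintegral_mono fun x => ?_
        by_cases hx : x ∈ ball (0 : Plane) r
        · have hx' : x - t ∈ ball (0 : Plane) (r + 1) := by
            rw [mem_ball_zero_iff] at *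
            exact (norm_sub_le _ _).trans_lt (by linarith [not_le.1 ht])
          rw [indicator_of_mem hx, indicator_of_mem hx']
        · rw [indicator_of_notMem hx]
          exact zero_le
    _ ≤ ∫⁻ x in ball 0 (r + 1), ‖g x‖ₑ := by
        rw [lintegral_mul_const'' _ hρc.enorm.measurable.aemeasurable]
        exact mul_le_of_le_one_left zero_le hρ1

theorem opNorm_le_sum (L : Plane →L[ℝ] ℝ) :
    ‖L‖ₑ ≤ ∑ i, ‖L (EuclideanSpace.single i 1)‖ₑ := by
  have h : ‖L‖ ≤ ∑ i, ‖L (EuclideanSpace.single i 1)‖ := by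
    refine L.opNorm_le_bound (Finset.sum_nonneg fun i _ => norm_nonneg _) fun x => ?_
    have hx : x = ∑ i, x i • EuclideanSpace.single i (1 : ℝ) := by
      ext j
      fin_cases j <;> simp [Fin.sum_univ_two]
    conv_lhs => rw [hx]
    rw [map_sum, Finset.sum_mul]
    refine (norm_sum_le _ _).trans (Finset.sum_le_sum fun i _ => ?_)
    rw [map_smul, norm_smul, mul_comm]
    gcongr
    exact PiLp.norm_apply_le x i
  calc ‖L‖ₑ = ENNReal.ofReal ‖L‖ := (ofReal_norm _).symm
    _ ≤ ENNReal.ofReal (∑ i, ‖L (EuclideanSpace.single i 1)‖) := ENNReal.ofReal_le_ofReal h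
    _ = ∑ i, ‖L (EuclideanSpace.single i 1)‖ₑ := by
        rw [ENNReal.ofReal_sum_of_nonneg fun i _ => norm_nonneg _]
        exact Finset.sum_congr rfl fun i _ => ofReal_norm _

/-- Cauchy–Schwarz: the root of the area of the ball is √π (r + 1), at most 2 √π r. -/
theorem lintegral_ball_le_of_memLp {G : Plane → Plane} (hG : MemLp G 2 volume) :
    ∃ M : ℝ≥0∞, M ≠ ⊤ ∧ ∀ (i : Fin 2) (r : ℝ), 1 ≤ r →
      ∫⁻ x in ball 0 (r + 1), ‖G x i‖ₑ ≤ M * ENNReal.ofReal r := by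
  refine ⟨eLpNorm G 2 volume * (2 * ENNReal.ofReal Real.pi ^ (1 / 2 : ℝ)), ?_, fun i r hr => ?_⟩
  · exact ENNReal.mul_ne_top hG.2.ne
      (ENNReal.mul_ne_top (by simp) (ENNReal.rpow_ne_top_of_nonneg (by norm_num) (by simp)))
  have h1 : ∫⁻ x in ball 0 (r + 1), ‖G x i‖ₑ ≤ eLpNorm G 1 (volume.restrict (ball 0 (r + 1))) := by
    rw [eLpNorm_one_eq_lintegral_enorm]
    refine lintegral_mono fun x => ?_
    rw [← ofReal_norm, ← ofReal_norm]
    exact ENNReal.ofReal_le_ofReal (PiLp.norm_apply_le (G x) i)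
  refine h1.trans ((eLpNorm_le_eLpNorm_mul_rpow_measure_univ one_le_two
    hG.1.restrict).trans ?_)
  rw [Measure.restrict_apply_univ, EuclideanSpace.volume_ball_fin_two, mul_assoc]
  gcongr ?_ * ?_
  · exact eLpNorm_restrict_le _ _ _ _
  have h2 : (1 / (1 : ℝ≥0∞).toReal - 1 / (2 : ℝ≥0∞).toReal) = 1 / 2 := by norm_num
  have h3 : ENNReal.ofReal (r + 1) ≤ 2 * ENNReal.ofReal r := by
    rw [show (2 : ℝ≥0∞) = ENNReal.ofReal 2 by simp, ← ENNReal.ofReal_mul (by norm_num)]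
    exact ENNReal.ofReal_le_ofReal (by linarith)
  rw [h2, ENNReal.mul_rpow_of_nonneg _ _ (by norm_num), ← ENNReal.rpow_natCast,
    ← ENNReal.rpow_mul]
  norm_num
  calc ENNReal.ofReal (r + 1) * ENNReal.ofReal Real.pi ^ (1 / 2 : ℝ)
      ≤ (2 * ENNReal.ofReal r) * ENNReal.ofReal Real.pi ^ (1 / 2 : ℝ) := by gcongr
    _ = _ := by ring

/-- Dyadic decomposition: w ^ (-3/2) is at most 8 · 8⁻ᵏ for the smallest k with |x| < 2ᵏ, and 8 Σ
(6/8)ᵏ = 32. -/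
theorem lintegral_weight_le_of_balls {u : Plane → ℝ} (hu : AEStronglyMeasurable u volume)
    {B : ℝ≥0∞} (hB : ∀ k : ℕ, ∫⁻ x in ball 0 (2 ^ k), ‖u x‖ₑ ≤ 6 ^ k * B) :
    ∫⁻ x, ‖weight x ^ (-(3 / 2) : ℝ) * u x‖ₑ ≤ 32 * B := by
  have hw : ∀ x : Plane, ‖weight x ^ (-(3 / 2) : ℝ)‖ₑ ≤
      ∑' k : ℕ, 8 * (8⁻¹) ^ k * (ball (0 : Plane) (2 ^ k)).indicator 1 x := by
    intro x
    have hex : ∃ k : ℕ, ‖x‖ < 2 ^ k := pow_unbounded_of_one_lt _ one_lt_two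
    classical
    have hk := Nat.find_spec hex
    -- Minimality of k gives |x| ≥ 2 ^ (k - 1) for k ≥ 1, hence w ≥ 4 ^ (k - 1). For k = 0 the bound
    -- w ≥ 1 is enough.
    have hmin : ∀ j, j < Nat.find hex → 2 ^ j ≤ ‖x‖ := fun j hj => not_lt.1 (Nat.find_min hex hj)
    set k := Nat.find hex
    refine le_trans ?_ (ENNReal.le_tsum k)
    rw [indicator_of_mem (mem_ball_zero_iff.2 hk), Pi.one_apply, mul_one]
    have hpos := weight_pos x
    rw [← ofReal_norm, Real.norm_of_nonneg (Real.rpow_nonneg hpos.le _)]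
    have h8 : (8 : ℝ≥0∞) * (8⁻¹) ^ k = ENNReal.ofReal (8 * (8⁻¹) ^ k) := by
      rw [ENNReal.ofReal_mul (by norm_num), ENNReal.ofReal_pow (by norm_num),
        ENNReal.ofReal_inv_of_pos (by norm_num)]
      norm_num
    rw [h8]
    refine ENNReal.ofReal_le_ofReal ?_
    rcases Nat.eq_zero_or_pos k with h0 | h0
    · rw [h0]
      have := Real.rpow_le_one_of_one_le_of_nonpos (one_le_weight x) (z := -(3 / 2)) (by norm_num)
      linarith
    · obtain ⟨j, hj⟩ : ∃ j, k = j + 1 := ⟨k - 1, by omega⟩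
      have h1 := hmin j (by omega)
      have h2 : ((2 : ℝ) ^ j) ^ 2 ≤ weight x := by
        rw [weight]
        nlinarith [pow_pos (two_pos (α := ℝ)) j]
      have h3 := Real.rpow_le_rpow_of_nonpos (by positivity) h2 (z := -(3 / 2)) (by norm_num)
      refine h3.trans_eq ?_
      rw [← Real.rpow_natCast, ← Real.rpow_mul (by positivity), hj, pow_succ]
      have : ((2 : ℕ) : ℝ) * (-(3 / 2)) = ((-3 : ℤ) : ℝ) := by norm_num
      rw [this, Real.rpow_intCast, zpow_neg, ← inv_zpow, ← inv_pow]
      norm_cast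
      rw [← pow_mul, mul_comm j 3, pow_mul]
      norm_num
      ring
  calc ∫⁻ x, ‖weight x ^ (-(3 / 2) : ℝ) * u x‖ₑ
      ≤ ∫⁻ x, ∑' k : ℕ, 8 * (8⁻¹) ^ k * (ball (0 : Plane) (2 ^ k)).indicator (fun x => ‖u x‖ₑ) x := by
        refine lintegral_mono fun x => ?_
        rw [enorm_mul]
        refine (mul_le_mul_left (hw x) _).trans_eq ?_
        rw [← ENNReal.tsum_mul_right]
        congr 1
        ext k
        by_cases hx : x ∈ ball (0 : Plane) (2 ^ k) <;> simp [hx]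
    _ = ∑' k : ℕ, 8 * (8⁻¹) ^ k * ∫⁻ x in ball (0 : Plane) (2 ^ k), ‖u x‖ₑ := by
        rw [lintegral_tsum]
        · congr 1
          ext k
          rw [lintegral_const_mul', lintegral_indicator measurableSet_ball]
          exact ENNReal.mul_ne_top (by norm_num) (ENNReal.pow_ne_top (by norm_num))
        · exact fun k => (hu.enorm.indicator measurableSet_ball).const_mul _
    _ ≤ ∑' k : ℕ, (8 * B) * (3 / 4) ^ k := by
        refine ENNReal.tsum_le_tsum fun k => ?_
        refine (mul_le_mul_right (hB k) _).trans_eq ?_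
        have : (3 / 4 : ℝ≥0∞) = 8⁻¹ * 6 := by
          rw [← ENNReal.toReal_eq_toReal_iff' (by norm_num [ENNReal.div_eq_top])
            (ENNReal.mul_ne_top (by norm_num) (by norm_num))]
          norm_num
        rw [this, mul_pow]
        ring
    _ = 32 * B := by
        rw [ENNReal.tsum_mul_left, ENNReal.tsum_geometric]
        have : (1 - 3 / 4 : ℝ≥0∞)⁻¹ = 4 := by
          have h34 : (3 / 4 : ℝ≥0∞) + 1 / 4 = 1 := by
            rw [ENNReal.div_add_div_same]
            norm_num
            exact ENNReal.div_self (by norm_num) (by norm_num)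
          have : (1 - 3 / 4 : ℝ≥0∞) = 1 / 4 :=
            ENNReal.sub_eq_of_eq_add_rev (by norm_num [ENNReal.div_eq_top]) h34.symm
          rw [this]
          simp
        rw [this]
        ring

/-! ### Mollification of functions with a weak gradient -/

theorem isTestFunction_comp_sub {ρ : Plane → ℝ} (hρ : IsTestFunction ρ) (x : Plane) :
    IsTestFunction fun y => ρ (x - y) :=
  ⟨hρ.1.comp (contDiff_const.sub contDiff_id),
    hρ.2.comp_homeomorph (Homeomorph.subLeft x)⟩

theorem fderiv_comp_sub {ρ : Plane → ℝ} (hρ : IsTestFunction ρ) (x y v : Plane) :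
    fderiv ℝ (fun y => ρ (x - y)) y v = -fderiv ℝ ρ (x - y) v := by
  have h1 : HasFDerivAt ρ (fderiv ℝ ρ (x - y)) (x - y) :=
    (hρ.1.differentiable (by simp) _).hasFDerivAt
  have h2 : HasFDerivAt (fun y : Plane => x - y) (-ContinuousLinearMap.id ℝ Plane) y :=
    (hasFDerivAt_id y).const_sub x
  have h3 := h1.comp y h2
  rw [show (fun y => ρ (x - y)) = ρ ∘ fun y => x - y from rfl, h3.fderiv]
  simp

/-- Mollification commutes with weak derivatives. -/
theorem fderiv_convolution {u : Plane → ℝ} {G : Plane → Plane} (hu : HasWeakGradient u G)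
    {ρ : Plane → ℝ} (hρ : IsTestFunction ρ) (x : Plane) (i : Fin 2) :
    fderiv ℝ (ρ ⋆[ContinuousLinearMap.lsmul ℝ ℝ, volume] u) x (EuclideanSpace.single i 1) =
      ∫ t, ρ t * G (x - t) i := by
  have hρ1 : ContDiff ℝ 1 ρ := hρ.1.of_le (by simp)
  have h1 := hρ.2.hasFDerivAt_convolution_left (ContinuousLinearMap.lsmul ℝ ℝ) hρ1 hu.1 x
  have hex : ConvolutionExistsAt (fderiv ℝ ρ) u x
      ((ContinuousLinearMap.lsmul ℝ ℝ).precompL Plane) volume :=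
    (hρ.2.fderiv ℝ).convolutionExists_left _ (hρ1.continuous_fderiv one_ne_zero) hu.1 x
  rw [h1.fderiv, convolution, ContinuousLinearMap.integral_apply hex]
  simp only [ContinuousLinearMap.precompL_apply, ContinuousLinearMap.lsmul_apply, smul_eq_mul]
  have h2 := hu.2.2 _ (isTestFunction_comp_sub hρ x) i
  simp only [fderiv_comp_sub hρ, mul_neg, integral_neg, neg_inj] at h2
  have h3 := integral_sub_left_eq_self
    (fun t => fderiv ℝ ρ t (EuclideanSpace.single i 1) * u (x - t)) volume x
  have h4 := integral_sub_left_eq_self (fun t => ρ t * G (x - t) i) volume x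
  simp only [sub_sub_cancel] at h3 h4
  rw [← h3, ← h4]
  simp only [mul_comm] at h2 ⊢
  exact h2

/-- A sequence of mollifiers. -/
def mollifier (n : ℕ) : ContDiffBump (0 : Plane) where
  rIn := ((n : ℝ) + 1)⁻¹ / 2
  rOut := ((n : ℝ) + 1)⁻¹
  rIn_pos := by positivity
  rIn_lt_rOut := half_lt_self (by positivity)

theorem rOut_mollifier_le (n : ℕ) : (mollifier n).rOut ≤ 1 :=
  inv_le_one_of_one_le₀ (by simp)

theorem isTestFunction_mollifier (n : ℕ) : IsTestFunction ((mollifier n).normed volume) :=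
  ⟨(mollifier n).contDiff_normed, (mollifier n).hasCompactSupport_normed⟩

theorem mollifier_eq_zero (n : ℕ) {t : Plane} (ht : 1 ≤ ‖t‖) :
    (mollifier n).normed volume t = 0 := by
  rw [← Function.notMem_support, ContDiffBump.support_normed_eq, mem_ball_zero_iff]
  exact not_lt.2 ((rOut_mollifier_le n).trans ht)

theorem lintegral_mollifier (n : ℕ) : ∫⁻ t, ‖(mollifier n).normed volume t‖ₑ ≤ 1 := by
  have h1 : ∀ t, ‖(mollifier n).normed volume t‖ₑ =
      ENNReal.ofReal ((mollifier n).normed volume t) := fun t =>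
    Real.enorm_of_nonneg ((mollifier n).nonneg_normed t)
  simp only [h1]
  rw [← ofReal_integral_eq_lintegral_ofReal (mollifier n).integrable_normed
    (ae_of_all _ (mollifier n).nonneg_normed), (mollifier n).integral_normed]
  simp

/-- A function with square integrable weak gradient grows slower than linearly in the mean. -/
theorem integrable_weight_mul {u : Plane → ℝ} {G : Plane → Plane} (hu : HasWeakGradient u G)
    (hG : MemLp G 2 volume) : Integrable fun x => weight x ^ (-(3 / 2) : ℝ) * u x := by
  have hum : AEStronglyMeasurable u volume := hu.1.aestronglyMeasurable
  obtain ⟨M, hM, hMi⟩ := lintegral_ball_le_of_memLp hG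
  set A : ℝ≥0∞ := ∫⁻ x in ball 0 (1 + 1), ‖u x‖ₑ with hA
  have hAfin : A ≠ ⊤ := by
    have h1 : IntegrableOn u (ball 0 (1 + 1)) volume :=
      (hu.1.integrableOn_isCompact (isCompact_closedBall (0 : Plane) (1 + 1))).mono_set
        ball_subset_closedBall
    exact h1.2.ne
  set v : ℕ → Plane → ℝ := fun n =>
    ((mollifier n).normed volume) ⋆[ContinuousLinearMap.lsmul ℝ ℝ, volume] u with hv
  have hvc : ∀ n, ContDiff ℝ 1 (v n) := fun n =>
    (isTestFunction_mollifier n).2.contDiff_convolution_left (n := 1) _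
      ((isTestFunction_mollifier n).1.of_le (by simp)) hu.1
  have hρc : ∀ n, Continuous ((mollifier n).normed (volume : Measure Plane)) := fun n =>
    (mollifier n).continuous_normed
  have hvA : ∀ n, ∫⁻ x in ball 0 1, ‖v n x‖ₑ ≤ A := fun n =>
    lintegral_ball_convolution_le (hρc n) (fun t ht => mollifier_eq_zero n ht)
      (lintegral_mollifier n) hum 1
  have hGm : ∀ i, AEStronglyMeasurable (fun x => G x i) volume := fun i =>
    (EuclideanSpace.proj i : Plane →L[ℝ] ℝ).continuous.comp_aestronglyMeasurable hG.1
  have hvM : ∀ n (r : ℝ), 1 ≤ r →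
      ∫⁻ x in ball 0 r, ‖fderiv ℝ (v n) x‖ₑ ≤ 2 * M * ENNReal.ofReal r := by
    intro n r hr
    have hcont : ∀ i : Fin 2, Continuous fun x =>
        fderiv ℝ (v n) x (EuclideanSpace.single i 1) := fun i =>
      ((hvc n).continuous_fderiv one_ne_zero).clm_apply continuous_const
    calc ∫⁻ x in ball 0 r, ‖fderiv ℝ (v n) x‖ₑ
        ≤ ∫⁻ x in ball 0 r, ∑ i, ‖fderiv ℝ (v n) x (EuclideanSpace.single i 1)‖ₑ :=
          lintegral_mono fun x => opNorm_le_sum _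
      _ = ∑ i, ∫⁻ x in ball 0 r, ‖fderiv ℝ (v n) x (EuclideanSpace.single i 1)‖ₑ :=
          lintegral_finsetSum _ fun i _ => (hcont i).enorm.measurable
      _ ≤ ∑ i : Fin 2, M * ENNReal.ofReal r := by
          refine Finset.sum_le_sum fun i _ => le_trans ?_ (hMi i r hr)
          simp only [hv, fderiv_convolution hu (isTestFunction_mollifier n)]
          exact lintegral_ball_convolution_le (hρc n) (fun t ht => mollifier_eq_zero n ht)
            (lintegral_mollifier n) (hGm i) r
      _ = 2 * M * ENNReal.ofReal r := by
          rw [Fin.sum_univ_two]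
          ring
  have hlim : ∀ᵐ x, Tendsto (fun n => v n x) atTop (𝓝 (u x)) := by
    refine ContDiffBump.ae_convolution_tendsto_right_of_locallyIntegrable (K := 2) ?_ ?_ hu.1
    · exact tendsto_inv_atTop_zero.comp
        (tendsto_atTop_add_const_right _ _ tendsto_natCast_atTop_atTop)
    · exact Eventually.of_forall fun n => by simp only [mollifier]; linarith
  -- The bounds for the mollified functions are uniform in n and pass to u by Fatou's lemma.
  have hball : ∀ k : ℕ, ∫⁻ x in ball 0 (2 ^ k), ‖u x‖ₑ ≤ 6 ^ k * (A + 2 * (2 * M)) := by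
    intro k
    have h1 : ∫⁻ x in ball 0 (2 ^ k), ‖u x‖ₑ ≤
        ∫⁻ x in ball 0 (2 ^ k), liminf (fun n => ‖v n x‖ₑ) atTop := by
      refine lintegral_mono_ae (ae_restrict_of_ae ?_)
      filter_upwards [hlim] with x hx
      rw [hx.enorm.liminf_eq]
    refine h1.trans ((lintegral_liminf_le fun n => (hvc n).continuous.enorm.measurable).trans ?_)
    exact liminf_le_of_le (h := fun b hb => by
      obtain ⟨n, hn⟩ := hb.exists
      exact hn.trans (lintegral_ball_two_pow_le (hvc n) (hvA n) (hvM n) k))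
  have hwc : Continuous fun x : Plane => weight x ^ (-(3 / 2) : ℝ) :=
    continuous_weight.rpow_const fun x => Or.inl (weight_ne_zero x)
  refine ⟨hwc.aestronglyMeasurable.mul hum, ?_⟩
  refine (lintegral_weight_le_of_balls hum hball).trans_lt ?_
  exact ENNReal.mul_lt_top (by norm_num) (ENNReal.add_lt_top.2 ⟨hAfin.lt_top,
    ENNReal.mul_lt_top (by norm_num) (ENNReal.mul_lt_top (by norm_num) hM.lt_top)⟩)

end Choquard

end

noncomputable section

namespace Choquard

open Set Filter Topology Metric
open scoped ENNReal

/-! ### Partial derivatives -/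

/-- The partial derivative in the `i`-th direction. -/
def pd (i : Fin 2) (u : Plane → ℝ) (x : Plane) : ℝ := fderiv ℝ u x (EuclideanSpace.single i 1)

/-- The Laplacian as a sum of second partial derivatives. -/
def lap (u : Plane → ℝ) (x : Plane) : ℝ := ∑ i, pd i (pd i u) x

theorem contDiff_pd {u : Plane → ℝ} (hu : ContDiff ℝ ∞ u) (i : Fin 2) : ContDiff ℝ ∞ (pd i u) :=
  (hu.fderiv_right (m := ∞) (by simp)).clm_apply contDiff_const

theorem contDiff_lap {u : Plane → ℝ} (hu : ContDiff ℝ ∞ u) : ContDiff ℝ ∞ (lap u) :=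
  ContDiff.sum fun i _ => contDiff_pd (contDiff_pd hu i) i

theorem pd_add {u v : Plane → ℝ} {x : Plane} (hu : DifferentiableAt ℝ u x)
    (hv : DifferentiableAt ℝ v x) (i : Fin 2) :
    pd i (fun y => u y + v y) x = pd i u x + pd i v x := by
  simp [pd, fderiv_fun_add hu hv]

theorem pd_const_mul {u : Plane → ℝ} {x : Plane} (hu : DifferentiableAt ℝ u x) (c : ℝ)
    (i : Fin 2) : pd i (fun y => c * u y) x = c * pd i u x := by
  simp [pd, fderiv_const_mul hu]

theorem pd_mul {u v : Plane → ℝ} {x : Plane} (hu : DifferentiableAt ℝ u x)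
    (hv : DifferentiableAt ℝ v x) (i : Fin 2) :
    pd i (fun y => u y * v y) x = pd i u x * v x + u x * pd i v x := by
  simp [pd, fderiv_fun_mul hu hv]
  ring

theorem pd_comp {F : ℝ → ℝ} {F' : ℝ} {u : Plane → ℝ} {x : Plane} (hu : DifferentiableAt ℝ u x)
    (hF : HasDerivAt F F' (u x)) (i : Fin 2) : pd i (fun y => F (u y)) x = F' * pd i u x := by
  have h := hF.comp_hasFDerivAt x hu.hasFDerivAt
  rw [pd, show (fun y => F (u y)) = F ∘ u from rfl, h.fderiv]
  simp [pd]

theorem pd_div {u v : Plane → ℝ} {x : Plane} (hu : DifferentiableAt ℝ u x)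
    (hv : DifferentiableAt ℝ v x) (h0 : v x ≠ 0) (i : Fin 2) :
    pd i (fun y => u y / v y) x = (pd i u x * v x - u x * pd i v x) / v x ^ 2 := by
  simp only [div_eq_mul_inv]
  rw [pd_mul (v := fun y => (v y)⁻¹) hu (hv.inv h0), pd_comp hv (hasDerivAt_inv h0)]
  field_simp
  ring

theorem pd_const (c : ℝ) (i : Fin 2) (x : Plane) : pd i (fun _ => c) x = 0 := by
  simp [pd]

theorem pd_coord (i j : Fin 2) (x : Plane) :
    pd i (fun y => y j) x = if j = i then 1 else 0 := by
  have h : HasFDerivAt (fun y : Plane => y j) (EuclideanSpace.proj j : Plane →L[ℝ] ℝ) x :=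
    (EuclideanSpace.proj j : Plane →L[ℝ] ℝ).hasFDerivAt
  rw [pd, h.fderiv]
  simp

theorem pd_comp_smul {u : Plane → ℝ} (hu : Differentiable ℝ u) (c : ℝ) (i : Fin 2) :
    pd i (fun y => u (c • y)) = fun x => c * pd i u (c • x) := by
  funext x
  have h1 : HasFDerivAt (fun y : Plane => c • y) (c • ContinuousLinearMap.id ℝ Plane) x :=
    (hasFDerivAt_id x).const_smul c
  have h2 := (hu (c • x)).hasFDerivAt.comp x h1
  rw [pd, show (fun y => u (c • y)) = u ∘ fun y => c • y from rfl, h2.fderiv]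
  simp [pd]

theorem lap_add {u v : Plane → ℝ} (hu : ContDiff ℝ ∞ u) (hv : ContDiff ℝ ∞ v) (x : Plane) :
    lap (fun y => u y + v y) x = lap u x + lap v x := by
  have h0 : ∀ i, pd i (fun y => u y + v y) = fun y => pd i u y + pd i v y := fun i =>
    funext fun y => pd_add (hu.differentiable (by simp) y) (hv.differentiable (by simp) y) i
  simp only [lap, h0]
  rw [← Finset.sum_add_distrib]
  exact Finset.sum_congr rfl fun i _ => pd_add ((contDiff_pd hu i).differentiable (by simp) x)
    ((contDiff_pd hv i).differentiable (by simp) x) i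

theorem lap_const_mul {u : Plane → ℝ} (hu : ContDiff ℝ ∞ u) (c : ℝ) (x : Plane) :
    lap (fun y => c * u y) x = c * lap u x := by
  have h0 : ∀ i, pd i (fun y => c * u y) = fun y => c * pd i u y := fun i =>
    funext fun y => pd_const_mul (hu.differentiable (by simp) y) c i
  simp only [lap, h0]
  rw [Finset.mul_sum]
  exact Finset.sum_congr rfl fun i _ =>
    pd_const_mul ((contDiff_pd hu i).differentiable (by simp) x) c i

theorem lap_mul {u v : Plane → ℝ} (hu : ContDiff ℝ ∞ u) (hv : ContDiff ℝ ∞ v) (x : Plane) :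
    lap (fun y => u y * v y) x =
      lap u x * v x + 2 * (∑ i, pd i u x * pd i v x) + u x * lap v x := by
  have hd : ∀ {w : Plane → ℝ}, ContDiff ℝ ∞ w → ∀ y, DifferentiableAt ℝ w y :=
    fun hw y => hw.differentiable (by simp) y
  have h0 : ∀ i, pd i (fun y => u y * v y) = fun y => pd i u y * v y + u y * pd i v y := fun i =>
    funext fun y => pd_mul (hd hu y) (hd hv y) i
  simp only [lap, h0]
  rw [Finset.sum_mul, Finset.mul_sum, Finset.mul_sum, ← Finset.sum_add_distrib,
    ← Finset.sum_add_distrib]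
  refine Finset.sum_congr rfl fun i _ => ?_
  have hui := contDiff_pd hu i
  have hvi := contDiff_pd hv i
  rw [pd_add (hd (hui.mul hv) x) (hd (hu.mul hvi) x), pd_mul (hd hui x) (hd hv x),
    pd_mul (hd hu x) (hd hvi x)]
  ring

theorem lap_comp_smul {u : Plane → ℝ} (hu : ContDiff ℝ ∞ u) (c : ℝ) (x : Plane) :
    lap (fun y => u (c • y)) x = c ^ 2 * lap u (c • x) := by
  have hd : ∀ i, Differentiable ℝ (pd i u) := fun i => (contDiff_pd hu i).differentiable (by simp)
  simp only [lap, pd_comp_smul (hu.differentiable (by simp))]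
  rw [Finset.mul_sum]
  refine Finset.sum_congr rfl fun i _ => ?_
  rw [pd_const_mul (u := fun y => pd i u (c • y)) (((hd i).comp (differentiable_id.const_smul c)) x), pd_comp_smul (hd i)]
  ring

theorem pd_congr {u v : Plane → ℝ} {x : Plane} (h : u =ᶠ[𝓝 x] v) (i : Fin 2) :
    pd i u =ᶠ[𝓝 x] pd i v := by
  filter_upwards [h.fderiv (𝕜 := ℝ)] with y hy
  rw [pd, pd, hy]

theorem lap_congr {u v : Plane → ℝ} {x : Plane} (h : u =ᶠ[𝓝 x] v) : lap u x = lap v x :=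
  Finset.sum_congr rfl fun i _ => (pd_congr (pd_congr h i) i).eq_of_nhds

theorem laplacian_eq_lap {u : Plane → ℝ} (hu : ContDiff ℝ ∞ u) (x : Plane) :
    Laplacian.laplacian u x = lap u x := by
  have h := congrFun (InnerProductSpace.laplacian_eq_iteratedFDeriv_orthonormalBasis u
    (EuclideanSpace.basisFun (Fin 2) ℝ)) x
  rw [h, lap]
  refine Finset.sum_congr rfl fun i _ => ?_
  have h1 : DifferentiableAt ℝ (fderiv ℝ u) x :=
    (hu.fderiv_right (m := ∞) (by simp)).differentiable (by simp) x
  rw [iteratedFDeriv_two_apply, pd]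
  have h2 : pd i u = fun y => fderiv ℝ u y (EuclideanSpace.single i 1) := rfl
  rw [h2, fderiv_clm_apply h1 (differentiableAt_const _)]
  simp

/-! ### Weak gradients -/

theorem IsTestFunction.pd {ψ : Plane → ℝ} (hψ : IsTestFunction ψ) (i : Fin 2) :
    IsTestFunction (pd i ψ) :=
  ⟨contDiff_pd hψ.1 i, hψ.2.fderiv_apply ℝ (EuclideanSpace.single i 1)⟩

theorem IsTestFunction.integrable_mul {ψ : Plane → ℝ} (hψ : IsTestFunction ψ) {u : Plane → ℝ}
    (hu : LocallyIntegrable u volume) : Integrable fun x => u x * ψ x := by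
  have h := hu.integrable_smul_left_of_hasCompactSupport hψ.1.continuous hψ.2
  simpa [mul_comm] using h

theorem HasWeakGradient.locallyIntegrable_apply {u : Plane → ℝ} {G : Plane → Plane}
    (hu : HasWeakGradient u G) (i : Fin 2) : LocallyIntegrable (fun x => G x i) volume := by
  intro x
  obtain ⟨s, hs, hi⟩ := hu.2.1 x
  exact ⟨s, hs, (EuclideanSpace.proj i : Plane →L[ℝ] ℝ).integrable_comp hi⟩

/-- Weak gradients are unique up to null sets. -/
theorem HasWeakGradient.ae_eq {u : Plane → ℝ} {G G' : Plane → Plane}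
    (hu : HasWeakGradient u G) (hu' : HasWeakGradient u G') : G =ᵐ[volume] G' := by
  have h : ∀ i, (fun x => G x i) =ᵐ[volume] fun x => G' x i := by
    intro i
    refine ae_eq_of_integral_contDiff_smul_eq (hu.locallyIntegrable_apply i)
      (hu'.locallyIntegrable_apply i) fun g hg hgc => ?_
    have h1 := hu.2.2 g ⟨hg, hgc⟩ i
    have h2 := hu'.2.2 g ⟨hg, hgc⟩ i
    simp only [smul_eq_mul, mul_comm (g _)]
    linarith
  filter_upwards [h 0, h 1] with x h0 h1
  ext i
  fin_cases i
  · exact h0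
  · exact h1

theorem HasWeakGradient.congr {u v : Plane → ℝ} {G : Plane → Plane}
    (hu : HasWeakGradient u G) (h : u =ᵐ[volume] v) : HasWeakGradient v G := by
  refine ⟨hu.1.congr h, hu.2.1, fun ψ hψ i => ?_⟩
  rw [← hu.2.2 ψ hψ i]
  refine integral_congr_ae ?_
  filter_upwards [h] with x hx
  rw [hx]

theorem weakGradient_ae_eq {u : Plane → ℝ} {G : Plane → Plane} (hu : HasWeakGradient u G) :
    weakGradient u =ᵐ[volume] G := by
  have hex : ∃ G, HasWeakGradient u G := ⟨G, hu⟩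
  have h : weakGradient u = hex.choose := dif_pos hex
  rw [h]
  exact hex.choose_spec.ae_eq hu

theorem inner_gradient_eq (ψ : Plane → ℝ) (v x : Plane) :
    inner ℝ v (gradient ψ x) = ∑ i, v i * pd i ψ x := by
  have hv : v = ∑ i, v i • EuclideanSpace.single i (1 : ℝ) := by
    ext j
    fin_cases j <;> simp [Fin.sum_univ_two]
  rw [real_inner_comm, inner_gradient_left]
  conv_lhs => rw [hv]
  simp [pd]

theorem HasWeakGradient.integral_inner {u : Plane → ℝ} {G : Plane → Plane}
    (hu : HasWeakGradient u G) {ψ : Plane → ℝ} (hψ : IsTestFunction ψ) :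
    ∫ x, inner ℝ (G x) (gradient ψ x) = ∑ i, ∫ x, G x i * pd i ψ x := by
  simp only [inner_gradient_eq]
  exact integral_finsetSum _ fun i _ =>
    (hψ.pd i).integrable_mul (hu.locallyIntegrable_apply i)

theorem HasWeakGradient.integral_lap {u : Plane → ℝ} {G : Plane → Plane}
    (hu : HasWeakGradient u G) {ψ : Plane → ℝ} (hψ : IsTestFunction ψ) :
    ∫ x, inner ℝ (G x) (gradient ψ x) = -∫ x, u x * lap ψ x := by
  rw [hu.integral_inner hψ]
  simp only [lap, Finset.mul_sum]
  rw [integral_finsetSum _ fun i _ => ((hψ.pd i).pd i).integrable_mul hu.1,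
    ← Finset.sum_neg_distrib]
  refine Finset.sum_congr rfl fun i _ => ?_
  have := hu.2.2 _ (hψ.pd i) i
  simp only [pd] at *
  linarith

/-! ### Cut-off functions -/

/-- The decay rate `(1 + |x|²)^(-1/2)`. -/
def decay (x : Plane) : ℝ := (√(weight x))⁻¹

theorem decay_pos (x : Plane) : 0 < decay x := inv_pos.2 (sqrt_weight_pos x)

theorem decay_sq (x : Plane) : decay x ^ 2 = (weight x)⁻¹ := by
  rw [decay, inv_pow, Real.sq_sqrt (weight_pos x).le]

theorem decay_le_one (x : Plane) : decay x ≤ 1 :=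
  inv_le_one_of_one_le₀ (Real.one_le_sqrt.2 (one_le_weight x))

theorem weight_rpow_eq_decay (x : Plane) : weight x ^ (-(3 / 2) : ℝ) = decay x ^ 3 := by
  rw [decay, Real.sqrt_eq_rpow, ← Real.rpow_neg (weight_pos x).le, ← Real.rpow_natCast,
    ← Real.rpow_mul (weight_pos x).le]
  norm_num

@[fun_prop]
theorem continuous_decay : Continuous decay :=
  Continuous.inv₀ (by fun_prop) fun x => (sqrt_weight_pos x).ne'

/-- The profile of the cut-off functions. -/
def cutoffProfile : ContDiffBump (0 : Plane) := ⟨1, 2, one_pos, one_lt_two⟩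

theorem isTestFunction_cutoffProfile : IsTestFunction cutoffProfile :=
  ⟨cutoffProfile.contDiff, cutoffProfile.hasCompactSupport⟩

/-- Smooth functions that are `1` on the ball of radius `n + 1` and `0` off twice that ball. -/
def cutoff (n : ℕ) (x : Plane) : ℝ := cutoffProfile (((n : ℝ) + 1)⁻¹ • x)

theorem isTestFunction_cutoff (n : ℕ) : IsTestFunction (cutoff n) :=
  ⟨cutoffProfile.contDiff.comp (contDiff_const_smul _),
    cutoffProfile.hasCompactSupport.comp_homeomorph
      (Homeomorph.smulOfNeZero ((n : ℝ) + 1)⁻¹ (by positivity))⟩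

theorem abs_cutoff_le (n : ℕ) (x : Plane) : |cutoff n x| ≤ 1 := by
  rw [cutoff, abs_of_nonneg cutoffProfile.nonneg]
  exact cutoffProfile.le_one

theorem cutoff_eventuallyEq {n : ℕ} {x : Plane} (hx : ‖x‖ < n + 1) :
    cutoff n =ᶠ[𝓝 x] fun _ => 1 := by
  have hpos : (0 : ℝ) < n + 1 := by positivity
  have h : ∀ᶠ y in 𝓝 x, ‖y‖ < n + 1 := continuous_norm.continuousAt.eventually_lt_const hx
  filter_upwards [h] with y hy
  refine cutoffProfile.one_of_mem_closedBall ?_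
  rw [mem_closedBall_zero_iff, norm_smul, norm_inv, Real.norm_of_nonneg hpos.le]
  change ((n : ℝ) + 1)⁻¹ * ‖y‖ ≤ 1
  rw [inv_mul_le_iff₀ hpos, mul_one]
  exact hy.le

theorem eventually_cutoff_eventuallyEq (x : Plane) :
    ∀ᶠ n : ℕ in atTop, cutoff n =ᶠ[𝓝 x] fun _ => 1 := by
  obtain ⟨N, hN⟩ := exists_nat_gt ‖x‖
  filter_upwards [eventually_ge_atTop N] with n hn
  refine cutoff_eventuallyEq ?_
  have : (N : ℝ) ≤ n := by exact_mod_cast hn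
  linarith

/-- Functions supported in the profile, rescaled, decay uniformly. -/
theorem exists_decay_bound {g : Plane → ℝ} (hg : Continuous g)
    (hs : tsupport g ⊆ tsupport cutoffProfile) (k : ℕ) :
    ∃ C : ℝ, 0 ≤ C ∧ ∀ (n : ℕ) (x : Plane),
      |(((n : ℝ) + 1)⁻¹) ^ k * g (((n : ℝ) + 1)⁻¹ • x)| ≤ C * decay x ^ k := by
  have hgc : HasCompactSupport g := cutoffProfile.hasCompactSupport.of_isClosed_subset
    (isClosed_tsupport g) hs
  obtain ⟨C, hC⟩ := hgc.exists_bound_of_continuous hg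
  have hC0 : 0 ≤ C := (norm_nonneg _).trans (hC 0)
  refine ⟨C * √5 ^ k, by positivity, fun n x => ?_⟩
  have hpos : (0 : ℝ) < n + 1 := by positivity
  by_cases hx : ((n : ℝ) + 1)⁻¹ • x ∈ tsupport cutoffProfile
  · rw [cutoffProfile.tsupport_eq, mem_closedBall_zero_iff, norm_smul, norm_inv,
      Real.norm_of_nonneg hpos.le] at hx
    have hx' : ‖x‖ ≤ 2 * (n + 1) := by
      have : ((n : ℝ) + 1)⁻¹ * ‖x‖ ≤ 2 := hx
      rw [inv_mul_le_iff₀ hpos] at this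
      linarith
    -- On the support |x| ≤ 2 (n + 1), so w ≤ 1 + 4 (n + 1)² ≤ 5 (n + 1)².
    have hw : √(weight x) ≤ √5 * (n + 1) := by
      refine Real.sqrt_le_left (by positivity) |>.2 ?_
      rw [mul_pow, Real.sq_sqrt (by norm_num), weight]
      have hn : (0 : ℝ) ≤ n := by positivity
      nlinarith [norm_nonneg x]
    have hd : ((n : ℝ) + 1)⁻¹ ≤ √5 * decay x := by
      rw [decay, ← div_eq_mul_inv, le_div_iff₀ (sqrt_weight_pos x), inv_mul_le_iff₀ hpos]
      linarith
    rw [abs_mul, abs_of_nonneg (by positivity)]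
    calc ((n : ℝ) + 1)⁻¹ ^ k * |g (((n : ℝ) + 1)⁻¹ • x)|
        ≤ (√5 * decay x) ^ k * C := by
          have := decay_pos x
          gcongr
          exact hC _
      _ = C * √5 ^ k * decay x ^ k := by ring
  · have h0 : g (((n : ℝ) + 1)⁻¹ • x) = 0 := image_eq_zero_of_notMem_tsupport fun h => hx (hs h)
    rw [h0, mul_zero, abs_zero]
    have := decay_pos x
    positivity

theorem tsupport_pd_subset (i : Fin 2) (u : Plane → ℝ) : tsupport (pd i u) ⊆ tsupport u :=
  tsupport_fderiv_apply_subset ℝ _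

theorem tsupport_lap_subset (u : Plane → ℝ) : tsupport (lap u) ⊆ tsupport u := by
  refine closure_minimal (fun x hx => ?_) (isClosed_tsupport u)
  by_contra h
  refine hx (Finset.sum_eq_zero fun i _ => image_eq_zero_of_notMem_tsupport fun h' => h ?_)
  exact tsupport_pd_subset i u (tsupport_pd_subset i _ h')

theorem pd_cutoff (i : Fin 2) (n : ℕ) (x : Plane) :
    pd i (cutoff n) x = ((n : ℝ) + 1)⁻¹ * pd i cutoffProfile (((n : ℝ) + 1)⁻¹ • x) :=
  congrFun (pd_comp_smul (isTestFunction_cutoffProfile.1.differentiable (by simp)) _ i) x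

theorem lap_cutoff (n : ℕ) (x : Plane) :
    lap (cutoff n) x = (((n : ℝ) + 1)⁻¹) ^ 2 * lap cutoffProfile (((n : ℝ) + 1)⁻¹ • x) :=
  lap_comp_smul isTestFunction_cutoffProfile.1 _ x

/-- The bounds are uniform in n, so products with the cut-offs have an n-independent majorant in
dominated convergence. -/
theorem exists_cutoff_bound : ∃ C : ℝ, 0 ≤ C ∧ ∀ (n : ℕ) (x : Plane),
    (∀ i, |pd i (cutoff n) x| ≤ C * decay x) ∧ |lap (cutoff n) x| ≤ C * decay x ^ 2 := by
  have hc := isTestFunction_cutoffProfile.1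
  have h1 := fun i => exists_decay_bound (contDiff_pd hc i).continuous (tsupport_pd_subset i _) 1
  choose A hA0 hA using h1
  obtain ⟨B, hB0, hB⟩ := exists_decay_bound (contDiff_lap hc).continuous (tsupport_lap_subset _) 2
  refine ⟨A 0 + A 1 + B, by linarith [hA0 0, hA0 1], fun n x => ⟨fun i => ?_, ?_⟩⟩
  · have h2 := hA i n x
    rw [pow_one, pow_one] at h2
    rw [pd_cutoff]
    refine h2.trans (mul_le_mul_of_nonneg_right ?_ (decay_pos x).le)
    fin_cases i
    · simp only [Fin.zero_eta]; linarith [hA0 1]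
    · simp only [Fin.mk_one]; linarith [hA0 0]
  · rw [lap_cutoff]
    refine (hB n x).trans (mul_le_mul_of_nonneg_right ?_ (sq_nonneg _))
    linarith [hA0 0, hA0 1]

/-! ### Consequences of the weak equation -/

/-- The weak equation may be tested with functions that decay at infinity. -/
theorem integral_mul_lap_of_decay {u f : Plane → ℝ}
    (hu : Integrable fun x => decay x ^ 3 * u x) (hf : Integrable f)
    (heq : ∀ ψ, IsTestFunction ψ → -∫ x, u x * lap ψ x = ∫ x, f x * ψ x)
    {η : Plane → ℝ} (hη : ContDiff ℝ ∞ η) {K : ℝ} (h0 : ∀ x, |η x| ≤ K * decay x)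
    (h1 : ∀ i x, |pd i η x| ≤ K * decay x ^ 2) (h2 : ∀ x, |lap η x| ≤ K * decay x ^ 3) :
    -∫ x, u x * lap η x = ∫ x, f x * η x := by
  obtain ⟨C, hC0, hC⟩ := exists_cutoff_bound
  have hum : AEStronglyMeasurable u volume := by
    have h := (continuous_decay.pow 3).aestronglyMeasurable (μ := volume)
    refine (((h.inv₀).mul hu.aestronglyMeasurable)).congr (ae_of_all _ fun x => ?_)
    have := (decay_pos x).ne'
    simp only [Pi.mul_apply, Pi.inv_apply, Pi.pow_apply]
    field_simp
  have hK0 : 0 ≤ K := by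
    have h3 := (abs_nonneg _).trans (h0 0)
    exact nonneg_of_mul_nonneg_left h3 (decay_pos 0)
  have htest : ∀ n, IsTestFunction fun x => cutoff n x * η x := fun n =>
    ⟨(isTestFunction_cutoff n).1.mul hη, (isTestFunction_cutoff n).2.mul_right⟩
  -- The product rule gives one term with the Laplacian of the cut-off and four cross terms, each
  -- bounded by C K decay³, and the last term by K decay³. The factor 6 leaves room.
  have hbound : ∀ n x, |lap (fun x => cutoff n x * η x) x| ≤ (6 * C * K + K) * decay x ^ 3 := by
    intro n x
    have hd := decay_pos x
    rw [lap_mul (isTestFunction_cutoff n).1 hη, Fin.sum_univ_two]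
    have e1 : |lap (cutoff n) x * η x| ≤ (C * decay x ^ 2) * (K * decay x) := by
      rw [abs_mul]
      exact mul_le_mul (hC n x).2 (h0 x) (abs_nonneg _) (by positivity)
    have e2 : ∀ i, |pd i (cutoff n) x * pd i η x| ≤ (C * decay x) * (K * decay x ^ 2) := by
      intro i
      rw [abs_mul]
      exact mul_le_mul ((hC n x).1 i) (h1 i x) (abs_nonneg _) (by positivity)
    have e3 : |cutoff n x * lap η x| ≤ K * decay x ^ 3 := by
      rw [abs_mul]
      exact (mul_le_of_le_one_left (abs_nonneg _) (abs_cutoff_le n x)).trans (h2 x)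
    have e20 := e2 0
    have e21 := e2 1
    have hCK : 0 ≤ C * K * decay x ^ 3 := by positivity
    rw [abs_le] at *
    constructor <;> nlinarith
  have hL : Tendsto (fun n => ∫ x, u x * lap (fun x => cutoff n x * η x) x) atTop
      (𝓝 (∫ x, u x * lap η x)) := by
    refine tendsto_integral_of_dominated_convergence
      (fun x => (6 * C * K + K) * ‖decay x ^ 3 * u x‖) (fun n => ?_) (hu.norm.const_mul _)
      (fun n => ae_of_all _ fun x => ?_) (ae_of_all _ fun x => ?_)
    · exact hum.mul (contDiff_lap (htest n).1).continuous.aestronglyMeasurable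
    · have := mul_le_mul_of_nonneg_right (hbound n x) (abs_nonneg (u x))
      have hd := decay_pos x
      rw [norm_mul, norm_mul, Real.norm_eq_abs, Real.norm_eq_abs, Real.norm_eq_abs,
        abs_of_nonneg (by positivity : 0 ≤ decay x ^ 3)]
      linarith
    · refine tendsto_const_nhds.congr' ?_
      filter_upwards [eventually_cutoff_eventuallyEq x] with n hn
      congr 1
      refine lap_congr ?_
      filter_upwards [hn] with y hy
      rw [hy, one_mul]
  have hR : Tendsto (fun n => ∫ x, f x * (cutoff n x * η x)) atTop (𝓝 (∫ x, f x * η x)) := by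
    refine tendsto_integral_of_dominated_convergence (fun x => K * ‖f x‖) (fun n => ?_)
      (hf.norm.const_mul _) (fun n => ae_of_all _ fun x => ?_) (ae_of_all _ fun x => ?_)
    · exact hf.aestronglyMeasurable.mul (htest n).1.continuous.aestronglyMeasurable
    · rw [norm_mul, mul_comm]
      gcongr
      rw [Real.norm_eq_abs, abs_mul]
      refine (mul_le_of_le_one_left (abs_nonneg _) (abs_cutoff_le n x)).trans ((h0 x).trans ?_)
      exact mul_le_of_le_one_right hK0 (decay_le_one x)
    · refine tendsto_const_nhds.congr' ?_
      filter_upwards [eventually_cutoff_eventuallyEq x] with n hn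
      rw [hn.eq_of_nhds, one_mul]
  refine tendsto_nhds_unique hL.neg ?_
  simpa only [← heq _ (htest _)] using hR

/-- The right-hand side of the weak equation has mean zero. -/
theorem integral_eq_zero_of_weak {u f : Plane → ℝ} {G : Plane → Plane}
    (hu : HasWeakGradient u G) (hG : MemLp G 2 volume) (hf : Integrable f)
    (heq : ∀ ψ, IsTestFunction ψ → ∫ x, inner ℝ (G x) (gradient ψ x) = ∫ x, f x * ψ x) :
    ∫ x, f x = 0 := by
  have hR : Tendsto (fun n => ∫ x, f x * cutoff n x) atTop (𝓝 (∫ x, f x)) := by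
    refine tendsto_integral_of_dominated_convergence (fun x => ‖f x‖) (fun n => ?_)
      hf.norm (fun n => ae_of_all _ fun x => ?_) (ae_of_all _ fun x => ?_)
    · exact hf.aestronglyMeasurable.mul
        (isTestFunction_cutoff n).1.continuous.aestronglyMeasurable
    · rw [norm_mul]
      exact mul_le_of_le_one_right (norm_nonneg _) (abs_cutoff_le n x)
    · refine tendsto_const_nhds.congr' ?_
      filter_upwards [eventually_cutoff_eventuallyEq x] with n hn
      rw [hn.eq_of_nhds, mul_one]
  have hGi : ∀ i, Integrable fun x => (G x i) ^ 2 := by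
    intro i
    have h1 : MemLp (fun x => G x i) 2 volume :=
      (EuclideanSpace.proj i : Plane →L[ℝ] ℝ).comp_memLp' hG
    exact h1.integrable_sq
  have hL : ∀ i, Tendsto (fun n => ∫ x, G x i * pd i (cutoff n) x) atTop (𝓝 0) := by
    intro i
    -- The energy of G on the set where the derivative of the cut-off does not vanish. This set
    -- escapes to infinity, so the energy tends to zero.
    set T : ℕ → ℝ := fun n => ∫ x, (if pd i (cutoff n) x = 0 then 0 else (G x i) ^ 2) with hT
    set K : ℝ := ∫ x, (pd i cutoffProfile x) ^ 2 with hK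
    have hmeas : ∀ n, MeasurableSet {x | pd i (cutoff n) x = 0} := fun n =>
      (contDiff_pd (isTestFunction_cutoff n).1 i).continuous.measurable (measurableSet_singleton 0)
    have hTm : ∀ n, AEStronglyMeasurable
        (fun x => if pd i (cutoff n) x = 0 then 0 else (G x i) ^ 2) volume := by
      intro n
      have h1 := ((hGi i).aestronglyMeasurable).indicator (hmeas n).compl
      refine h1.congr (ae_of_all _ fun x => ?_)
      by_cases hx : pd i (cutoff n) x = 0 <;> simp [hx]
    have hTb : ∀ n x, ‖(if pd i (cutoff n) x = 0 then 0 else (G x i) ^ 2)‖ ≤ (G x i) ^ 2 := by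
      intro n x
      split_ifs
      · simp [sq_nonneg]
      · rw [Real.norm_of_nonneg (sq_nonneg _)]
    have hTlim : Tendsto T atTop (𝓝 0) := by
      have h1 : Tendsto T atTop (𝓝 (∫ _ : Plane, (0 : ℝ))) := by
        refine tendsto_integral_of_dominated_convergence (fun x => (G x i) ^ 2) hTm (hGi i)
          (fun n => ae_of_all _ (hTb n)) (ae_of_all _ fun x => ?_)
        refine tendsto_const_nhds.congr' ?_
        filter_upwards [eventually_cutoff_eventuallyEq x] with n hn
        have h2 : pd i (cutoff n) x = 0 := by
          rw [(pd_congr hn i).eq_of_nhds, pd_const]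
        rw [if_pos h2]
      simpa using h1
    -- The Dirichlet energy is scale invariant in dimension two, so the cut-offs all have the same
    -- energy.
    have hKn : ∀ n, ∫ x, (pd i (cutoff n) x) ^ 2 = K := by
      intro n
      have hpos : (0 : ℝ) < n + 1 := by positivity
      simp only [pd_cutoff, mul_pow]
      rw [integral_const_mul, Measure.integral_comp_smul volume
        (fun x => (pd i cutoffProfile x) ^ 2) (((n : ℝ) + 1)⁻¹), finrank_euclideanSpace_fin]
      rw [smul_eq_mul, abs_of_pos (by positivity), ← mul_assoc,
        mul_inv_cancel₀ (by positivity), one_mul]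
    have hKi : ∀ n, Integrable fun x => (pd i (cutoff n) x) ^ 2 := fun n => by
      have h1 := (isTestFunction_cutoff n).pd i
      have h2 := h1.integrable_mul (h1.1.continuous.locallyIntegrable (μ := volume))
      simpa only [sq] using h2
    -- Cauchy–Schwarz in the form 2ab ≤ a² / t + t b², with t chosen small at the end.
    have hamgm : ∀ t : ℝ, 0 < t → ∀ n, |∫ x, G x i * pd i (cutoff n) x| ≤ t⁻¹ * T n + t * K := by
      intro t ht n
      have hTi : Integrable (fun x => if pd i (cutoff n) x = 0 then 0 else (G x i) ^ 2) :=
        (hGi i).mono' (hTm n) (ae_of_all _ (hTb n))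
      rw [hT, ← hKn n, ← integral_const_mul, ← integral_const_mul,
        ← integral_add (hTi.const_mul _) ((hKi n).const_mul _)]
      refine (norm_integral_le_integral_norm (fun x => G x i * pd i (cutoff n) x)).trans
        (integral_mono_of_nonneg (ae_of_all _ fun x => norm_nonneg (G x i * pd i (cutoff n) x))
        ((hTi.const_mul _).add ((hKi n).const_mul _)) (ae_of_all _ fun x => ?_))
      simp only [Real.norm_eq_abs, abs_mul]
      split_ifs with hx
      · simp [hx]
      · have h1 : 0 ≤ t⁻¹ * (|G x i| - t * |pd i (cutoff n) x|) ^ 2 := by positivity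
        have h2 : t⁻¹ * (|G x i| - t * |pd i (cutoff n) x|) ^ 2 = t⁻¹ * |G x i| ^ 2 -
            2 * (|G x i| * |pd i (cutoff n) x|) + t * |pd i (cutoff n) x| ^ 2 := by
          field_simp
          ring
        rw [← sq_abs (G x i), ← sq_abs (pd i (cutoff n) x)]
        have h3 : 0 ≤ |G x i| * |pd i (cutoff n) x| := by positivity
        linarith
    rw [Metric.tendsto_atTop]
    intro ε hε
    have hK0 : 0 ≤ K := integral_nonneg fun x => sq_nonneg _
    have ht : 0 < ε / (2 * (K + 1)) := by positivity
    have h1 : Tendsto (fun n => (ε / (2 * (K + 1)))⁻¹ * T n) atTop (𝓝 0) := by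
      simpa using hTlim.const_mul (ε / (2 * (K + 1)))⁻¹
    obtain ⟨N, hN⟩ := eventually_atTop.1 (h1.eventually_lt_const (half_pos hε))
    refine ⟨N, fun n hn => ?_⟩
    rw [Real.dist_eq, sub_zero]
    refine (hamgm _ ht n).trans_lt ?_
    have h2 : ε / (2 * (K + 1)) * K ≤ ε / 2 := by
      rw [div_mul_eq_mul_div, div_le_div_iff₀ (by positivity) two_pos]
      nlinarith
    have := hN n hn
    linarith
  refine tendsto_nhds_unique hR ?_
  have h3 : ∀ n, ∫ x, f x * cutoff n x = ∑ i, ∫ x, G x i * pd i (cutoff n) x := fun n => by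
    rw [← heq _ (isTestFunction_cutoff n), hu.integral_inner (isTestFunction_cutoff n)]
  simp only [h3]
  simpa using tendsto_finsetSum Finset.univ fun i _ => hL i

/-! ### Regularized logarithmic kernels -/

/-- The regularized squared distance `|x - z|² + ε²`. -/
def regSq (ε : ℝ) (z x : Plane) : ℝ := ‖x - z‖ ^ 2 + ε ^ 2

/-- The Laplacian of the logarithm of the regularized squared distance. -/
def regKernel (ε : ℝ) (z x : Plane) : ℝ := 4 * ε ^ 2 / regSq ε z x ^ 2

theorem regSq_pos {ε : ℝ} (hε : 0 < ε) (z x : Plane) : 0 < regSq ε z x := by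
  unfold regSq
  positivity

theorem contDiff_regSq (ε : ℝ) (z : Plane) : ContDiff ℝ ∞ (regSq ε z) := by
  unfold regSq
  exact ((contDiff_id.sub contDiff_const).norm_sq ℝ).add contDiff_const

theorem pd_regSq (ε : ℝ) (z : Plane) (i : Fin 2) (x : Plane) :
    pd i (regSq ε z) x = 2 * (x i - z i) := by
  have h := (((hasFDerivAt_id (𝕜 := ℝ) x).sub_const z).norm_sq).add_const (ε ^ 2)
  have h' : HasFDerivAt (regSq ε z) _ x := h
  rw [pd, h'.fderiv]
  simp [EuclideanSpace.inner_single_right]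

theorem contDiff_log_regSq {ε : ℝ} (hε : 0 < ε) (z : Plane) :
    ContDiff ℝ ∞ fun x => Real.log (regSq ε z x) :=
  (contDiff_regSq ε z).log fun x => (regSq_pos hε z x).ne'

theorem pd_log_regSq {ε : ℝ} (hε : 0 < ε) (z : Plane) (i : Fin 2) :
    pd i (fun x => Real.log (regSq ε z x)) = fun x => 2 * (x i - z i) / regSq ε z x := by
  funext x
  rw [pd_comp ((contDiff_regSq ε z).differentiable (by simp) x)
    (Real.hasDerivAt_log (regSq_pos hε z x).ne'), pd_regSq]
  ring

theorem lap_log_regSq {ε : ℝ} (hε : 0 < ε) (z x : Plane) :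
    lap (fun x => Real.log (regSq ε z x)) x = regKernel ε z x := by
  have h0 := (regSq_pos hε z x).ne'
  have h1 : ∀ i : Fin 2, pd i (fun x : Plane => 2 * (x i - z i)) x = 2 := by
    intro i
    have hd : DifferentiableAt ℝ (fun x : Plane => x i) x := by fun_prop
    rw [pd_const_mul (u := fun x : Plane => x i - z i) (hd.sub_const _)]
    simp only [sub_eq_add_neg]
    rw [pd_add hd (differentiableAt_const _), pd_coord, pd_const]
    simp
  have h2 : ∀ i, pd i (fun x => 2 * (x i - z i) / regSq ε z x) x =
      (2 * regSq ε z x - 2 * (x i - z i) * (2 * (x i - z i))) / regSq ε z x ^ 2 := by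
    intro i
    rw [pd_div (u := fun x : Plane => 2 * (x i - z i)) (by fun_prop)
      ((contDiff_regSq ε z).differentiable (by simp) x) h0, h1, pd_regSq]
  simp only [lap, pd_log_regSq hε, h2, Fin.sum_univ_two]
  rw [regKernel, ← add_div]
  congr 1
  simp only [regSq, norm_sq_eq_coord, PiLp.sub_apply]
  ring

theorem weight_mul_decay_sq (x : Plane) : weight x * decay x ^ 2 = 1 := by
  rw [decay_sq, mul_inv_cancel₀ (weight_ne_zero x)]

theorem norm_mul_decay_le (x : Plane) : ‖x‖ * decay x ≤ 1 := by
  have h1 := decay_pos x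
  have h2 := weight_mul_decay_sq x
  rw [← sq_le_one_iff₀ (by positivity), mul_pow, ← h2]
  gcongr
  rw [weight]
  linarith

theorem weight_le_mul_regSq {ε : ℝ} (hε : 0 < ε) (hε1 : ε ≤ 1) (z x : Plane) :
    weight x ≤ 2 * (ε ^ 2)⁻¹ * weight z * regSq ε z x := by
  have h1 : ‖x‖ ≤ ‖x - z‖ + ‖z‖ := by simpa using norm_add_le (x - z) z
  have h2 : weight x ≤ 2 * weight z * (1 + ‖x - z‖ ^ 2) := by
    simp only [weight]
    have := norm_nonneg x
    nlinarith [sq_nonneg (‖x - z‖ - ‖z‖), sq_nonneg (‖x - z‖ * ‖z‖)]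
  have h3 : 1 + ‖x - z‖ ^ 2 ≤ (ε ^ 2)⁻¹ * regSq ε z x := by
    rw [regSq, mul_add, inv_mul_cancel₀ (by positivity)]
    have : 1 ≤ (ε ^ 2)⁻¹ := (one_le_inv₀ (by positivity)).2 (pow_le_one₀ hε.le hε1)
    nlinarith [sq_nonneg ‖x - z‖]
  calc weight x ≤ 2 * weight z * (1 + ‖x - z‖ ^ 2) := h2
    _ ≤ 2 * weight z * ((ε ^ 2)⁻¹ * regSq ε z x) := by
        have := weight_pos z
        gcongr
    _ = _ := by ring

theorem regSq_le_mul_weight {ε : ℝ} (hε : 0 < ε) (hε1 : ε ≤ 1) (z x : Plane) :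
    regSq ε z x ≤ 2 * weight z * weight x := by
  have h1 : ‖x - z‖ ≤ ‖x‖ + ‖z‖ := norm_sub_le x z
  have h2 : ε ^ 2 ≤ 1 := pow_le_one₀ hε.le hε1
  simp only [regSq, weight]
  have := norm_nonneg (x - z)
  nlinarith [sq_nonneg (‖x‖ - ‖z‖), sq_nonneg (‖x‖ * ‖z‖)]

theorem inv_regSq_le {ε : ℝ} (hε : 0 < ε) (hε1 : ε ≤ 1) (z x : Plane) :
    (regSq ε z x)⁻¹ ≤ 2 * (ε ^ 2)⁻¹ * weight z * decay x ^ 2 := by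
  rw [decay_sq, ← div_eq_mul_inv, inv_le_iff_one_le_mul₀ (regSq_pos hε z x), div_mul_eq_mul_div,
    one_le_div (weight_pos x)]
  exact weight_le_mul_regSq hε hε1 z x

theorem regKernel_nonneg (ε : ℝ) (z x : Plane) : 0 ≤ regKernel ε z x := by
  unfold regKernel
  positivity

theorem regKernel_le {ε : ℝ} (hε : 0 < ε) (hε1 : ε ≤ 1) (z x : Plane) :
    regKernel ε z x ≤ 16 * (ε ^ 2)⁻¹ * weight z ^ 2 * decay x ^ 4 := by
  have h1 := inv_regSq_le hε hε1 z x
  have h2 := regSq_pos hε z x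
  have h3 : regKernel ε z x = 4 * ε ^ 2 * ((regSq ε z x)⁻¹) ^ 2 := by
    rw [regKernel, inv_pow, div_eq_mul_inv]
  rw [h3]
  calc 4 * ε ^ 2 * ((regSq ε z x)⁻¹) ^ 2
      ≤ 4 * ε ^ 2 * (2 * (ε ^ 2)⁻¹ * weight z * decay x ^ 2) ^ 2 := by gcongr
    _ = 16 * (ε ^ 2)⁻¹ * weight z ^ 2 * decay x ^ 4 := by
        field_simp
        ring

theorem decay_pow_le {m k : ℕ} (h : m ≤ k) (x : Plane) : decay x ^ k ≤ decay x ^ m :=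
  pow_le_pow_of_le_one (decay_pos x).le (decay_le_one x) h

/-- The quadratic terms cancel, so the difference grows only linearly in |x|. This is where the
difference of two logarithms gains its decay. -/
theorem abs_regSq_sub_le (ε : ℝ) (z x : Plane) :
    |regSq ε z x - regSq ε 0 x| * decay x ≤ ‖z‖ * (2 + ‖z‖) := by
  have h1 : |‖x - z‖ - ‖x‖| ≤ ‖z‖ := by
    have := abs_norm_sub_norm_le (x - z) x
    simpa using this
  have h2 : ‖x - z‖ ≤ ‖x‖ + ‖z‖ := norm_sub_le x z
  have h3 := norm_mul_decay_le x
  have h4 := decay_le_one x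
  have h5 := decay_pos x
  have h6 : regSq ε z x - regSq ε 0 x = (‖x - z‖ - ‖x‖) * (‖x - z‖ + ‖x‖) := by
    simp only [regSq, sub_zero]
    ring
  rw [h6, abs_mul, abs_of_nonneg (by positivity : 0 ≤ ‖x - z‖ + ‖x‖), mul_assoc]
  have h7 : (‖x - z‖ + ‖x‖) * decay x ≤ 2 + ‖z‖ := by
    nlinarith [norm_nonneg z, norm_nonneg x]
  exact mul_le_mul h1 h7 (by positivity) (norm_nonneg _)

/-- The difference of two regularized logarithmic kernels decays at infinity. -/
theorem exists_log_sub_bound {ε : ℝ} (hε : 0 < ε) (hε1 : ε ≤ 1) (z : Plane) :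
    ∃ K : ℝ,
      (∀ x, |Real.log (regSq ε z x) + -1 * Real.log (regSq ε 0 x)| ≤ K * decay x) ∧
      (∀ i x, |pd i (fun x => Real.log (regSq ε z x) + -1 * Real.log (regSq ε 0 x)) x| ≤
        K * decay x ^ 2) ∧
      ∀ x, |lap (fun x => Real.log (regSq ε z x) + -1 * Real.log (regSq ε 0 x)) x| ≤
        K * decay x ^ 3 := by
  set M : ℝ := 2 * (ε ^ 2)⁻¹ * weight z with hM
  have hMpos : 0 < M := by have := weight_pos z; positivity
  set D : ℝ := ‖z‖ * (2 + ‖z‖) with hD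
  have hDpos : 0 ≤ D := by positivity
  have hAz : ∀ x, (regSq ε z x)⁻¹ ≤ M * decay x ^ 2 := fun x => inv_regSq_le hε hε1 z x
  have hA0 : ∀ x, (regSq ε 0 x)⁻¹ ≤ M * decay x ^ 2 := fun x => by
    refine (inv_regSq_le hε hε1 0 x).trans ?_
    have h1 : weight 0 ≤ weight z := by simp [weight]
    have h2 := decay_pos x
    rw [hM]
    gcongr
  have hdiff : ∀ x, |regSq ε z x - regSq ε 0 x| * decay x ≤ D := fun x => abs_regSq_sub_le ε z x
  have hcz := contDiff_log_regSq hε z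
  have hc0 := contDiff_log_regSq hε 0
  have hd : ∀ {w : Plane → ℝ}, ContDiff ℝ ∞ w → ∀ y, DifferentiableAt ℝ w y :=
    fun hw y => hw.differentiable (by simp) y
  set S : ℝ := 16 * (ε ^ 2)⁻¹ * weight z ^ 2 with hS
  have hSpos : 0 ≤ S := by positivity
  have hK : 0 ≤ M * D ∧ 0 ≤ 2 * ‖z‖ * M + 2 * M ^ 2 * D ∧ 0 ≤ 2 * S := by
    refine ⟨by positivity, by positivity, by positivity⟩
  refine ⟨M * D + (2 * ‖z‖ * M + 2 * M ^ 2 * D) + 2 * S, fun x => ?_, fun i x => ?_, fun x => ?_⟩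
  · have hdx := decay_pos x
    have hz := regSq_pos hε z x
    have h0 := regSq_pos hε 0 x
    -- From log (a / b) ≤ a / b - 1 = (a - b) / b; applied with a and b in both orders it bounds the
    -- absolute value.
    have key : ∀ a b : ℝ, 0 < a → 0 < b → b⁻¹ ≤ M * decay x ^ 2 → |a - b| * decay x ≤ D →
        Real.log a - Real.log b ≤ M * D * decay x := by
      intro a b ha hb hb' hab
      rw [← Real.log_div ha.ne' hb.ne']
      refine (Real.log_le_sub_one_of_pos (div_pos ha hb)).trans ?_
      have h1 : a / b - 1 = (a - b) * b⁻¹ := by field_simp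
      rw [h1]
      calc (a - b) * b⁻¹ ≤ |a - b| * b⁻¹ := by gcongr; exact le_abs_self _
        _ ≤ |a - b| * (M * decay x ^ 2) := by gcongr
        _ = M * (|a - b| * decay x) * decay x := by ring
        _ ≤ M * D * decay x := by gcongr
    have h1 := key _ _ hz h0 (hA0 x) (hdiff x)
    have h2 := key _ _ h0 hz (hAz x) (by rw [abs_sub_comm]; exact hdiff x)
    have h3 : M * D * decay x ≤
        (M * D + (2 * ‖z‖ * M + 2 * M ^ 2 * D) + 2 * S) * decay x := by
      gcongr
      linarith [hK.2.1, hK.2.2]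
    rw [abs_le]
    constructor <;> linarith
  · have hdx := decay_pos x
    have hz := regSq_pos hε z x
    have h0 := regSq_pos hε 0 x
    rw [pd_add (hd hcz x) (hd (contDiff_const.mul hc0) x), pd_const_mul (hd hc0 x),
      pd_log_regSq hε, pd_log_regSq hε]
    -- Each gradient alone decays only to first order. In this form the first term has one full
    -- reciprocal, and the second has two reciprocals against quantities of linear growth, so both
    -- are of second order.
    have h1 : 2 * (x i - z i) / regSq ε z x + -1 * (2 * (x i - (0 : Plane) i) / regSq ε 0 x) =
        -2 * z i * (regSq ε z x)⁻¹ +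
          2 * x i * (regSq ε 0 x - regSq ε z x) * ((regSq ε z x)⁻¹ * (regSq ε 0 x)⁻¹) := by
      simp only [PiLp.zero_apply]
      field_simp
      ring
    simp only [h1]
    have hzi : |z i| ≤ ‖z‖ := PiLp.norm_apply_le z i
    have hxi : |x i| * decay x ≤ 1 :=
      (mul_le_mul_of_nonneg_right (PiLp.norm_apply_le x i) hdx.le).trans (norm_mul_decay_le x)
    have e1 : |-2 * z i * (regSq ε z x)⁻¹| ≤ 2 * ‖z‖ * M * decay x ^ 2 := by
      rw [abs_mul, abs_mul, abs_of_pos (inv_pos.2 hz)]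
      norm_num
      calc 2 * |z i| * (regSq ε z x)⁻¹ ≤ 2 * ‖z‖ * (M * decay x ^ 2) := by
            gcongr
            exact hAz x
        _ = _ := by ring
    have e2 : |2 * x i * (regSq ε 0 x - regSq ε z x) * ((regSq ε z x)⁻¹ * (regSq ε 0 x)⁻¹)| ≤
        2 * M ^ 2 * D * decay x ^ 2 := by
      rw [abs_mul, abs_mul, abs_mul, abs_of_pos (mul_pos (inv_pos.2 hz) (inv_pos.2 h0)),
        abs_sub_comm (regSq ε 0 x)]
      norm_num
      calc 2 * |x i| * |regSq ε z x - regSq ε 0 x| * ((regSq ε z x)⁻¹ * (regSq ε 0 x)⁻¹)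
          ≤ 2 * |x i| * |regSq ε z x - regSq ε 0 x| * ((M * decay x ^ 2) * (M * decay x ^ 2)) := by
            gcongr
            · exact hAz x
            · exact hA0 x
        _ = 2 * M ^ 2 * (|x i| * decay x) * (|regSq ε z x - regSq ε 0 x| * decay x) *
              decay x ^ 2 := by ring
        _ ≤ 2 * M ^ 2 * 1 * D * decay x ^ 2 := by
            gcongr
            exact hdiff x
        _ = _ := by ring
    refine (abs_add_le _ _).trans ?_
    have h3 : (2 * ‖z‖ * M + 2 * M ^ 2 * D) * decay x ^ 2 ≤
        (M * D + (2 * ‖z‖ * M + 2 * M ^ 2 * D) + 2 * S) * decay x ^ 2 := by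
      refine mul_le_mul_of_nonneg_right ?_ (by positivity)
      linarith [hK.1, hK.2.2]
    linarith
  · have hdx := decay_pos x
    rw [lap_add hcz (contDiff_const.mul hc0), lap_const_mul hc0, lap_log_regSq hε,
      lap_log_regSq hε]
    have e1 : regKernel ε z x ≤ S * decay x ^ 4 := regKernel_le hε hε1 z x
    have e2 : regKernel ε 0 x ≤ S * decay x ^ 4 := by
      refine (regKernel_le hε hε1 0 x).trans ?_
      rw [hS]
      have h1 : weight 0 ≤ weight z := by simp [weight]
      have h2 := weight_pos 0
      gcongr
    have e3 : S * decay x ^ 4 ≤ S * decay x ^ 3 := by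
      gcongr 1
      exact decay_pow_le (by norm_num) x
    have n1 := regKernel_nonneg ε z x
    have n2 := regKernel_nonneg ε 0 x
    have h3 : 2 * S * decay x ^ 3 ≤
        (M * D + (2 * ‖z‖ * M + 2 * M ^ 2 * D) + 2 * S) * decay x ^ 3 := by
      gcongr
      linarith [hK.1, hK.2.1]
    have h4 : 0 ≤ S * decay x ^ 3 := by positivity
    rw [abs_le]
    constructor <;> linarith

/-! ### The regularized kernels as an approximate identity -/

theorem sphereMeasure_real_univ : sphereMeasure.real univ = Real.pi := by
  have h := integral_comp_chord_zero fun _ => 1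
  simpa using h

theorem integral_inv_weight_sq : ∫ x : Plane, (weight x ^ 2)⁻¹ = Real.pi := by
  have h := integral_sphereMeasure fun _ => 1
  simp only [mul_one, integral_const, smul_eq_mul] at h
  rw [← h, sphereMeasure_real_univ]

/-- The regularized kernel applied to a test function. -/
def regConv (ε : ℝ) (γ : Plane → ℝ) (x : Plane) : ℝ := ∫ z, regKernel ε z x * γ z

/-- The substitution z = x + ε y turns the kernel into the fixed profile 4 / w², of total mass 4π.
-/
theorem regConv_eq {ε : ℝ} (hε : 0 < ε) (γ : Plane → ℝ) (x : Plane) :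
    regConv ε γ x = ∫ y, 4 * (weight y ^ 2)⁻¹ * γ (x + ε • y) := by
  have h1 := integral_add_left_eq_self (μ := volume) (fun z => regKernel ε z x * γ z) x
  have h2 := Measure.integral_comp_smul volume (fun z => regKernel ε (x + z) x * γ (x + z)) ε
  rw [finrank_euclideanSpace_fin, abs_of_pos (by positivity), smul_eq_mul] at h2
  have h3 : ∫ z, regKernel ε (x + z) x * γ (x + z) =
      ε ^ 2 * ∫ y, regKernel ε (x + ε • y) x * γ (x + ε • y) := by
    rw [h2, ← mul_assoc, mul_inv_cancel₀ (by positivity), one_mul]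
  rw [regConv, ← h1, h3, ← integral_const_mul]
  congr 1
  ext y
  have h4 : regSq ε (x + ε • y) x = ε ^ 2 * weight y := by
    rw [regSq, weight, sub_add_cancel_left, norm_neg, norm_smul, mul_pow, Real.norm_eq_abs, sq_abs]
    ring
  have hw := weight_ne_zero y
  rw [regKernel, h4]
  field_simp

theorem continuous_regKernel {ε : ℝ} (hε : 0 < ε) :
    Continuous fun p : Plane × Plane => regKernel ε p.1 p.2 := by
  have h : Continuous fun p : Plane × Plane => regSq ε p.1 p.2 := by
    unfold regSq
    fun_prop
  exact continuous_const.div (h.pow 2) fun p => pow_ne_zero 2 (regSq_pos hε p.1 p.2).ne'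

theorem tendsto_regConv {ε : ℕ → ℝ} (hε : ∀ n, 0 < ε n) (hlim : Tendsto ε atTop (𝓝 0))
    {γ : Plane → ℝ} (hγ : IsTestFunction γ) (x : Plane) :
    Tendsto (fun n => regConv (ε n) γ x) atTop (𝓝 (4 * Real.pi * γ x)) := by
  obtain ⟨C, hC⟩ := hγ.2.exists_bound_of_continuous hγ.1.continuous
  have h0 : 4 * Real.pi * γ x = ∫ y, 4 * (weight y ^ 2)⁻¹ * γ x := by
    rw [integral_mul_const, integral_const_mul, integral_inv_weight_sq]
  simp only [regConv_eq (hε _)]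
  rw [h0]
  have hwc : Continuous fun y : Plane => 4 * (weight y ^ 2)⁻¹ :=
    continuous_const.mul ((continuous_weight.pow 2).inv₀ fun y => pow_ne_zero 2 (weight_ne_zero y))
  refine tendsto_integral_of_dominated_convergence (fun y => 4 * (weight y ^ 2)⁻¹ * C)
    (fun n => ?_) ((integrable_inv_weight_sq.const_mul 4).mul_const C)
    (fun n => ae_of_all _ fun y => ?_) (ae_of_all _ fun y => ?_)
  · exact (hwc.mul (hγ.1.continuous.comp (by fun_prop))).aestronglyMeasurable
  · rw [norm_mul, Real.norm_of_nonneg (by positivity)]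
    gcongr
    exact hC _
  · refine Tendsto.const_mul _ ((hγ.1.continuous.tendsto x).comp ?_)
    have h1 : Tendsto (fun n => x + ε n • y) atTop (𝓝 (x + (0 : ℝ) • y)) :=
      tendsto_const_nhds.add (hlim.smul_const y)
    simpa using h1

/-- The decay must be uniform in ε, in order to dominate the pairing with a function u for which
only decay³ u is integrable. -/
theorem exists_regConv_bound {γ : Plane → ℝ} (hγ : IsTestFunction γ) :
    ∃ K : ℝ, ∀ ε : ℝ, 0 < ε → ε ≤ 1 → ∀ x, |regConv ε γ x| ≤ K * decay x ^ 3 := by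
  obtain ⟨C, hC⟩ := hγ.2.exists_bound_of_continuous hγ.1.continuous
  have hC0 : 0 ≤ C := (norm_nonneg _).trans (hC 0)
  obtain ⟨r, hr⟩ : ∃ r : ℝ, ∀ z, r ≤ ‖z‖ → γ z = 0 := by
    obtain ⟨r, hr⟩ := hγ.2.isCompact.isBounded.subset_ball (0 : Plane)
    exact ⟨r, fun z hz => image_eq_zero_of_notMem_tsupport fun h =>
      absurd (mem_ball_zero_iff.1 (hr h)) (not_lt.2 hz)⟩
  set s : ℝ := max r 1 with hs
  have hs1 : 1 ≤ s := le_max_right _ _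
  have hγi : Integrable γ := hγ.1.continuous.integrable_of_hasCompactSupport hγ.2
  set I : ℝ := ∫ z, ‖γ z‖ with hI
  have hI0 : 0 ≤ I := integral_nonneg fun z => norm_nonneg _
  set W : ℝ := 1 + (2 * s) ^ 2 with hW
  have hW1 : 1 ≤ W := by rw [hW]; nlinarith
  refine ⟨4 * Real.pi * C * W ^ 2 + 256 * I, fun ε hε hε1 x => ?_⟩
  have hd := decay_pos x
  have hd43 : decay x ^ 4 ≤ decay x ^ 3 := decay_pow_le (by norm_num) x
  -- Near the support the total mass of the kernel bounds the integral; away from it the kernel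
  -- itself is of order decay⁴.
  rcases le_total ‖x‖ (2 * s) with hx | hx
  · have h1 : |regConv ε γ x| ≤ 4 * Real.pi * C := by
      rw [regConv_eq hε]
      have h2 : ∫ y : Plane, 4 * (weight y ^ 2)⁻¹ * C = 4 * Real.pi * C := by
        rw [integral_mul_const, integral_const_mul, integral_inv_weight_sq]
      rw [← h2, ← Real.norm_eq_abs]
      refine norm_integral_le_of_norm_le ((integrable_inv_weight_sq.const_mul 4).mul_const C)
        (ae_of_all _ fun y => ?_)
      rw [norm_mul, Real.norm_of_nonneg (by positivity)]
      gcongr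
      exact hC _
    have h3 : 1 ≤ W ^ 2 * decay x ^ 3 := by
      have h4 : weight x ≤ W := by
        rw [weight, hW]
        gcongr
      have h5 := weight_mul_decay_sq x
      have h6 : 1 ≤ W * decay x ^ 2 := by
        rw [← h5]
        gcongr
      calc (1 : ℝ) ≤ (W * decay x ^ 2) ^ 2 := one_le_pow₀ h6
        _ = W ^ 2 * decay x ^ 4 := by ring
        _ ≤ W ^ 2 * decay x ^ 3 := by gcongr
    calc |regConv ε γ x| ≤ 4 * Real.pi * C * 1 := by rw [mul_one]; exact h1
      _ ≤ 4 * Real.pi * C * (W ^ 2 * decay x ^ 3) := by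
          have := Real.pi_pos
          gcongr
      _ ≤ (4 * Real.pi * C * W ^ 2 + 256 * I) * decay x ^ 3 := by
          have : 0 ≤ 256 * I * decay x ^ 3 := by positivity
          linarith
  · have hxpos : 0 < ‖x‖ := by linarith
    have h1 : |regConv ε γ x| ≤ ∫ z, 256 * decay x ^ 4 * ‖γ z‖ := by
      rw [regConv, ← Real.norm_eq_abs]
      refine norm_integral_le_of_norm_le (hγi.norm.const_mul _) (ae_of_all _ fun z => ?_)
      by_cases hz : s ≤ ‖z‖
      · have : γ z = 0 := hr z ((le_max_left _ _).trans hz)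
        simp [this]
      · rw [norm_mul]
        gcongr
        rw [Real.norm_of_nonneg (regKernel_nonneg _ _ _)]
        have h2 : ‖x‖ / 2 ≤ ‖x - z‖ := by
          have := norm_sub_norm_le x z
          linarith [not_le.1 hz]
        -- Here |x - z|² ≥ |x|² / 4 and |x| ≥ 1. The resulting constant is 4 · 8² = 256.
        have h3 : weight x / 8 ≤ regSq ε z x := by
          rw [weight, regSq]
          nlinarith [sq_nonneg ε]
        have h4 : (regSq ε z x)⁻¹ ≤ 8 * decay x ^ 2 := by
          rw [decay_sq, ← div_eq_mul_inv, inv_le_comm₀ (regSq_pos hε z x)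
            (div_pos (by norm_num) (weight_pos x)), inv_div]
          exact h3
        have h5 : regKernel ε z x = 4 * ε ^ 2 * ((regSq ε z x)⁻¹) ^ 2 := by
          rw [regKernel, inv_pow, div_eq_mul_inv]
        have h6 := inv_pos.2 (regSq_pos hε z x)
        rw [h5]
        calc 4 * ε ^ 2 * ((regSq ε z x)⁻¹) ^ 2 ≤ 4 * 1 ^ 2 * (8 * decay x ^ 2) ^ 2 := by gcongr
          _ = 256 * decay x ^ 4 := by ring
    rw [integral_const_mul] at h1
    calc |regConv ε γ x| ≤ 256 * decay x ^ 4 * I := h1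
      _ ≤ 256 * decay x ^ 3 * I := by gcongr
      _ ≤ (4 * Real.pi * C * W ^ 2 + 256 * I) * decay x ^ 3 := by
          have : 0 ≤ 4 * Real.pi * C * W ^ 2 * decay x ^ 3 := by
            have := Real.pi_pos
            positivity
          linarith

theorem aestronglyMeasurable_of_decay {u : Plane → ℝ} {k : ℕ}
    (hu : Integrable fun x => decay x ^ k * u x) : AEStronglyMeasurable u volume := by
  have h := (continuous_decay.pow k).aestronglyMeasurable (μ := volume)
  refine (((h.inv₀).mul hu.aestronglyMeasurable)).congr (ae_of_all _ fun x => ?_)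
  have := (decay_pos x).ne'
  simp only [Pi.mul_apply, Pi.inv_apply, Pi.pow_apply]
  field_simp

theorem integrable_mul_of_decay {u g : Plane → ℝ} {k : ℕ}
    (hu : Integrable fun x => decay x ^ k * u x) (hg : AEStronglyMeasurable g volume) {K : ℝ}
    (hb : ∀ x, |g x| ≤ K * decay x ^ k) : Integrable fun x => u x * g x := by
  refine (hu.norm.const_mul K).mono' ((aestronglyMeasurable_of_decay hu).mul hg)
    (ae_of_all _ fun x => ?_)
  have h := mul_le_mul_of_nonneg_right (hb x) (abs_nonneg (u x))
  have hd := decay_pos x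
  rw [norm_mul, norm_mul, Real.norm_eq_abs, Real.norm_eq_abs, Real.norm_eq_abs,
    abs_of_nonneg (by positivity : 0 ≤ decay x ^ k)]
  linarith

theorem aestronglyMeasurable_regConv {ε : ℝ} (hε : 0 < ε) {γ : Plane → ℝ}
    (hγ : IsTestFunction γ) : AEStronglyMeasurable (regConv ε γ) volume := by
  have h : Continuous fun p : Plane × Plane => regKernel ε p.2 p.1 * γ p.2 :=
    ((continuous_regKernel hε).comp continuous_swap).mul (hγ.1.continuous.comp continuous_snd)
  exact (h.stronglyMeasurable.integral_prod_right).aestronglyMeasurable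

theorem tendsto_integral_regConv {ε : ℕ → ℝ} (hε : ∀ n, 0 < ε n) (hε1 : ∀ n, ε n ≤ 1)
    (hlim : Tendsto ε atTop (𝓝 0)) {γ : Plane → ℝ} (hγ : IsTestFunction γ) {u : Plane → ℝ}
    (hu : Integrable fun x => decay x ^ 3 * u x) :
    Tendsto (fun n => ∫ x, u x * regConv (ε n) γ x) atTop
      (𝓝 (∫ x, u x * (4 * Real.pi * γ x))) := by
  obtain ⟨K, hK⟩ := exists_regConv_bound hγ
  have hum := aestronglyMeasurable_of_decay hu
  refine tendsto_integral_of_dominated_convergence (fun x => K * ‖decay x ^ 3 * u x‖)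
    (fun n => hum.mul (aestronglyMeasurable_regConv (hε n) hγ)) (hu.norm.const_mul K)
    (fun n => ae_of_all _ fun x => ?_)
    (ae_of_all _ fun x => (tendsto_regConv hε hlim hγ x).const_mul _)
  have h := mul_le_mul_of_nonneg_right (hK _ (hε n) (hε1 n) x) (abs_nonneg (u x))
  have hd := decay_pos x
  rw [norm_mul, norm_mul, Real.norm_eq_abs, Real.norm_eq_abs, Real.norm_eq_abs,
    abs_of_nonneg (by positivity : 0 ≤ decay x ^ 3)]
  linarith

theorem integrable_regKernel_prod {ε : ℝ} (hε : 0 < ε) (hε1 : ε ≤ 1) {γ : Plane → ℝ}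
    (hγ : IsTestFunction γ) {u : Plane → ℝ} (hu : Integrable fun x => decay x ^ 3 * u x) :
    Integrable (fun p : Plane × Plane => u p.2 * (regKernel ε p.1 p.2 * γ p.1))
      (volume.prod volume) := by
  have hum := aestronglyMeasurable_of_decay hu
  have hγi : Integrable fun z => weight z ^ 2 * γ z :=
    ((continuous_weight.pow 2).mul hγ.1.continuous).integrable_of_hasCompactSupport
      hγ.2.mul_left
  have hprod := (hγi.norm.mul_prod hu.norm).const_mul (16 * (ε ^ 2)⁻¹)
  refine hprod.mono' ?_ (ae_of_all _ fun p => ?_)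
  · exact hum.comp_snd.mul ((continuous_regKernel hε).mul
      (hγ.1.continuous.comp continuous_fst)).aestronglyMeasurable
  · have h1 := regKernel_le hε hε1 p.1 p.2
    have h2 := regKernel_nonneg ε p.1 p.2
    have hd := decay_pos p.2
    have hw := weight_pos p.1
    have h3 : decay p.2 ^ 4 ≤ decay p.2 ^ 3 := decay_pow_le (by norm_num) _
    simp only [norm_mul, Real.norm_eq_abs, abs_of_nonneg h2, abs_pow, abs_of_pos hd, abs_of_pos hw]
    calc |u p.2| * (regKernel ε p.1 p.2 * |γ p.1|)
        ≤ |u p.2| * ((16 * (ε ^ 2)⁻¹ * weight p.1 ^ 2 * decay p.2 ^ 3) * |γ p.1|) := by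
          gcongr
          exact h1.trans (by gcongr)
      _ = _ := by ring

theorem integral_regKernel_swap {ε : ℝ} (hε : 0 < ε) (hε1 : ε ≤ 1) {γ : Plane → ℝ}
    (hγ : IsTestFunction γ) {u : Plane → ℝ} (hu : Integrable fun x => decay x ^ 3 * u x) :
    Integrable (fun z => (∫ x, u x * regKernel ε z x) * γ z) ∧
      ∫ z, (∫ x, u x * regKernel ε z x) * γ z = ∫ x, u x * regConv ε γ x := by
  have hi := integrable_regKernel_prod hε hε1 hγ hu
  have h1 : ∀ z, ∫ x, u x * (regKernel ε z x * γ z) = (∫ x, u x * regKernel ε z x) * γ z := by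
    intro z
    rw [← integral_mul_const]
    congr 1
    ext x
    ring
  constructor
  · have := hi.integral_prod_left
    simpa only [h1] using this
  · have h2 := integral_integral_swap (f := fun z x => u x * (regKernel ε z x * γ z)) hi
    simp only [h1, integral_const_mul] at h2
    exact h2

/-! ### The logarithmic potential -/

theorem isKernel_log : IsKernel Real.log where
  measurable := Real.measurable_log
  integrable := by
    rw [integrableOn_Ioo_iff]
    exact intervalIntegral.intervalIntegrable_log'

theorem isKernel_one_add_abs_log : IsKernel fun s => 1 + |Real.log s| where
  measurable := by fun_prop
  integrable := by
    refine Integrable.add ?_ (Integrable.abs isKernel_log.integrable)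
    exact integrableOn_const (by simp)

/-- The regularized chordal distance. -/
def regChord (ε : ℝ) (z x : Plane) : ℝ := regSq ε z x / (weight z * weight x)

/-- The regularized chord lies between the chord and 2, which gives an integrable majorant
independent of ε. -/
theorem abs_log_regChord_le {ε : ℝ} (hε : 0 < ε) (hε1 : ε ≤ 1) {z x : Plane} (hxz : z ≠ x) :
    |Real.log (regChord ε z x)| ≤ 1 + |Real.log (chord z x)| := by
  have hw := mul_pos (weight_pos z) (weight_pos x)
  have hc := chord_pos hxz
  have h1 : chord z x ≤ regChord ε z x := by
    rw [chord, regChord, regSq, norm_sub_rev]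
    gcongr
    nlinarith [sq_nonneg ε]
  have h2 : regChord ε z x ≤ 2 := by
    rw [regChord, div_le_iff₀ hw]
    have := regSq_le_mul_weight hε hε1 z x
    linarith
  have h3 : Real.log (regChord ε z x) ≤ 1 := by
    have := Real.log_le_sub_one_of_pos (hc.trans_le h1)
    linarith
  have h4 : Real.log (chord z x) ≤ Real.log (regChord ε z x) := Real.log_le_log hc h1
  have h5 := neg_abs_le (Real.log (chord z x))
  have h6 := abs_nonneg (Real.log (chord z x))
  rw [abs_le]
  constructor <;> linarith

theorem continuous_log_regChord {ε : ℝ} (hε : 0 < ε) :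
    Continuous fun p : Plane × Plane => Real.log (regChord ε p.1 p.2) := by
  have h : Continuous fun p : Plane × Plane => regSq ε p.1 p.2 := by
    unfold regSq
    fun_prop
  have hw : ∀ p : Plane × Plane, 0 < weight p.1 * weight p.2 := fun p =>
    mul_pos (weight_pos _) (weight_pos _)
  refine Continuous.log (h.div (by fun_prop) fun p => (hw p).ne') fun p => ?_
  exact (div_pos (regSq_pos hε p.1 p.2) (hw p)).ne'

theorem exists_log_regChord_bound {ε : ℝ} (hε : 0 < ε) (hε1 : ε ≤ 1) (z : Plane) :
    ∃ K : ℝ, ∀ x, |Real.log (regChord ε z x)| ≤ K := by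
  have hz := weight_pos z
  set a : ℝ := (2 * (ε ^ 2)⁻¹ * weight z)⁻¹ / weight z with ha
  have ha0 : 0 < a := by positivity
  refine ⟨|Real.log a| + |Real.log 2|, fun x => ?_⟩
  have hx := weight_pos x
  have h1 : regChord ε z x ≤ 2 := by
    rw [regChord, div_le_iff₀ (mul_pos hz hx)]
    have := regSq_le_mul_weight hε hε1 z x
    linarith
  have h2 : a ≤ regChord ε z x := by
    have h3 := weight_le_mul_regSq hε hε1 z x
    have h4 : (2 * (ε ^ 2)⁻¹ * weight z)⁻¹ * weight x ≤ regSq ε z x := by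
      rw [inv_mul_le_iff₀ (by positivity)]
      exact h3
    rw [regChord, ha, div_le_div_iff₀ hz (mul_pos hz hx)]
    calc (2 * (ε ^ 2)⁻¹ * weight z)⁻¹ * (weight z * weight x)
        = ((2 * (ε ^ 2)⁻¹ * weight z)⁻¹ * weight x) * weight z := by ring
      _ ≤ regSq ε z x * weight z := by gcongr
  have h5 := Real.log_le_log ha0 h2
  have h6 := Real.log_le_log (ha0.trans_le h2) h1
  have h7 := neg_abs_le (Real.log a)
  have h8 := le_abs_self (Real.log 2)
  have h9 := abs_nonneg (Real.log a)
  have h10 := abs_nonneg (Real.log 2)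
  rw [abs_le]
  constructor <;> linarith

/-! ### Representation of weak solutions by the logarithmic potential -/

/-- The regularized logarithmic potential on the sphere. -/
def regPot (ε : ℝ) (F : Plane → ℝ) (z : Plane) : ℝ :=
  ∫ x, Real.log (regChord ε z x) * F x ∂sphereMeasure

theorem log_regSq_eq {ε : ℝ} (hε : 0 < ε) (z x : Plane) :
    Real.log (regSq ε z x) =
      Real.log (regChord ε z x) + (Real.log (weight z) + Real.log (weight x)) := by
  rw [regChord, Real.log_div (regSq_pos hε z x).ne'
    (mul_pos (weight_pos z) (weight_pos x)).ne', Real.log_mul (weight_ne_zero z) (weight_ne_zero x)]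
  ring

theorem integrable_log_regChord_mul {ε : ℝ} (hε : 0 < ε) (hε1 : ε ≤ 1) {F : Plane → ℝ}
    (hF : Integrable F sphereMeasure) (z : Plane) :
    Integrable (fun x => Real.log (regChord ε z x) * F x) sphereMeasure := by
  obtain ⟨K, hK⟩ := exists_log_regChord_bound hε hε1 z
  exact hF.bdd_mul ((continuous_log_regChord hε).comp (Continuous.prodMk_right z)).aestronglyMeasurable
    (ae_of_all _ hK)

theorem integrable_mul_regKernel {ε : ℝ} (hε : 0 < ε) (hε1 : ε ≤ 1) {u : Plane → ℝ}
    (hu : Integrable fun x => decay x ^ 3 * u x) (z : Plane) :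
    Integrable fun x => u x * regKernel ε z x := by
  refine integrable_mul_of_decay hu
    ((continuous_regKernel hε).comp (Continuous.prodMk_right z)).aestronglyMeasurable
    (K := 16 * (ε ^ 2)⁻¹ * weight z ^ 2) fun x => ?_
  rw [abs_of_nonneg (regKernel_nonneg _ _ _)]
  have hw := weight_pos z
  exact (regKernel_le hε hε1 z x).trans (mul_le_mul_of_nonneg_left
    (decay_pow_le (by norm_num) x) (by positivity))

/-- The regularized representation formula, up to a constant independent of the base point. -/
theorem integral_regKernel_add_regPot {u F : Plane → ℝ}
    (hu : Integrable fun x => decay x ^ 3 * u x) (hF : Integrable F sphereMeasure)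
    (hF0 : ∫ x, F x ∂sphereMeasure = 0)
    (heq : ∀ ψ, IsTestFunction ψ →
      -∫ x, u x * lap ψ x = ∫ x, (weight x ^ 2)⁻¹ * F x * ψ x)
    {ε : ℝ} (hε : 0 < ε) (hε1 : ε ≤ 1) (z : Plane) :
    (∫ x, u x * regKernel ε z x) + regPot ε F z =
      (∫ x, u x * regKernel ε 0 x) + regPot ε F 0 := by
  obtain ⟨K, h0, h1, h2⟩ := exists_log_sub_bound hε hε1 z
  have hcz := contDiff_log_regSq hε z
  have hc0 := contDiff_log_regSq hε 0
  have hc0' : ContDiff ℝ ∞ fun x => -1 * Real.log (regSq ε 0 x) := contDiff_const.mul hc0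
  -- A single logarithm is not admissible as a test function, since it does not decay; the
  -- difference for the points z and 0 is.
  have h := integral_mul_lap_of_decay hu (integrable_sphereMeasure_iff.1 hF) heq
    (hcz.add hc0') h0 h1 h2
  have hl : ∀ x, u x * lap (fun x => Real.log (regSq ε z x) + -1 * Real.log (regSq ε 0 x)) x =
      u x * regKernel ε z x - u x * regKernel ε 0 x := by
    intro x
    rw [lap_add hcz hc0', lap_const_mul hc0, lap_log_regSq hε, lap_log_regSq hε]
    ring
  have hr : ∀ x, (weight x ^ 2)⁻¹ * F x *
      (Real.log (regSq ε z x) + -1 * Real.log (regSq ε 0 x)) =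
      (weight x ^ 2)⁻¹ * ((Real.log (regChord ε z x) * F x - Real.log (regChord ε 0 x) * F x) +
        (Real.log (weight z) - Real.log (weight 0)) * F x) := by
    intro x
    rw [log_regSq_eq hε, log_regSq_eq hε 0]
    ring
  simp only [hl, hr] at h
  rw [← integral_sphereMeasure fun x =>
    (Real.log (regChord ε z x) * F x - Real.log (regChord ε 0 x) * F x) +
        (Real.log (weight z) - Real.log (weight 0)) * F x] at h
  have hz := integrable_log_regChord_mul hε hε1 hF z
  have h0 := integrable_log_regChord_mul hε hε1 hF 0
  have hs : Integrable (fun x => Real.log (regChord ε z x) * F x -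
      Real.log (regChord ε 0 x) * F x) sphereMeasure := hz.sub h0
  -- The contribution of log w(z) - log w(0) is a constant times the mean of F, which is zero; the
  -- terms log w(x) have already cancelled in the difference.
  rw [integral_sub (integrable_mul_regKernel hε hε1 hu z) (integrable_mul_regKernel hε hε1 hu 0),
    integral_add hs (hF.const_mul _), integral_sub hz h0, integral_const_mul, hF0] at h
  simp only [regPot]
  linarith

theorem ae_prod_ne : ∀ᵐ p : Plane × Plane ∂(sphereMeasure.prod sphereMeasure), p.1 ≠ p.2 := by
  have hm : MeasurableSet {p : Plane × Plane | p.1 ≠ p.2} :=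
    (isClosed_eq continuous_fst continuous_snd).isOpen_compl.measurableSet
  rw [Measure.ae_prod_iff_ae_ae hm]
  refine ae_of_all _ fun x => ?_
  filter_upwards [ae_ne x] with y hy
  exact hy.symm

theorem tendsto_regChord {ε : ℕ → ℝ} (hlim : Tendsto ε atTop (𝓝 0)) (z x : Plane) :
    Tendsto (fun n => regChord (ε n) z x) atTop (𝓝 (chord z x)) := by
  have h : Tendsto (fun n => (‖x - z‖ ^ 2 + ε n ^ 2) / (weight z * weight x)) atTop
      (𝓝 ((‖x - z‖ ^ 2 + 0 ^ 2) / (weight z * weight x))) :=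
    ((hlim.pow 2).const_add _).div_const _
  have h1 : chord z x = (‖x - z‖ ^ 2 + 0 ^ 2) / (weight z * weight x) := by
    rw [chord, norm_sub_rev]
    simp
  rw [h1]
  exact h

theorem integral_eq_integral_sphereMeasure (g : Plane → ℝ) :
    ∫ x, g x = ∫ x, weight x ^ 2 * g x ∂sphereMeasure := by
  rw [integral_sphereMeasure]
  congr 1
  ext x
  have := weight_ne_zero x
  field_simp

/-- Dominated convergence on the product of two spheres, where the regularized kernels converge off
the diagonal, a null set. -/
theorem tendsto_integral_regPot {ε : ℕ → ℝ} (hε : ∀ n, 0 < ε n) (hε1 : ∀ n, ε n ≤ 1)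
    (hlim : Tendsto ε atTop (𝓝 0)) {γ : Plane → ℝ} (hγ : IsTestFunction γ) {F : Plane → ℝ}
    (hF : Integrable F sphereMeasure) :
    (∀ n, Integrable fun z => regPot (ε n) F z * γ z) ∧
    Tendsto (fun n => ∫ z, regPot (ε n) F z * γ z) atTop
      (𝓝 (∫ z, zonal Real.log F z * γ z)) := by
  have hgc : Continuous fun z => weight z ^ 2 * γ z :=
    (continuous_weight.pow 2).mul hγ.1.continuous
  obtain ⟨C, hC⟩ := (hγ.2.mul_left (f := fun z => weight z ^ 2)).exists_bound_of_continuous hgc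
  have hC0 : 0 ≤ C := (norm_nonneg _).trans (hC 0)
  have hdom := ((isKernel_one_add_abs_log.integrable_prod hF).norm).const_mul C
  have hmeas : ∀ k : Plane × Plane → ℝ, AEStronglyMeasurable k (sphereMeasure.prod sphereMeasure) →
      AEStronglyMeasurable (fun p : Plane × Plane =>
        weight p.1 ^ 2 * γ p.1 * (k p * F p.2)) (sphereMeasure.prod sphereMeasure) := fun k hk =>
    (hgc.comp continuous_fst).aestronglyMeasurable.mul (hk.mul hF.aestronglyMeasurable.comp_snd)
  have hbound : ∀ (k : Plane × Plane → ℝ) (p : Plane × Plane),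
      |k p| ≤ 1 + |Real.log (chord p.1 p.2)| →
      ‖weight p.1 ^ 2 * γ p.1 * (k p * F p.2)‖ ≤
        C * ‖(1 + |Real.log (chord p.1 p.2)|) * F p.2‖ := by
    intro k p hk
    rw [norm_mul, norm_mul (k p), norm_mul (1 + |Real.log (chord p.1 p.2)|)]
    have h1 : ‖weight p.1 ^ 2 * γ p.1‖ ≤ C := hC p.1
    have h2 : ‖k p‖ ≤ ‖1 + |Real.log (chord p.1 p.2)|‖ := by
      rw [Real.norm_eq_abs, Real.norm_of_nonneg (by positivity)]
      exact hk
    gcongr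
  have hkn : ∀ n, Integrable (fun p : Plane × Plane =>
      weight p.1 ^ 2 * γ p.1 * (Real.log (regChord (ε n) p.1 p.2) * F p.2))
      (sphereMeasure.prod sphereMeasure) := by
    intro n
    refine hdom.mono' (hmeas _ (continuous_log_regChord (hε n)).aestronglyMeasurable) ?_
    filter_upwards [ae_prod_ne] with p hp
    exact hbound (fun p => Real.log (regChord (ε n) p.1 p.2)) p
      (abs_log_regChord_le (hε n) (hε1 n) hp)
  have hk : Integrable (fun p : Plane × Plane =>
      weight p.1 ^ 2 * γ p.1 * (Real.log (chord p.1 p.2) * F p.2))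
      (sphereMeasure.prod sphereMeasure) := by
    refine hdom.mono' (hmeas (fun p => Real.log (chord p.1 p.2))
      (Real.measurable_log.comp continuous_chord.measurable).aestronglyMeasurable)
      (ae_of_all _ fun p => ?_)
    exact hbound (fun p => Real.log (chord p.1 p.2)) p (by linarith)
  have hiter : ∀ n, ∫ z, regPot (ε n) F z * γ z = ∫ p : Plane × Plane,
      weight p.1 ^ 2 * γ p.1 * (Real.log (regChord (ε n) p.1 p.2) * F p.2)
        ∂(sphereMeasure.prod sphereMeasure) := by
    intro n
    rw [integral_prod _ (hkn n), integral_eq_integral_sphereMeasure]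
    congr 1
    ext z
    simp only [integral_const_mul]
    rw [regPot]
    ring
  have hiter' : ∫ z, zonal Real.log F z * γ z = ∫ p : Plane × Plane,
      weight p.1 ^ 2 * γ p.1 * (Real.log (chord p.1 p.2) * F p.2)
        ∂(sphereMeasure.prod sphereMeasure) := by
    rw [integral_prod _ hk, integral_eq_integral_sphereMeasure]
    congr 1
    ext z
    simp only [integral_const_mul]
    rw [zonal]
    ring
  constructor
  · intro n
    have h := integrable_sphereMeasure_iff.1 (hkn n).integral_prod_left
    refine h.congr (ae_of_all _ fun z => ?_)
    have := weight_ne_zero z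
    simp only [integral_const_mul]
    rw [regPot]
    field_simp
  · simp only [hiter]
    rw [hiter']
    refine tendsto_integral_of_dominated_convergence _ (fun n => (hkn n).aestronglyMeasurable)
      hdom (fun n => ?_) ?_
    · filter_upwards [ae_prod_ne] with p hp
      exact hbound (fun p => Real.log (regChord (ε n) p.1 p.2)) p
        (abs_log_regChord_le (hε n) (hε1 n) hp)
    · filter_upwards [ae_prod_ne] with p hp
      exact (((tendsto_regChord hlim p.1 p.2).log (chord_pos hp).ne').mul_const _).const_mul _

theorem locallyIntegrable_of_integrable_sphereMeasure {h : Plane → ℝ}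
    (hh : Integrable h sphereMeasure) : LocallyIntegrable h volume := by
  have h1 := (integrable_sphereMeasure_iff.1 hh).locallyIntegrable
  have h2 := h1.continuous_mul (continuous_weight.pow 2)
  refine h2.congr (ae_of_all _ fun x => ?_)
  have := weight_ne_zero x
  simp only [Pi.pow_apply]
  field_simp

/-- A weak solution of finite energy of a Poisson equation is, up to a constant, the logarithmic
potential of the right-hand side. -/
theorem exists_ae_eq_zonal_greenKernel {u F : Plane → ℝ} {G : Plane → Plane}
    (hu : HasWeakGradient u G) (hG : MemLp G 2 volume) (hF : Integrable F sphereMeasure)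
    (heq : ∀ ψ, IsTestFunction ψ →
      ∫ x, inner ℝ (G x) (gradient ψ x) = ∫ x, (weight x ^ 2)⁻¹ * F x * ψ x) :
    ∫ x, F x ∂sphereMeasure = 0 ∧
      ∃ e : ℝ, u =ᵐ[sphereMeasure] fun x => e + zonal greenKernel F x := by
  have hF0 : ∫ x, F x ∂sphereMeasure = 0 := by
    rw [integral_sphereMeasure]
    exact integral_eq_zero_of_weak hu hG (integrable_sphereMeasure_iff.1 hF) heq
  refine ⟨hF0, ?_⟩
  have hud : Integrable fun x => decay x ^ 3 * u x := by
    simpa only [weight_rpow_eq_decay] using integrable_weight_mul hu hG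
  have heq' : ∀ ψ, IsTestFunction ψ →
      -∫ x, u x * lap ψ x = ∫ x, (weight x ^ 2)⁻¹ * F x * ψ x := fun ψ hψ => by
    rw [← hu.integral_lap hψ, heq ψ hψ]
  set ε : ℕ → ℝ := fun n => ((n : ℝ) + 1)⁻¹ with hεdef
  have hε : ∀ n, 0 < ε n := fun n => by positivity
  have hε1 : ∀ n, ε n ≤ 1 := fun n => inv_le_one_of_one_le₀ (by simp)
  have hlim : Tendsto ε atTop (𝓝 0) := by
    simpa only [hεdef, one_div] using tendsto_one_div_add_atTop_nhds_zero_nat (𝕜 := ℝ)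
  -- The value common to all base points z at regularization ε n; in the limit it becomes the
  -- additive constant.
  set c : ℕ → ℝ := fun n => (∫ x, u x * regKernel (ε n) 0 x) + regPot (ε n) F 0 with hc
  have key : ∀ γ : Plane → ℝ, IsTestFunction γ →
      Tendsto (fun n => c n * ∫ z, γ z) atTop
        (𝓝 ((∫ x, u x * (4 * Real.pi * γ x)) + ∫ z, zonal Real.log F z * γ z)) := by
    intro γ hγ
    obtain ⟨hVi, hV⟩ := tendsto_integral_regPot hε hε1 hlim hγ hF
    refine ((tendsto_integral_regConv hε hε1 hlim hγ hud).add hV).congr fun n => ?_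
    obtain ⟨hQi, hQ⟩ := integral_regKernel_swap (hε n) (hε1 n) hγ hud
    rw [← hQ, ← integral_add hQi (hVi n), ← integral_const_mul]
    congr 1
    ext z
    rw [← add_mul, integral_regKernel_add_regPot hud hF hF0 heq' (hε n) (hε1 n) z]
  set γ₀ := (mollifier 0).normed volume with hγ₀
  have hone : ∫ z, γ₀ z = 1 := (mollifier 0).integral_normed
  -- Testing with one function of integral one shows that the constants converge; all other test
  -- functions then identify the limit.
  obtain ⟨e, he⟩ : ∃ e, Tendsto c atTop (𝓝 e) :=
    ⟨_, by simpa only [hone, mul_one] using key γ₀ (isTestFunction_mollifier 0)⟩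
  have hV := isKernel_log.integrable_zonal hF
  have hVl := locallyIntegrable_of_integrable_sphereMeasure hV
  have hrep : ∀ᵐ x, 4 * Real.pi * u x + zonal Real.log F x - e = 0 := by
    refine ae_eq_zero_of_integral_contDiff_smul_eq_zero
      (((hu.1.smul (4 * Real.pi)).add hVl).sub (locallyIntegrable_const e)) fun γ hγ hγc => ?_
    have hγt : IsTestFunction γ := ⟨hγ, hγc⟩
    have hlimit := tendsto_nhds_unique (key γ hγt) (he.mul_const _)
    have i1 : Integrable fun x => u x * (4 * Real.pi * γ x) := by
      refine ((hγt.integrable_mul hu.1).const_mul (4 * Real.pi)).congr (ae_of_all _ fun x => ?_)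
      ring
    have i2 := hγt.integrable_mul hVl
    have i3 : Integrable fun x => e * γ x :=
      (hγ.continuous.integrable_of_hasCompactSupport hγc).const_mul e
    rw [← integral_const_mul, ← integral_add i1 i2] at hlimit
    have i12 : Integrable fun x => u x * (4 * Real.pi * γ x) + zonal Real.log F x * γ x := i1.add i2
    have h0 := integral_sub i12 i3
    rw [hlimit, sub_self] at h0
    rw [← h0]
    congr 1
    ext x
    simp only [smul_eq_mul]
    ring
  refine ⟨(4 * Real.pi)⁻¹ * e, ae_eq_sphereMeasure.2 ?_⟩
  filter_upwards [hrep] with x hx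
  have hg : zonal greenKernel F x = -(4 * Real.pi)⁻¹ * zonal Real.log F x := by
    simp only [zonal, greenKernel, mul_assoc]
    rw [integral_const_mul]
  rw [hg]
  have := Real.pi_pos
  field_simp
  linarith

end Choquard

end

noncomputable section

namespace Choquard

open Set Filter Topology
open scoped ENNReal

/-! ### Calculus of the linear forms on the sphere -/

/-- The affine function `M` with `lin v = v₂ + M / weight`. -/
def linNum (v : Fin 3 → ℝ) (x : Plane) : ℝ := 2 * v 0 * x 0 + (2 * v 1 * x 1 + -2 * v 2)

theorem lin_eq (v : Fin 3 → ℝ) : lin v = fun x => v 2 + linNum v x / weight x := by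
  funext x
  have hw := weight_ne_zero x
  rw [lin, Fin.sum_univ_three, stereo_zero_apply, stereo_one_apply, stereo_two_apply, linNum,
    norm_sq_eq_coord]
  rw [weight_eq_coord] at *
  field_simp
  ring

theorem contDiff_linNum (v : Fin 3 → ℝ) : ContDiff ℝ ∞ (linNum v) := by
  unfold linNum
  fun_prop

theorem contDiff_lin (v : Fin 3 → ℝ) : ContDiff ℝ ∞ (lin v) := by
  rw [lin_eq]
  exact contDiff_const.add ((contDiff_linNum v).div contDiff_weight weight_ne_zero)

theorem pd_weight (i : Fin 2) (x : Plane) : pd i weight x = 2 * x i := by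
  have h : weight = regSq 1 0 := by
    funext y
    simp [weight, regSq, add_comm]
  simp [h, pd_regSq]

theorem pd_linNum (v : Fin 3 → ℝ) (i : Fin 2) (x : Plane) :
    pd i (linNum v) x = 2 * v i.castSucc := by
  have h0 : DifferentiableAt ℝ (fun y : Plane => y 0) x := by fun_prop
  have h1 : DifferentiableAt ℝ (fun y : Plane => y 1) x := by fun_prop
  have h0' : DifferentiableAt ℝ (fun y : Plane => 2 * v 0 * y 0) x := h0.const_mul _
  have h1' : DifferentiableAt ℝ (fun y : Plane => 2 * v 1 * y 1) x := h1.const_mul _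
  unfold linNum
  rw [pd_add h0' (h1'.add_const _), pd_add h1' (differentiableAt_const _), pd_const_mul h0,
    pd_const_mul h1, pd_const, pd_coord, pd_coord]
  fin_cases i <;> simp

theorem pd_lin (v : Fin 3 → ℝ) (i : Fin 2) :
    pd i (lin v) = fun x =>
      (2 * v i.castSucc * weight x + -2 * (x i * linNum v x)) / weight x ^ 2 := by
  funext x
  have hM : DifferentiableAt ℝ (linNum v) x := (contDiff_linNum v).differentiable (by simp) x
  have hW : DifferentiableAt ℝ weight x := contDiff_weight.differentiable one_ne_zero x
  have hw := weight_ne_zero x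
  have hD : DifferentiableAt ℝ (fun y => linNum v y / weight y) x :=
    ((contDiff_linNum v).div contDiff_weight weight_ne_zero).differentiable (by simp) x
  rw [lin_eq, pd_add (differentiableAt_const _) hD, pd_const, pd_div hM hW hw,
    pd_linNum, pd_weight]
  ring

theorem pd_pd_lin (v : Fin 3 → ℝ) (i : Fin 2) (x : Plane) :
    pd i (pd i (lin v)) x = (-2 * linNum v x * weight x -
      4 * x i * (2 * v i.castSucc * weight x - 2 * x i * linNum v x)) / weight x ^ 3 := by
  have hM : DifferentiableAt ℝ (linNum v) x := (contDiff_linNum v).differentiable (by simp) x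
  have hW : DifferentiableAt ℝ weight x := contDiff_weight.differentiable one_ne_zero x
  have hX : DifferentiableAt ℝ (fun y : Plane => y i) x := by fun_prop
  have hw := weight_ne_zero x
  have hA : DifferentiableAt ℝ (fun y => 2 * v i.castSucc * weight y) x := hW.const_mul _
  have hB : DifferentiableAt ℝ (fun y => y i * linNum v y) x := hX.mul hM
  have hB' : DifferentiableAt ℝ (fun y => -2 * (y i * linNum v y)) x := hB.const_mul _
  have hS : DifferentiableAt ℝ
      (fun y => 2 * v i.castSucc * weight y + -2 * (y i * linNum v y)) x := hA.add hB'
  have hW2 : DifferentiableAt ℝ (fun y => weight y ^ 2) x := hW.pow 2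
  rw [pd_lin, pd_div hS hW2 (pow_ne_zero 2 hw), pd_add hA hB',
    pd_const_mul hW, pd_const_mul hB, pd_mul hX hM, pd_comp (F := fun s => s ^ 2) hW
      (hasDerivAt_pow 2 (weight x)), pd_weight, pd_linNum, pd_coord]
  simp only [if_true]
  field_simp
  ring

/-- Linear functions have eigenvalue 2 for the Laplacian of the sphere, whose metric is 4 w⁻² |dx|²;
hence 8. -/
theorem lap_lin (v : Fin 3 → ℝ) (x : Plane) :
    lap (lin v) x = (weight x ^ 2)⁻¹ * (-8 * lin v x) := by
  have hw := weight_ne_zero x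
  simp only [lap, pd_pd_lin]
  simp only [Fin.sum_univ_two, lin_eq, linNum]
  simp only [Fin.castSucc_zero, Fin.castSucc_one]
  rw [weight_eq_coord] at *
  field_simp
  ring

/-- The tangential gradient of ⟨v, ·⟩ has squared length |v|² - ⟨v, ·⟩², and the conformal factor is
4 w⁻². -/
theorem sum_pd_lin_sq (v : Fin 3 → ℝ) (x : Plane) :
    ∑ i, pd i (lin v) x ^ 2 =
      (weight x ^ 2)⁻¹ * (4 * (∑ i, v i ^ 2) - 4 * lin v x ^ 2) := by
  have hw := weight_ne_zero x
  simp only [pd_lin]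
  simp only [Fin.sum_univ_two, Fin.sum_univ_three, lin_eq, linNum]
  simp only [Fin.castSucc_zero, Fin.castSucc_one]
  rw [weight_eq_coord] at *
  field_simp
  ring

/-- The points 0, e₀, e₁ of the plane correspond to the south pole and two orthogonal equatorial
points, a basis of ℝ³. -/
theorem eq_of_lin_eq {v w : Fin 3 → ℝ} (h : ∀ x, lin v x = lin w x) : v = w := by
  have h0 := h 0
  have h1 := h (EuclideanSpace.single 0 1)
  have h2 := h (EuclideanSpace.single 1 1)
  simp only [lin, Fin.sum_univ_three, stereo_zero_apply, stereo_one_apply, stereo_two_apply,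
    weight] at h0 h1 h2
  norm_num at h0 h1 h2
  ext i
  fin_cases i <;> assumption

/-- The kernel 1 - 2s is the inner product of the two unit vectors, so its zonal operator is given
by the Gram matrix of the coordinates. Its eigenvalue π ∫ (1 - 2s)² ds = π / 3 identifies that
matrix. -/
theorem integral_lin_sq (v : Fin 3 → ℝ) :
    ∫ x, lin v x ^ 2 ∂sphereMeasure = Real.pi / 3 * ∑ i, v i ^ 2 := by
  have hk : IsKernel fun s => 1 - 2 * s :=
    ⟨by fun_prop, by
      rw [integrableOn_Ioo_iff]
      exact Continuous.intervalIntegrable (by fun_prop) _ _⟩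
  have hint : ∀ (i : Fin 3) (a : ℝ),
      Integrable (fun y => a * (stereo y i * lin v y)) sphereMeasure := fun i a =>
    ((integrable_lin v).bdd_mul (continuous_stereo i).aestronglyMeasurable
      (ae_of_all _ fun x => abs_stereo_le x i)).const_mul a
  have hc : ∫ s in Ioo (0 : ℝ) 1, (1 - 2 * s) * (1 - 2 * s) = 1 / 3 := by
    rw [setIntegral_Ioo_eq]
    have h : ∀ s : ℝ, (1 - 2 * s) * (1 - 2 * s) = 1 - 4 * s ^ 1 + 4 * s ^ 2 := fun s => by ring
    simp only [h]
    rw [intervalIntegral.integral_add (Continuous.intervalIntegrable (by fun_prop) _ _)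
      (Continuous.intervalIntegrable (by fun_prop) _ _), intervalIntegral.integral_sub
      (Continuous.intervalIntegrable (by fun_prop) _ _)
      (Continuous.intervalIntegrable (by fun_prop) _ _)]
    simp only [intervalIntegral.integral_const_mul, integral_pow,
      intervalIntegral.integral_const, smul_eq_mul]
    norm_num
  have hg : (fun i => ∫ y, stereo y i * lin v y ∂sphereMeasure) =
      fun i => Real.pi / 3 * v i := by
    refine eq_of_lin_eq fun x => ?_
    have h := hk.zonal_lin v x
    rw [hc] at h
    have h1 : lin (fun i => Real.pi / 3 * v i) x = Real.pi * (1 / 3) * lin v x := by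
      simp only [lin, Finset.mul_sum]
      exact Finset.sum_congr rfl fun i _ => by ring
    have h2 : lin (fun i => ∫ y, stereo y i * lin v y ∂sphereMeasure) x =
        zonal (fun s => 1 - 2 * s) (lin v) x := by
      have h3 : ∀ y, (1 - 2 * chord x y) * lin v y =
          ∑ i, stereo x i * (stereo y i * lin v y) := fun y => by
        rw [chord_eq]
        simp only [← mul_assoc, ← Finset.sum_mul]
        ring
      simp only [zonal, h3]
      rw [integral_finsetSum _ fun i _ => hint i _, lin]
      refine Finset.sum_congr rfl fun i _ => ?_
      rw [integral_const_mul, mul_comm]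
    rw [h1, h2, h]
  have hsq : ∀ y, lin v y ^ 2 = ∑ i, v i * (stereo y i * lin v y) := fun y => by
    simp only [← mul_assoc, ← Finset.sum_mul]
    rw [← lin, sq]
  simp only [hsq]
  rw [integral_finsetSum _ fun i _ => hint i _, Finset.mul_sum]
  refine Finset.sum_congr rfl fun i _ => ?_
  rw [integral_const_mul, congrFun hg i]
  ring

/-! ### Weighted norms -/

theorem hasWeakGradient_of_contDiff {u : Plane → ℝ} (hu : ContDiff ℝ ∞ u) :
    HasWeakGradient u fun x => WithLp.toLp 2 fun i => pd i u x := by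
  have hc : Continuous fun x => (WithLp.toLp 2 fun i => pd i u x : Plane) :=
    (PiLp.continuous_toLp 2 _).comp (continuous_pi fun i => (contDiff_pd hu i).continuous)
  refine ⟨hu.continuous.locallyIntegrable, hc.locallyIntegrable, fun ψ hψ i => ?_⟩
  refine integral_mul_fderiv_eq_neg_fderiv_mul_of_integrable
    (hψ.integrable_mul (contDiff_pd hu i).continuous.locallyIntegrable)
    ((hψ.pd i).integrable_mul hu.continuous.locallyIntegrable)
    (hψ.integrable_mul hu.continuous.locallyIntegrable)
    (fun x _ => hu.differentiable (by simp) x) (fun x _ => hψ.1.differentiable (by simp) x)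

theorem toReal_eLpNorm_two_sq {E : Type*} [NormedAddCommGroup E] {f : Plane → E}
    (hf : MemLp f 2 volume) : (eLpNorm f 2 volume).toReal ^ 2 = ∫ x, ‖f x‖ ^ 2 := by
  have h0 : 0 ≤ ∫ x, ‖f x‖ ^ 2 := integral_nonneg fun x => by positivity
  rw [hf.eLpNorm_eq_integral_rpow_norm (by simp) (by simp)]
  simp only [ENNReal.toReal_ofNat, Real.rpow_ofNat]
  rw [ENNReal.toReal_ofReal (by positivity), ← Real.rpow_natCast, ← Real.rpow_mul h0]
  norm_num

theorem integrable_lin_sq (v : Fin 3 → ℝ) :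
    Integrable (fun x => lin v x ^ 2) sphereMeasure := by
  refine integrable_of_continuous_bounded ((continuous_lin v).pow 2)
    (C := (∑ i, |v i|) ^ 2) fun x => ?_
  rw [abs_pow]
  gcongr
  exact abs_lin_le v x

theorem weighted_lin_sq (v : Fin 3 → ℝ) (x : Plane) :
    weighted (lin v) x ^ 2 = (weight x ^ 2)⁻¹ * lin v x ^ 2 := by
  rw [weighted, ← weight, div_pow, div_eq_inv_mul]

theorem memL2w_lin (v : Fin 3 → ℝ) : MemL2w (lin v) := by
  have hc : Continuous (weighted (lin v)) := (continuous_lin v).div continuous_weight weight_ne_zero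
  rw [MemL2w, memLp_two_iff_integrable_sq hc.aestronglyMeasurable]
  simp only [weighted_lin_sq]
  exact integrable_sphereMeasure_iff.1 (integrable_lin_sq v)

theorem normL2w_lin_sq (v : Fin 3 → ℝ) :
    normL2w (lin v) ^ 2 = Real.pi / 3 * ∑ i, v i ^ 2 := by
  rw [normL2w, toReal_eLpNorm_two_sq (memL2w_lin v), ← integral_lin_sq, integral_sphereMeasure]
  simp only [Real.norm_eq_abs, sq_abs, weighted_lin_sq]

theorem weighted_congr {u v : Plane → ℝ} (h : u =ᵐ[volume] v) :
    weighted u =ᵐ[volume] weighted v := by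
  filter_upwards [h] with x hx
  rw [weighted, weighted, hx]

theorem normL2w_congr {u v : Plane → ℝ} (h : u =ᵐ[volume] v) : normL2w u = normL2w v := by
  rw [normL2w, normL2w, eLpNorm_congr_ae (weighted_congr h)]

theorem memL2w_congr {u v : Plane → ℝ} (h : u =ᵐ[volume] v) : MemL2w u ↔ MemL2w v :=
  memLp_congr_ae (weighted_congr h)

/-- Linear forms on the sphere are eigenfunctions: their Dirichlet energy is eight times the square
of the weighted norm. -/
theorem eLpNorm_weakGradient_sq {u : Plane → ℝ} (hu : MemHomogeneousH1 u) {v : Fin 3 → ℝ}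
    (h : u =ᵐ[volume] lin v) :
    (eLpNorm (weakGradient u) 2 volume).toReal ^ 2 = 8 * normL2w u ^ 2 := by
  obtain ⟨G, hG, hG2⟩ := hu
  have hL := (hasWeakGradient_of_contDiff (contDiff_lin v)).congr h.symm
  have hm := (memLp_congr_ae (hG.ae_eq hL)).1 hG2
  have hn : ∀ x, ‖(WithLp.toLp 2 fun i => pd i (lin v) x : Plane)‖ ^ 2 =
      (weight x ^ 2)⁻¹ * (4 * (∑ i, v i ^ 2) - 4 * lin v x ^ 2) := fun x => by
    rw [EuclideanSpace.real_norm_sq_eq, ← sum_pd_lin_sq]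
  rw [eLpNorm_congr_ae (weakGradient_ae_eq hL), toReal_eLpNorm_two_sq hm]
  simp only [hn]
  -- The energy is 4π |v|² - (4π / 3) |v|² = 8 (π / 3) |v|².
  rw [← integral_sphereMeasure fun x => 4 * (∑ i, v i ^ 2) - 4 * lin v x ^ 2,
    integral_sub (integrable_const _) ((integrable_lin_sq v).const_mul 4),
    integral_const_mul 4 fun x => lin v x ^ 2,
    integral_lin_sq, integral_const, sphereMeasure_real_univ, normL2w_congr h, normL2w_lin_sq,
    smul_eq_mul]
  ring

/-- The squared H¹ norm is 8 + 1 times the squared weighted norm, and 8 ≤ 4 (4 - α) is the condition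
α ≤ 2. -/
theorem normH1w_le {α : ℝ} (hα : α ≤ 2) {u : Plane → ℝ} (hu : MemHomogeneousH1 u) {v : Fin 3 → ℝ}
    (h : u =ᵐ[volume] lin v) : normH1w u ≤ √(4 * (4 - α) + 1) * normL2w u := by
  have h0 : 0 ≤ normL2w u := ENNReal.toReal_nonneg
  rw [normH1w, eLpNorm_weakGradient_sq hu h, ← Real.sqrt_sq h0, ← Real.sqrt_mul (by linarith),
    Real.sqrt_sq h0]
  exact Real.sqrt_le_sqrt (by nlinarith [sq_nonneg (normL2w u)])

/-! ### Derivatives of the bubbles -/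

theorem hasDerivAt_bubble_translation {α : ℝ} (hα : α ∈ Ioo (0 : ℝ) 2) (x : Plane) (j : Fin 2) :
    HasDerivAt (fun t : ℝ => bubble α 1 (EuclideanSpace.single j t) x)
      (kernelTranslation α j x) 0 := by
  have hC := (bubbleConst_pos hα.2).ne'
  have hw : 1 + ‖x‖ ^ 2 ≠ 0 := weight_ne_zero x
  have hq : ∀ t : ℝ, 1 + 1 ^ 2 * ‖x - EuclideanSpace.single j t‖ ^ 2 =
      1 + ‖x‖ ^ 2 - 2 * x j * t + t ^ 2 := fun t => by
    rw [norm_sq_eq_coord, norm_sq_eq_coord]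
    fin_cases j <;> simp <;> ring
  have hd : HasDerivAt (fun t : ℝ => 1 + ‖x‖ ^ 2 - 2 * x j * t + t ^ 2) (-(2 * x j)) 0 := by
    have := (((hasDerivAt_id' (0 : ℝ)).const_mul (2 * x j)).const_sub (1 + ‖x‖ ^ 2)).fun_add
      (hasDerivAt_pow 2 (0 : ℝ))
    exact this.congr_deriv (by simp)
  simp only [bubble, hq]
  have h1 := ((hasDerivAt_const (0 : ℝ) (bubbleConst α * 1)).fun_div hd (by simpa using hw)).log
    (by simp [hC, hw])
  refine (h1.const_mul ((4 - α) / 2)).congr_deriv ?_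
  rw [kernelTranslation]
  simp
  field_simp

theorem hasDerivAt_bubble_dilation {α : ℝ} (hα : α ∈ Ioo (0 : ℝ) 2) (x : Plane) :
    HasDerivAt (fun μ : ℝ => bubble α μ 0 x) (kernelDilation α x) 1 := by
  have hC := (bubbleConst_pos hα.2).ne'
  have hw : 1 + ‖x‖ ^ 2 ≠ 0 := weight_ne_zero x
  have hd : HasDerivAt (fun μ : ℝ => 1 + μ ^ 2 * ‖x‖ ^ 2) (2 * ‖x‖ ^ 2) 1 := by
    simpa using ((hasDerivAt_pow 2 (1 : ℝ)).mul_const (‖x‖ ^ 2)).const_add 1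
  simp only [bubble, sub_zero]
  have h1 := (((hasDerivAt_id' (1 : ℝ)).const_mul (bubbleConst α)).fun_div hd (by simpa using hw)).log
    (by simp [hC, hw])
  refine (h1.const_mul ((4 - α) / 2)).congr_deriv ?_
  rw [kernelDilation]
  simp only [mul_one, one_pow, one_mul]
  field_simp
  ring

end Choquard

end

noncomputable section

namespace Choquard

open Set Filter Topology

/-! ### Classification of the weak solutions -/

theorem exists_ae_eq_lin {α : ℝ} (hα : α ∈ Ioo (0 : ℝ) 2) {φ : Plane → ℝ}
    (hφ : MemHomogeneousH1 φ) (hsol : IsWeakSolution α φ) : ∃ v, φ =ᵐ[volume] lin v := by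
  obtain ⟨G, hG, hG2⟩ := hφ
  obtain ⟨G', hG', heq⟩ := hsol
  -- The density of the measure is decay⁴, stronger than the decay³ supplied by the growth estimate.
  have hφi : Integrable φ sphereMeasure := by
    have hd : Integrable fun x => decay x ^ 3 * φ x := by
      simpa only [weight_rpow_eq_decay] using integrable_weight_mul hG hG2
    rw [integrable_sphereMeasure_iff]
    refine (integrable_mul_of_decay hd (continuous_decay.pow 4).aestronglyMeasurable
      (K := 1) fun x => ?_).congr (ae_of_all _ fun x => ?_)
    · rw [one_mul, Pi.pow_apply, abs_of_nonneg (pow_nonneg (decay_pos x).le 4)]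
      exact decay_pow_le (by norm_num) x
    · have h4 : decay x ^ 4 = (weight x ^ 2)⁻¹ := by
        rw [show decay x ^ 4 = (decay x ^ 2) ^ 2 by ring, decay_sq, inv_pow]
      simp only [Pi.pow_apply, h4]
      ring
  have H := isLinearization hα
  have hF := H.integrable_affine hφi
  obtain ⟨hmean, e, he⟩ := exists_ae_eq_zonal_greenKernel hG hG2 hF fun ψ hψ => by
    simp only [← linearizedRHS_eq hα]
    rw [← heq ψ hψ]
    -- The weak gradient in the equation need not be the square integrable one, but the two agree
    -- almost everywhere.
    refine integral_congr_ae ?_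
    filter_upwards [hG.ae_eq hG'] with x hx
    rw [hx]
  obtain ⟨v, hv⟩ := H.rigidity ⟨hφi, e, he⟩ hmean
  exact ⟨v, ae_eq_sphereMeasure.1 hv⟩

/-! ### Explicit formulas for linear solutions -/

theorem exp_stdBubble_eq {α : ℝ} (hα : α < 2) (x : Plane) :
    Real.exp (4 / (4 - α) * stdBubble α x) = bubbleConst α ^ 2 * (weight x ^ 2)⁻¹ := by
  have h : 4 / (4 - α) * ((4 - α) / 2) = 2 := by
    have : 4 - α ≠ 0 := by linarith
    field_simp
    norm_num
  rw [exp_mul_stdBubble hα, h, Real.rpow_neg (weight_pos x).le, Real.rpow_ofNat, Real.rpow_ofNat]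

theorem integral_weight_mul_lin (v : Fin 3 → ℝ) (c : ℝ) :
    Integrable (fun x => (weight x ^ 2)⁻¹ * (c * lin v x)) ∧
      ∫ x, (weight x ^ 2)⁻¹ * (c * lin v x) = 0 := by
  refine ⟨integrable_sphereMeasure_iff.1 ((integrable_lin v).const_mul c), ?_⟩
  rw [← integral_sphereMeasure fun x => c * lin v x, integral_const_mul,
    IsLinearization.integral_lin, mul_zero]

/-- The translation kernels are (4 - α) / 2 times the horizontal coordinates, and the dilation
kernel is -(4 - α) / 2 times the vertical one. -/
theorem lin_eq_sum_kernel {α : ℝ} (hα : α < 2) (v : Fin 3 → ℝ) (x : Plane) :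
    lin v x = (∑ j : Fin 2, 2 * v j.castSucc / (4 - α) * kernelTranslation α j x) +
      -(2 * v 2) / (4 - α) * kernelDilation α x := by
  have h4 : 4 - α ≠ 0 := by linarith
  have hw : 1 + ‖x‖ ^ 2 ≠ 0 := weight_ne_zero x
  simp only [lin, Fin.sum_univ_two, Fin.sum_univ_three, kernelTranslation, kernelDilation, weight,
    stereo_zero_apply, stereo_one_apply, stereo_two_apply, Fin.castSucc_zero, Fin.castSucc_one]
  field_simp
  ring

end Choquard

end

/-- Weak solutions in `Ḣ¹(ℝ²)` of the linearized equation. Such a `φ` is determined up to null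
sets; `φ'` is its smooth representative. -/
theorem corollary1p2 (α : ℝ) (hα : α ∈ Set.Ioo (0 : ℝ) 2) (φ : Choquard.Plane → ℝ)
    (hφ : Choquard.MemHomogeneousH1 φ) (hsol : Choquard.IsWeakSolution α φ) :
    MemLp φ ⊤ volume ∧
    (∃ φ' : Choquard.Plane → ℝ, φ =ᵐ[volume] φ' ∧ ContDiff ℝ ∞ φ' ∧
      (Integrable (Laplacian.laplacian φ') volume ∧
        Integrable (fun x => Real.exp (4 / (4 - α) * Choquard.stdBubble α x) * φ' x) volume ∧
        -∫ x, Laplacian.laplacian φ' x =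
          4 * (4 - α) / Choquard.bubbleConst α ^ 2 *
            ∫ x, Real.exp (4 / (4 - α) * Choquard.stdBubble α x) * φ' x ∧
        4 * (4 - α) / Choquard.bubbleConst α ^ 2 *
            ∫ x, Real.exp (4 / (4 - α) * Choquard.stdBubble α x) * φ' x = 0) ∧
      ∃ (a : Fin 2 → ℝ) (b : ℝ), ∀ x : Choquard.Plane,
        φ' x = (∑ j, a j * Choquard.kernelTranslation α j x) + b * Choquard.kernelDilation α x) ∧
    (∀ x : Choquard.Plane,
      (∀ j : Fin 2, HasDerivAt (fun t : ℝ => Choquard.bubble α 1 (EuclideanSpace.single j t) x)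
        (Choquard.kernelTranslation α j x) 0) ∧
      HasDerivAt (fun μ : ℝ => Choquard.bubble α μ 0 x) (Choquard.kernelDilation α x) 1) ∧
    Choquard.MemH1w φ ∧
    Choquard.normH1w φ ≤ Real.sqrt (4 * (4 - α) + 1) * Choquard.normL2w φ := by
  obtain ⟨v, hv⟩ := Choquard.exists_ae_eq_lin hα hφ hsol
  have hlap : Laplacian.laplacian (Choquard.lin v) =
      fun x => (Choquard.weight x ^ 2)⁻¹ * (-8 * Choquard.lin v x) := by
    funext x
    rw [Choquard.laplacian_eq_lap (Choquard.contDiff_lin v), Choquard.lap_lin]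
  have hexp : (fun x => Real.exp (4 / (4 - α) * Choquard.stdBubble α x) * Choquard.lin v x) =
      fun x => (Choquard.weight x ^ 2)⁻¹ * (Choquard.bubbleConst α ^ 2 * Choquard.lin v x) := by
    funext x
    rw [Choquard.exp_stdBubble_eq hα.2]
    ring
  -- Both the Laplacian and the exponential density times the solution are multiples of w⁻² `lin v`,
  -- whose integral is the mean of a linear function on the sphere.
  obtain ⟨hi₁, h₁⟩ := Choquard.integral_weight_mul_lin v (-8)
  obtain ⟨hi₂, h₂⟩ := Choquard.integral_weight_mul_lin v (Choquard.bubbleConst α ^ 2)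
  refine ⟨?_, ⟨Choquard.lin v, hv, Choquard.contDiff_lin v, ?_, _, _,
    Choquard.lin_eq_sum_kernel hα.2 v⟩, fun x =>
    ⟨Choquard.hasDerivAt_bubble_translation hα x, Choquard.hasDerivAt_bubble_dilation hα x⟩,
    ⟨hφ, (Choquard.memL2w_congr hv).2 (Choquard.memL2w_lin v)⟩,
    Choquard.normH1w_le hα.2.le hφ hv⟩
  · exact (memLp_congr_ae hv).2 (memLp_top_of_bound (Choquard.continuous_lin v).aestronglyMeasurable
      _ (Filter.Eventually.of_forall (Choquard.abs_lin_le v)))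
  · rw [hlap, hexp]
    exact ⟨hi₁, hi₂, by rw [h₁, h₂]; simp, by rw [h₂, mul_zero]⟩
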